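/- **Conventions.** $\Delta$ is the simplex category, $\mathsf{Cat}$ the category of small categories, and $\mathrm{Ps}[\Delta^{op\,m},\mathsf{Cat}]$ the category of pseudo-functors $\Delta^{op\,m}=(\Delta^{op})^m\to\mathsf{Cat}$ and pseudo-natural transformations. Let $p:\mathsf{Cat}\to\mathsf{Set}$ be the functor of isomorphism classes of objects. For $X\in[\Delta^{op\,m},\mathsf{Cat}]$ put $\bar pX=p\circ X\in[\Delta^{op\,m},\mathsf{Set}]$ and, if $m\ge1$, $X_s=X(s,-,\dots,-)\in[\Delta^{op\,(m-1)},\mathsf{Cat}]$; so $X$ is a simplicial object $s\mapsto X_s$, with Segal maps $X_k\to X_1\times_{X_0}\overset{k}{\cdots}\times_{X_0}X_1$, $k\geq 2$. An $n$-fold category is identified with its image under the fully faithful functor $J_n$ into $[\Delta^{op\,(n-1)},\mathsf{Cat}]$ (nerves in the first $n-1$ directions); the image consists of the diagrams all of whose Segal maps are isomorphisms. For $n\ge 2$ we say that $S\in[\Delta^{op\,(n-1)},\mathsf{Set}]$ *is the multinerve of* $Y\in[\Delta^{op\,(n-2)},\mathsf{Cat}]$ if $S$ is isomorphic to the diagram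 obtained from $Y$ by taking nerves of categories in the last direction; $Y$ is then unique up to isomorphism. If $\bar pX$ is the multinerve of $Y$, write $p^{(n)}X=Y$; also $p^{(1)}=p$. **Homotopically discrete $n$-fold categories** $\mathsf{Cat}_{hd}^n\subset[\Delta^{op\,(n-1)},\mathsf{Cat}]$. $\mathsf{Cat}^1_{hd}$ consists of the categories that are equivalence relations. For $n\ge2$, $X\in\mathsf{Cat}_{hd}^n$ iff all $X_s\in\mathsf{Cat}_{hd}^{n-1}$, all Segal maps $X_k\to X_1\times_{X_0}\cdots\times_{X_0}X_1$ ($k\ge2$) are isomorphisms, and $\bar pX$ is the multinerve of some $p^{(n)}X\in\mathsf{Cat}_{hd}^{n-1}$. For $X\in\mathsf{Cat}_{hd}^n$ let $X^d$ be the set $p^{(1)}p^{(2)}\cdots p^{(n)}X$, regarded as a constant diagram of discrete categories, and $\gamma:X\to X^d$ the natural map (iterated passage to isomorphism classes). **Weakly globular $n$-fold categories** $\mathsf{Cat}_{wg}^n\subset[\Delta^{op\,(n-1)},\mathsf{Cat}]$ **and $n$-equivalences** (full subcategory, defined inductively). $\mathsf{Cat}^1_{wg}=\mathsf{Cat}$,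 and $1$-equivalences are equivalences of categories. For $n\ge2$, $X\in\mathsf{Cat}_{wg}^n$ iff all $X_s\in\mathsf{Cat}_{wg}^{n-1}$ and: (a) $X_0\in\mathsf{Cat}_{hd}^{n-1}$; (b) the Segal maps $X_k\to X_1\times_{X_0}\cdots\times_{X_0}X_1$ ($k\ge2$) are isomorphisms; (c) the induced Segal maps $X_k\to X_1\times_{X_0^d}\cdots\times_{X_0^d}X_1$ ($k\ge2$) are $(n-1)$-equivalences; (d) $\bar pX$ is the multinerve of some $p^{(n)}X\in\mathsf{Cat}_{wg}^{n-1}$. A map $f:X\to Y$ is an $n$-equivalence if for all $a,b\in X_0^d$ the map $f(a,b):X(a,b)\to Y(fa,fb)$ is an $(n-1)$-equivalence, where $X(a,b)$ is the fibre over $(a,b)$ of $X_1\to X_0\times X_0\xrightarrow{\gamma\times\gamma}X_0^d\times X_0^d$, and $p^{(n)}f$ is an $(n-1)$-equivalence. **Segalic pseudo-functors.** For a multi-index $k$ and a direction $i$ write $k(s,i)$ for $k$ with $k_i$ replaced by $s$. For $m\ge1$, $\mathrm{SegPs}[\Delta^{op\,m},\mathsf{Cat}]$ is the full subcategory of $\mathrm{Ps}[\Delta^{op\,m},\mathsf{Cat}]$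 of those $H$ such that: (a) $H_{k(0,i)}$ is a discrete category for all $k$ and $1\le i\le m$; (b) for all $k$, all $i$, and $k_i\ge2$ the Segal map $H_k\to H_{k(1,i)}\times_{H_{k(0,i)}}\overset{k_i}{\cdots}\times_{H_{k(0,i)}}H_{k(1,i)}$ (which exists by (a)) is an isomorphism of categories; (c) the strict functor $\bar pH=p\circ H\in[\Delta^{op\,m},\mathsf{Set}]$ is the multinerve of a weakly globular $m$-fold category. (For $m=1$, condition (c) follows from (a) and (b).) **Strictification.** For a pseudo-functor $H$, let $(TUH)_k=\coprod_{r}\coprod_{f:r\to k\text{ in }\Delta^{op\,m}}H_r$, let $h_k:(TUH)_k\to H_k$ be $H(f)$ on the summand indexed by $f$, and factor $h_k=g_k\circ v_k$, where $v_k:(TUH)_k\to L_k$ is bijective on objects and $g_k:L_k\to H_k$ is fully faithful. Let $\mathrm{St}\,H$ be the strict functor $k\mapsto L_k$ for which $v:TUH\to \mathrm{St}\,H$ is strictly natural and the $g_k$ form a pseudo-natural transformation $g:\mathrm{St}\,H\to H$ whose constraints are the composition constraints of $H$. A pseudo-natural transformation $\theta:H\to H'$ is sent to the strict transformation given by $(r,f,x)\mapsto(r,f,\theta_rx)$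 on objects and by conjugating $\theta_k$ with the constraints of $\theta$ on morphisms. This is the Power–Lack strictification functor $\mathrm{St}:\mathrm{Ps}[\Delta^{op\,m},\mathsf{Cat}]\to[\Delta^{op\,m},\mathsf{Cat}]$. **Theorem.** Let $n\ge2$. The functor $\mathrm{St}:\mathrm{Ps}[\Delta^{op\,(n-1)},\mathsf{Cat}]\to[\Delta^{op\,(n-1)},\mathsf{Cat}]$ restricts to a functor $$L_n:\mathrm{SegPs}[\Delta^{op\,(n-1)},\mathsf{Cat}]\to\mathsf{Cat}_{wg}^n,$$ that is, there is a functor $L_n$ whose composite with the inclusion $\mathsf{Cat}_{wg}^n\subset[\Delta^{op\,(n-1)},\mathsf{Cat}]$ is the restriction of $\mathrm{St}$. Moreover, for every Segalic pseudo-functor $H$ and every multi-index $k\in\Delta^{op\,(n-1)}$, the component $g_k:(L_nH)_k\to H_k$ is an equivalence of categories. -/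

import Mathlib

open CategoryTheory Opposite

universe u

noncomputable section

namespace NFold

/-- The objects of `Δ^{op m}`, the `m`-fold power of the opposite of the simplex category; as a
product of categories this carries the product category structure. -/
abbrev MIdx (m : ℕ) : Type := Fin m → SimplexCategoryᵒᵖ

/-- The category `[Δ^{op m}, Cat]` of strict functors. `(m+1)`-fold categories are regarded as those
objects of `MCat m` all of whose Segal maps are isomorphisms. -/
abbrev MCat (m : ℕ) := MIdx m ⥤ Cat.{u, u}

/-- The category `[Δ^{op m}, Set]` of `m`-fold simplicial sets. -/
abbrev MSet (m : ℕ) := MIdx m ⥤ Type u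

/-- `ins i (s, k)` is the multi-index with `s` in direction `i` and `k` in the other directions. -/
def ins {m : ℕ} (i : Fin (m + 1)) : SimplexCategoryᵒᵖ × MIdx m ⥤ MIdx (m + 1) :=
  Functor.pi' (Fin.insertNth (α := fun _ => SimplexCategoryᵒᵖ × MIdx m ⥤ SimplexCategoryᵒᵖ) i
    (CategoryTheory.Prod.fst _ _) (fun j => CategoryTheory.Prod.snd _ _ ⋙ Pi.eval _ j))

/-- The inverse of `ins i`: separate direction `i` from the others. -/
def split {m : ℕ} (i : Fin (m + 1)) : MIdx (m + 1) ⥤ SimplexCategoryᵒᵖ × MIdx m :=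
  Functor.prod' (Pi.eval _ i) (Functor.pi' fun j => Pi.eval _ (i.succAbove j))

theorem ins_eval {m : ℕ} (i j : Fin (m + 1)) :
    ins i ⋙ Pi.eval _ j =
      Fin.insertNth (α := fun _ => SimplexCategoryᵒᵖ × MIdx m ⥤ SimplexCategoryᵒᵖ) i
        (CategoryTheory.Prod.fst _ _) (fun j => CategoryTheory.Prod.snd _ _ ⋙ Pi.eval _ j) j :=
  rfl

theorem split_ins {m : ℕ} (i : Fin (m + 1)) : split i ⋙ ins i = 𝟭 (MIdx (m + 1)) := by
  have h : ∀ j, (split i ⋙ ins i) ⋙ Pi.eval _ j = 𝟭 (MIdx (m + 1)) ⋙ Pi.eval _ j := by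
    intro j
    rw [Functor.assoc, ins_eval]
    refine Fin.succAboveCases i ?_ (fun j => ?_) j
    · rw [Fin.insertNth_apply_same]; rfl
    · rw [Fin.insertNth_apply_succAbove]; rfl
  refine CategoryTheory.Functor.ext (fun k => funext fun j => CategoryTheory.Functor.congr_obj (h j) k) (fun k l f => ?_)
  funext j
  have := CategoryTheory.Functor.congr_hom (h j) f
  simpa [CategoryTheory.Functor.eqToHom_proj] using! this

/-- `X ↦ (s ↦ X_s)`: an object of `[Δ^{op (m+1)}, Cat]` as a simplicial object in
`[Δ^{op m}, Cat]`, along the first direction. -/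
def slices (m : ℕ) : MCat.{u} (m + 1) ⥤ (SimplexCategoryᵒᵖ ⥤ MCat.{u} m) :=
  (Functor.whiskeringLeft _ _ _).obj (ins 0) ⋙ Functor.curry

/-- An `(m+1)`-fold simplicial set as a diagram of simplicial sets, along the last direction. -/
def lastDir (m : ℕ) : MSet.{u} (m + 1) ⥤ (MIdx m ⥤ SSet.{u}) :=
  (Functor.whiskeringLeft _ _ _).obj (CategoryTheory.Prod.swap _ _ ⋙ ins (Fin.last m)) ⋙ Functor.curry

/-- Apply the left adjoint of the nerve functor in the last direction. On `(m+1)`-fold simplicial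
sets that are nerves of categories in the last direction (the only ones for which it is used, see
`IsMultinerve`) it returns these categories. -/
def toCat (m : ℕ) : MSet.{u} (m + 1) ⥤ MCat.{u} m :=
  lastDir m ⋙ (Functor.whiskeringRight _ _ _).obj SSet.hoFunctor

/-- `p̄ X = p ∘ X`, where `p : Cat ⥤ Set` takes isomorphism classes of objects. -/
def pbar (m : ℕ) : MCat.{u} m ⥤ MSet.{u} m := (Functor.whiskeringRight _ _ _).obj isomorphismClasses

/-- The truncation `p^{(n)}` (here `n = m + 2`): isomorphism classes of objects levelwise, the result
being read as a diagram of categories along the last direction. -/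
def trunc (m : ℕ) : MCat.{u} (m+1) ⥤ MCat.{u} m := pbar (m+1) ⋙ toCat m

/-- The set underlying the discretization `X^d`: apply `p^{(n)}, p^{(n-1)}, …, p^{(1)} = p`
successively. -/
def Disc : ∀ m : ℕ, (MCat.{u} m ⥤ Type u)
  | 0 => (evaluation _ _).obj (fun i => i.elim0) ⋙ isomorphismClasses
  | m + 1 => trunc m ⋙ Disc m

/-- The vertex `0` of the image of the simplex `z` under `K ⟶ N (ho K)`, an object of `ho K`. -/
def vtx (K : SSet.{u}) {t : SimplexCategoryᵒᵖ} (z : K.obj t) : SSet.hoFunctor.obj K :=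
  ((nerveAdjunction.unit.app K).app t z).obj 0

theorem vtx_naturality {K L : SSet.{u}} (g : K ⟶ L) {t : SimplexCategoryᵒᵖ} (z : K.obj t) :
    (SSet.hoFunctor.map g).toFunctor.obj (vtx K z) = vtx L (g.app t z) := by
  have e := congrArg (fun q => q.app t z) (nerveAdjunction.unit.naturality g)
  have e' : (nerveAdjunction.unit.app L).app t (g.app t z) =
    (nerveFunctor.map (SSet.hoFunctor.map g)).app t ((nerveAdjunction.unit.app K).app t z) := e
  unfold vtx
  rw [e']
  rfl

theorem vtx_map (K : SSet.{u}) {t t' : SimplexCategoryᵒᵖ} (f : t ⟶ t') (z : K.obj t) :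
    Nonempty (vtx K z ⟶ vtx K (K.map f z)) := by
  have e : (nerveAdjunction.unit.app K).app t' (K.map f z) =
      (nerve (SSet.hoFunctor.obj K)).map f ((nerveAdjunction.unit.app K).app t z) :=
    congrArg (fun q => q z) ((nerveAdjunction.unit.app K).naturality f)
  unfold vtx
  rw [e]
  exact ⟨((nerveAdjunction.unit.app K).app t z).map (homOfLE (Fin.zero_le _))⟩

theorem prod_map_eq {A B C : Type*} [Category* A] [Category* B] [Category* C] (F : A × B ⥤ C)
    {p q : A × B} (f : p ⟶ q) :
    F.map f = F.map (CategoryTheory.Prod.mkHom (𝟙 p.1) f.2 : (p.1, p.2) ⟶ (p.1, q.2)) ≫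
      F.map (CategoryTheory.Prod.mkHom f.1 (𝟙 q.2) : (p.1, q.2) ⟶ (q.1, q.2)) := by
  rw [← CategoryTheory.Functor.map_comp]
  congr 1
  ext <;> simp

/-- The object, given by the vertex `0` in the last direction, determined by `z ∈ S_k`. -/
def vertex {m : ℕ} (S : MSet.{u} (m + 1)) (k : MIdx (m + 1)) (z : S.obj k) :
    ((toCat m).obj S).obj ((split (Fin.last m)).obj k).2 :=
  vtx (((lastDir m).obj S).obj ((split (Fin.last m)).obj k).2) (t := ((split (Fin.last m)).obj k).1)
      (S.map (eqToHom (Functor.congr_obj (split_ins (Fin.last m)) k).symm) z)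

theorem vertex_map {m : ℕ} (S : MSet.{u} (m + 1)) {k l : MIdx (m + 1)} (f : k ⟶ l) (z : S.obj k) :
    Nonempty ((((toCat m).obj S).map ((split (Fin.last m)).map f).2).toFunctor.obj (vertex S k z) ⟶
      vertex S l (S.map f z)) := by
  have e1 : f ≫ eqToHom (Functor.congr_obj (split_ins (Fin.last m)) l).symm =
      eqToHom (Functor.congr_obj (split_ins (Fin.last m)) k).symm ≫
        (ins (Fin.last m)).map ((split (Fin.last m)).map f) := by
    have := Functor.congr_hom (split_ins (Fin.last m)) f
    simp only [Functor.comp_map] at this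
    simp [this]
  have e2 : S.map (eqToHom (CategoryTheory.Functor.congr_obj (split_ins (Fin.last m)) l).symm)
        (S.map f z) = (((lastDir m).obj S).obj _).map ((split (Fin.last m)).map f).1
          ((((lastDir m).obj S).map ((split (Fin.last m)).map f).2).app _
            (S.map (eqToHom (Functor.congr_obj (split_ins (Fin.last m)) k).symm) z)) := by
    refine ((S.map_comp_apply _ _ _).symm.trans ?_)
    rw [e1, prod_map_eq, CategoryTheory.Functor.map_comp, CategoryTheory.Functor.map_comp]
    rfl
  unfold vertex
  rw [e2]
  erw [vtx_naturality]
  exact vtx_map _ _ _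

theorem vertex_naturality {m : ℕ} {S T : MSet.{u} (m + 1)} (g : S ⟶ T) (k : MIdx (m + 1)) (z : S.obj k) :
    (((toCat m).map g).app _).toFunctor.obj (vertex S k z) = vertex T k (g.app k z) := by
  unfold vertex
  have : T.map (eqToHom (CategoryTheory.Functor.congr_obj (split_ins (Fin.last m)) k).symm)
        (g.app k z) = (((lastDir m).map g).app _).app ((split (Fin.last m)).obj k).1
            (S.map (eqToHom (Functor.congr_obj (split_ins (Fin.last m)) k).symm) z) :=
    NatTrans.naturality_apply g _ z |>.symm
  rw [this]
  exact vtx_naturality _ _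

/-! ### Iterated fibre products of categories -/

section Chain

variable {C Z : Type u} [SmallCategory C] [SmallCategory Z]

/-- The objects of the iterated fibre product `C ×_Z C ×_Z ⋯ ×_Z C` (`k` factors) of categories,
formed with `t` on the left and `s` on the right of each `×_Z`: the families `(x_1, …, x_k)` with
`t x_i = s x_{i+1}`. -/
@[ext]
structure Chain (s t : C ⥤ Z) (k : ℕ) : Type u where
  obj : Fin k → C
  link : ∀ i j : Fin k, (i : ℕ) + 1 = j → t.obj (obj i) = s.obj (obj j)

namespace Chain

variable {s t : C ⥤ Z} {k : ℕ}

/-- Morphisms of the iterated fibre product: families of morphisms `a_i` with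
`t a_i = s a_{i+1}`. -/
@[ext]
structure Hom (x y : Chain s t k) : Type u where
  app : ∀ i, x.obj i ⟶ y.obj i
  link : ∀ (i j : Fin k) (h : (i : ℕ) + 1 = j),
    t.map (app i) = eqToHom (x.link i j h) ≫ s.map (app j) ≫ eqToHom (y.link i j h).symm

instance : SmallCategory (Chain s t k) where
  Hom := Hom
  id x := ⟨fun i => 𝟙 _, fun i j h => by simp⟩
  comp f g := ⟨fun i => f.app i ≫ g.app i, fun i j h => by simp [f.link i j h, g.link i j h]⟩
  id_comp f := by apply Hom.ext; funext i; exact Category.id_comp _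
  comp_id f := by apply Hom.ext; funext i; exact Category.comp_id _
  assoc f g h := by apply Hom.ext; funext i; exact Category.assoc _ _ _

/-- The `i`-th projection. -/
def proj (s t : C ⥤ Z) {k : ℕ} (i : Fin k) : Chain s t k ⥤ C where
  obj x := x.obj i
  map f := f.app i
  map_id _ := rfl
  map_comp _ _ := rfl

theorem functor_ext {A : Type u} [SmallCategory A] {F G : A ⥤ Chain s t k}
    (h : ∀ i, F ⋙ proj s t i = G ⋙ proj s t i) : F = G := by
  refine CategoryTheory.Functor.ext (fun x => ?_) (fun x y f => ?_)
  · apply Chain.ext; funext i; exact CategoryTheory.Functor.congr_obj (h i) x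
  · apply Chain.Hom.ext; funext i
    have := CategoryTheory.Functor.congr_hom (h i) f
    refine this.trans ?_
    change _ = (proj s t i).map (eqToHom _ ≫ G.map f ≫ eqToHom _)
    simp [eqToHom_map]

/-- The functor into the iterated fibre product induced by functors `ν_i : A ⥤ C` such that
`t ν_i = s ν_{i+1}`. -/
def lift {A : Type u} [SmallCategory A] (ν : Fin k → (A ⥤ C))
    (hν : ∀ i j : Fin k, (i : ℕ) + 1 = j → ν i ⋙ t = ν j ⋙ s) : A ⥤ Chain s t k where
  obj a := ⟨fun i => (ν i).obj a, fun i j h => CategoryTheory.Functor.congr_obj (hν i j h) a⟩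
  map f := ⟨fun i => (ν i).map f, fun i j h => CategoryTheory.Functor.congr_hom (hν i j h) f⟩
  map_id a := by apply Hom.ext; funext i; exact (ν i).map_id a
  map_comp f g := by apply Hom.ext; funext i; exact (ν i).map_comp f g

/-- Functoriality of the iterated fibre product. -/
def mapFunctor {C' Z' : Type u} [SmallCategory C'] [SmallCategory Z'] {s' t' : C' ⥤ Z'}
    (F : C ⥤ C') (G : Z ⥤ Z') (hs : s ⋙ G = F ⋙ s') (ht : t ⋙ G = F ⋙ t') (k : ℕ) :
    Chain s t k ⥤ Chain s' t' k where
  obj x := ⟨fun i => F.obj (x.obj i), fun i j h => by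
    have h1 := CategoryTheory.Functor.congr_obj hs (x.obj j)
    have h2 := CategoryTheory.Functor.congr_obj ht (x.obj i)
    simp only [CategoryTheory.Functor.comp_obj] at h1 h2
    rw [← h1, ← h2, x.link i j h]⟩
  map f := ⟨fun i => F.map (f.app i), fun i j h => by
    have h1 := CategoryTheory.Functor.congr_hom hs (f.app j)
    have h2 := CategoryTheory.Functor.congr_hom ht (f.app i)
    simp only [CategoryTheory.Functor.comp_map, f.link i j h] at h1 h2
    simp only [CategoryTheory.Functor.map_comp, eqToHom_map, h1] at h2
    have h3 := congrArg (fun q => eqToHom (CategoryTheory.Functor.congr_obj ht _).symm ≫ q ≫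
      eqToHom (CategoryTheory.Functor.congr_obj ht _)) h2
    simpa using! h3.symm⟩
  map_id a := by apply Hom.ext; funext i; exact F.map_id _
  map_comp f g := by apply Hom.ext; funext i; exact F.map_comp _ _

end Chain
end Chain

/-- The iterated fibre product `C ×_Z ⋯ ×_Z C` (`k` factors) of diagrams of categories, computed
levelwise. -/
def chains {D : Type} [SmallCategory D] {C Z : D ⥤ Cat.{u, u}} (s t : C ⟶ Z) (k : ℕ) :
    D ⥤ Cat.{u, u} where
  obj d := Cat.of (Chain (s.app d).toFunctor (t.app d).toFunctor k)
  map f := (Chain.mapFunctor (C.map f).toFunctor (Z.map f).toFunctor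
    (congrArg Cat.Hom.toFunctor (s.naturality f).symm)
    (congrArg Cat.Hom.toFunctor (t.naturality f).symm) k).toCatHom
  map_id d := Cat.ext (Chain.functor_ext fun i => by
    change Chain.proj _ _ i ⋙ (C.map (𝟙 d)).toFunctor = Chain.proj _ _ i
    rw [C.map_id]; rfl)
  map_comp {d e e'} f g := Cat.ext (Chain.functor_ext fun i => by
    change Chain.proj _ _ i ⋙ (C.map (f ≫ g)).toFunctor =
      Chain.proj _ _ i ⋙ (C.map f).toFunctor ⋙ (C.map g).toFunctor
    rw [C.map_comp]; rfl)

/-- The map into the iterated fibre product induced by a compatible family of maps. -/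
def chainsLift {D : Type} [SmallCategory D] {A C Z : D ⥤ Cat.{u, u}} {s t : C ⟶ Z} {k : ℕ}
    (ν : Fin k → (A ⟶ C)) (hν : ∀ i j : Fin k, (i : ℕ) + 1 = j → ν i ≫ t = ν j ≫ s) :
    A ⟶ chains s t k where
  app d := (Chain.lift (fun i => ((ν i).app d).toFunctor) (fun i j h =>
    congrArg (fun η => (η.app d).toFunctor) (hν i j h))).toCatHom
  naturality _ _ f := Cat.ext (Chain.functor_ext fun i =>
    congrArg Cat.Hom.toFunctor ((ν i).naturality f))

/-! ### Segal maps -/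

/-- The object `[n]` of `Δ^{op}`. -/
abbrev smp (n : ℕ) : SimplexCategoryᵒᵖ := op (SimplexCategory.mk n)

/-- The face operator `d_1 : X_1 → X_0`, which picks the vertex `0` (the source). -/
def src : smp 1 ⟶ smp 0 := (SimplexCategory.δ (n := 0) 1).op
/-- The face operator `d_0 : X_1 → X_0`, which picks the vertex `1` (the target). -/
def tgt : smp 1 ⟶ smp 0 := (SimplexCategory.δ (n := 0) 0).op
/-- The operator `X_k → X_1` which picks the edge `j → j + 1`. -/
def spine (k : ℕ) (j : Fin k) : smp k ⟶ smp 1 := (SimplexCategory.mkOfSucc j).op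

theorem spine_link {k : ℕ} (i j : Fin k) (h : (i : ℕ) + 1 = j) :
    spine k i ≫ tgt = spine k j ≫ src := by
  have : (SimplexCategory.δ (n := 0) 0) ≫ SimplexCategory.mkOfSucc i =
      (SimplexCategory.δ (n := 0) 1) ≫ SimplexCategory.mkOfSucc j := by
    rw [SimplexCategory.δ_zero_mkOfSucc, SimplexCategory.δ_one_mkOfSucc]
    congr 1
    ext; simpa using h
  exact congrArg Quiver.Hom.op this

section Segal

variable {D : Type} [SmallCategory D] (X : SimplexCategoryᵒᵖ ⥤ (D ⥤ Cat.{u, u}))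

/-- The Segal map `X_k → X_1 ×_{X_0} ⋯ ×_{X_0} X_1`. -/
def segalMap (k : ℕ) : X.obj (smp k) ⟶ chains (X.map src) (X.map tgt) k :=
  chainsLift (fun j => X.map (spine k j)) (fun i j h => by
    rw [← CategoryTheory.Functor.map_comp, ← CategoryTheory.Functor.map_comp, spine_link i j h])

/-- All Segal maps (`k ≥ 2`) are isomorphisms. -/
def IsSegal : Prop := ∀ k, 2 ≤ k → IsIso (segalMap X k)

/-- The induced Segal map `X_k → X_1 ×_Z ⋯ ×_Z X_1` determined by a map `γ : X_0 → Z`. -/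
def inducedSegalMap {Z : D ⥤ Cat.{u, u}} (γ : X.obj (smp 0) ⟶ Z) (k : ℕ) :
    X.obj (smp k) ⟶ chains (X.map src ≫ γ) (X.map tgt ≫ γ) k :=
  chainsLift (fun j => X.map (spine k j)) (fun i j h => by
    rw [← Category.assoc, ← Category.assoc,
      ← CategoryTheory.Functor.map_comp, ← CategoryTheory.Functor.map_comp, spine_link i j h])

end Segal

/-- The category is an equivalence relation: there is at most one morphism between two objects, and
the existence of a morphism is a symmetric relation. -/
def IsEqRel (C : Type u) [SmallCategory C] : Prop :=
  Quiver.IsThin C ∧ ∀ a b : C, Nonempty (a ⟶ b) → Nonempty (b ⟶ a)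

/-- The `(m+1)`-fold simplicial set `S` is the nerve, in the last direction, of a diagram of
categories `A : Δ^{op m} → Cat`. Then `A` is recovered as `toCat m S`, see `toCat_iso`. -/
def IsMultinerve {m : ℕ} (S : MSet.{u} (m + 1)) : Prop :=
  ∃ A : MCat.{u} m, Nonempty ((lastDir m).obj S ≅ A ⋙ nerveFunctor)

theorem toCat_iso {m : ℕ} {S : MSet.{u} (m + 1)} {A : MCat.{u} m}
    (e : (lastDir m).obj S ≅ A ⋙ nerveFunctor) : Nonempty ((toCat m).obj S ≅ A) :=
  ⟨CategoryTheory.Functor.isoWhiskerRight e SSet.hoFunctor ≪≫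
    CategoryTheory.Functor.isoWhiskerLeft A (asIso nerveAdjunction.counit) ≪≫ A.rightUnitor⟩

/-- Homotopically discrete `(m+1)`-fold categories, inside `[Δ^{op m}, Cat]`. For `m = 0` these are
the categories which are equivalence relations. For `m + 1`: every `X_s` is homotopically discrete,
the Segal maps are isomorphisms, and levelwise isomorphism classes of objects give (the nerve of) a
homotopically discrete `(m+1)`-fold category. -/
def IsHD : ∀ m : ℕ, MCat.{u} m → Prop
  | 0, X => ∀ k, IsEqRel (X.obj k)
  | m + 1, X => (∀ s, IsHD m (((slices m).obj X).obj s)) ∧ IsSegal ((slices m).obj X) ∧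
      IsMultinerve ((pbar (m + 1)).obj X) ∧ IsHD m ((trunc m).obj X)

theorem IsHD.isEqRel : ∀ {m : ℕ} {X : MCat.{u} m}, IsHD m X → ∀ k, IsEqRel (X.obj k)
  | 0, _, h, k => h k
  | m + 1, X, h, k => by
    have := (h.1 ((split 0).obj k).1).isEqRel ((split 0).obj k).2
    change IsEqRel (X.obj ((split 0 ⋙ ins 0).obj k)) at this
    rwa [split_ins] at this

/-- The discretization map `γ : X → X^d` on objects: an object of `X_k` is sent to its isomorphism
class, which is an element of the last-direction nerve of the truncation; take its vertex `0` and
iterate. -/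
def gammaObj : ∀ (m : ℕ) (X : MCat.{u} m) (k : MIdx m), X.obj k → (Disc m).obj X
  | 0, X, k, x => Quotient.mk (isIsomorphicSetoid _)
      ((X.map (fun i => i.elim0 : k ⟶ fun i => i.elim0)).toFunctor.obj x)
  | m + 1, X, k, x => gammaObj m ((trunc m).obj X) ((split (Fin.last m)).obj k).2
      (vertex ((pbar (m + 1)).obj X) k (Quotient.mk (isIsomorphicSetoid _) x))

theorem gammaObj_iso : ∀ {m : ℕ} (X : MCat.{u} m) {k : MIdx m} {x y : X.obj k} (_ : x ≅ y),
    gammaObj m X k x = gammaObj m X k y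
  | 0, X, k, x, y, f => Quotient.sound (s := isIsomorphicSetoid _)
      ⟨(X.map (fun i => i.elim0 : k ⟶ fun i => i.elim0)).toFunctor.mapIso f⟩
  | m + 1, X, k, x, y, f => by
      unfold gammaObj
      rw [Quotient.sound (s := isIsomorphicSetoid _) (⟨f⟩ : IsIsomorphic x y)]

theorem gammaObj_hom {m : ℕ} {X : MCat.{u} m} (h : IsHD m X) {k : MIdx m} {x y : X.obj k} (f : x ⟶ y) :
    gammaObj m X k x = gammaObj m X k y := by
  obtain ⟨h1, h2⟩ := h.isEqRel k
  obtain ⟨g⟩ := h2 x y ⟨f⟩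
  exact gammaObj_iso X ⟨f, g, (h1 _ _).elim _ _, (h1 _ _).elim _ _⟩

theorem gammaObj_map : ∀ {m : ℕ} {X : MCat.{u} m} (_ : IsHD m X) {k l : MIdx m} (f : k ⟶ l)
    (x : X.obj k), gammaObj m X l ((X.map f).toFunctor.obj x) = gammaObj m X k x
  | 0, X, _, k, l, f, x => by
      have : k = l := funext fun i => i.elim0
      subst this
      have : f = 𝟙 k := funext fun i => i.elim0
      subst this
      simp
  | m + 1, X, h, k, l, f, x => by
      obtain ⟨g⟩ := vertex_map ((pbar (m + 1)).obj X) f (Quotient.mk (isIsomorphicSetoid _) x)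
      have := gammaObj_hom h.2.2.2 g
      exact this.symm.trans (gammaObj_map h.2.2.2 _ _)

theorem gammaObj_naturality : ∀ {m : ℕ} {X Y : MCat.{u} m} (f : X ⟶ Y) {k : MIdx m}
    (x : X.obj k), gammaObj m Y k ((f.app k).toFunctor.obj x) = (Disc m).map f (gammaObj m X k x)
  | 0, X, Y, f, k, x => congrArg (fun F : X.obj k ⟶ Y.obj (fun i => i.elim0) =>
      Quotient.mk (isIsomorphicSetoid _) (F.toFunctor.obj x))
        (f.naturality (fun i => i.elim0 : k ⟶ fun i => i.elim0)).symm
  | m + 1, X, Y, f, k, x => by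
      refine Eq.trans ?_ (gammaObj_naturality ((trunc m).map f) _)
      exact congrArg (gammaObj m ((trunc m).obj Y) _)
        (vertex_naturality ((pbar (m + 1)).map f) k (Quotient.mk (isIsomorphicSetoid _) x)).symm

/-- The constant diagram at the discrete category on a set. -/
def discrete {m : ℕ} (S : Type u) : MCat.{u} m :=
  (CategoryTheory.Functor.const _).obj (Cat.of (Discrete S))

/-- The discretization map `γ : X → X^d` of a homotopically discrete object. -/
def gamma {m : ℕ} (X : MCat.{u} m) (h : IsHD m X) : X ⟶ discrete ((Disc m).obj X) where
  app k := CategoryTheory.Functor.toCatHom (D := Discrete ((Disc m).obj X))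
    { obj := fun x => ⟨gammaObj m X k x⟩
      map := fun f => Discrete.eqToHom (gammaObj_hom h f) }
  naturality k l f := Cat.ext (CategoryTheory.Functor.ext
    (fun x => congrArg Discrete.mk (gammaObj_map h f x)) (fun _ _ _ => (IsDiscrete.subsingleton (C := Discrete ((Disc m).obj X)) _ _).elim _ _))

theorem fullSub_functor_ext {A B : Type u} [SmallCategory A] [SmallCategory B]
    {P : ObjectProperty B} {F G : A ⥤ P.FullSubcategory} (h : F ⋙ P.ι = G ⋙ P.ι) : F = G := by
  refine CategoryTheory.Functor.ext (fun x => ?_) (fun x y f => ?_)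
  · exact ObjectProperty.FullSubcategory.ext (CategoryTheory.Functor.congr_obj h x)
  · apply P.ι.map_injective
    refine (CategoryTheory.Functor.congr_hom h f).trans ?_
    simp

section Fiber

variable {D : Type} [SmallCategory D] {A : D ⥤ Cat.{u, u}} {S : Type u}

/-- The objects `x` with `φ x = a` and `ψ x = b`. -/
def fiberProp (φ ψ : A ⟶ (CategoryTheory.Functor.const _).obj (Cat.of (Discrete S))) (a b : S) (d : D) :
    ObjectProperty (A.obj d) :=
  fun x => (φ.app d).toFunctor.obj x = Discrete.mk a ∧ (ψ.app d).toFunctor.obj x = Discrete.mk b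

theorem fiberProp_map (φ ψ : A ⟶ (CategoryTheory.Functor.const _).obj (Cat.of (Discrete S)))
    (a b : S) {d e : D} (f : d ⟶ e) (x : A.obj d) (hx : fiberProp φ ψ a b d x) :
    fiberProp φ ψ a b e ((A.map f).toFunctor.obj x) := by
  have h : ∀ χ : A ⟶ (CategoryTheory.Functor.const _).obj (Cat.of (Discrete S)),
      (χ.app e).toFunctor.obj ((A.map f).toFunctor.obj x) = (χ.app d).toFunctor.obj x := fun χ =>
    congrArg (fun F : A.obj d ⟶ Cat.of (Discrete S) => F.toFunctor.obj x) (χ.naturality f)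
  exact ⟨(h φ).trans hx.1, (h ψ).trans hx.2⟩

/-- The fibre over `(a, b)` of `(φ, ψ) : A → S × S`, where the set `S` is regarded as a constant
diagram of discrete categories. -/
def fiber (φ ψ : A ⟶ (CategoryTheory.Functor.const _).obj (Cat.of (Discrete S))) (a b : S) :
    D ⥤ Cat.{u, u} where
  obj d := Cat.of (fiberProp φ ψ a b d).FullSubcategory
  map {d e} f := ((fiberProp φ ψ a b e).lift ((fiberProp φ ψ a b d).ι ⋙ (A.map f).toFunctor)
    (fun x => fiberProp_map φ ψ a b f x.obj x.property)).toCatHom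
  map_id d := Cat.ext (fullSub_functor_ext (by
    change (fiberProp φ ψ a b d).ι ⋙ (A.map (𝟙 d)).toFunctor = (fiberProp φ ψ a b d).ι
    rw [A.map_id]; rfl))
  map_comp {d _ _} f g := Cat.ext (fullSub_functor_ext (by
    change (fiberProp φ ψ a b d).ι ⋙ (A.map (f ≫ g)).toFunctor =
      (fiberProp φ ψ a b d).ι ⋙ (A.map f).toFunctor ⋙ (A.map g).toFunctor
    rw [A.map_comp]; rfl))

/-- The map induced on fibres. -/
def fiberMap {B : D ⥤ Cat.{u, u}} {T : Type u}
    {φ ψ : A ⟶ (CategoryTheory.Functor.const _).obj (Cat.of (Discrete S))}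
    {φ' ψ' : B ⟶ (CategoryTheory.Functor.const _).obj (Cat.of (Discrete T))}
    (f : A ⟶ B) {a b : S} {a' b' : T}
    (hf : ∀ d x, fiberProp φ ψ a b d x → fiberProp φ' ψ' a' b' d ((f.app d).toFunctor.obj x)) :
    fiber φ ψ a b ⟶ fiber φ' ψ' a' b' where
  app d := ((fiberProp φ' ψ' a' b' d).lift ((fiberProp φ ψ a b d).ι ⋙ (f.app d).toFunctor)
    (fun x => hf d x.obj x.property)).toCatHom
  naturality d _ g := Cat.ext (fullSub_functor_ext
    (by
    change (fiberProp φ ψ a b d).ι ⋙ (A.map g ≫ f.app _).toFunctor =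
      (fiberProp φ ψ a b d).ι ⋙ (f.app d ≫ B.map g).toFunctor
    rw [f.naturality g]))

end Fiber

variable {m : ℕ}

/-- `X_s`, the value at `[s]` in the first direction. -/
abbrev slice (X : MCat.{u} (m + 1)) (s : ℕ) : MCat.{u} m := ((slices m).obj X).obj (smp s)

/-- `f_s : X_s → Y_s`. -/
abbrev sliceMap {X Y : MCat.{u} (m + 1)} (f : X ⟶ Y) (s : ℕ) : slice X s ⟶ slice Y s :=
  ((slices m).map f).app (smp s)

/-- The set underlying `X_0^d`. -/
abbrev Disc0 (X : MCat.{u} (m + 1)) : Type u := (Disc m).obj (slice X 0)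

/-- The hom-object `X(a, b)`, for `a, b ∈ X_0^d`: the fibre at `(a, b)` of
`X_1 → X_0 × X_0 → X_0^d × X_0^d`. -/
def HomFib (X : MCat.{u} (m + 1)) (hX : IsHD m (slice X 0)) (a b : Disc0 X) : MCat.{u} m :=
  fiber (((slices m).obj X).map src ≫ gamma _ hX) (((slices m).obj X).map tgt ≫ gamma _ hX) a b

/-- The map `f(a, b) : X(a, b) → Y(f a, f b)`. -/
def HomFib.map {X Y : MCat.{u} (m + 1)} (f : X ⟶ Y) (hX : IsHD m (slice X 0))
    (hY : IsHD m (slice Y 0)) (a b : Disc0 X) :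
    HomFib X hX a b ⟶
      HomFib Y hY ((Disc m).map (sliceMap f 0) a) ((Disc m).map (sliceMap f 0) b) :=
  fiberMap (sliceMap f 1) (fun k x hx => by
    have h : ∀ (e : smp 1 ⟶ smp 0) (c : Disc0 X),
        ((((slices m).obj X).map e ≫ gamma _ hX).app k).toFunctor.obj x = Discrete.mk c →
        ((((slices m).obj Y).map e ≫ gamma _ hY).app k).toFunctor.obj
          (((sliceMap f 1).app k).toFunctor.obj x) =
            Discrete.mk ((Disc m).map (sliceMap f 0) c) := by
      intro e c hc
      have hc' : gammaObj m (slice X 0) k (((((slices m).obj X).map e).app k).toFunctor.obj x) = c :=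
        congrArg Discrete.as hc
      have h1 : (((((slices m).obj Y).map e).app k).toFunctor.obj
          (((sliceMap f 1).app k).toFunctor.obj x)) = 
          ((sliceMap f 0).app k).toFunctor.obj
            (((((slices m).obj X).map e).app k).toFunctor.obj x) :=
        congrArg (fun η : slice X 1 ⟶ slice Y 0 => (η.app k).toFunctor.obj x)
          (((slices m).map f).naturality e).symm
      refine congrArg Discrete.mk ?_
      rw [← hc', ← gammaObj_naturality]
      exact congrArg (gammaObj m (slice Y 0) k) h1
    exact ⟨h _ _ hx.1, h _ _ hx.2⟩)

/-- `(m+1)`-equivalences, inside `[Δ^{op m}, Cat]`. For `m = 0` they are the equivalences of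
categories. For `m + 1`: all `f(a, b) : X(a, b) → Y(f a, f b)` and the truncation of `f` are
`(m+1)`-equivalences. It is part of the notion that `X_0` and `Y_0` are homotopically discrete, so
that the hom-objects make sense; this holds for all weakly globular `X` and `Y`. -/
def IsNEquiv : ∀ (m : ℕ) {X Y : MCat.{u} m}, (X ⟶ Y) → Prop
  | 0, _, _, f => ∀ k, (f.app k).toFunctor.IsEquivalence
  | m + 1, X, Y, f => ∃ (hX : IsHD m (slice X 0)) (hY : IsHD m (slice Y 0)),
      (∀ a b : Disc0 X, IsNEquiv m (HomFib.map f hX hY a b)) ∧ IsNEquiv m ((trunc m).map f)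

/-- Weakly globular `(m+1)`-fold categories, inside `[Δ^{op m}, Cat]`. For `m = 0` they are all
categories. For `m + 1`: every `X_s` is weakly globular, `X_0` is homotopically discrete, the induced
Segal maps `X_k → X_1 ×_{X_0^d} ⋯ ×_{X_0^d} X_1` (`k ≥ 2`) are `(m+1)`-equivalences, the Segal maps
are isomorphisms, and levelwise isomorphism classes of objects give (the nerve of) a weakly globular
`(m+1)`-fold category. -/
def IsWG : ∀ m : ℕ, MCat.{u} m → Prop
  | 0, _ => True
  | m + 1, X => (∀ s, IsWG m (slice X s)) ∧
      (∃ hX : IsHD m (slice X 0),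
        ∀ k, 2 ≤ k → IsNEquiv m (inducedSegalMap ((slices m).obj X) (gamma _ hX) k)) ∧
      IsSegal ((slices m).obj X) ∧
      IsMultinerve ((pbar (m + 1)).obj X) ∧ IsWG m ((trunc m).obj X)

section Pseudo

variable {I : Type} [SmallCategory I]

open Bicategory

/-- The category `Ps[I, Cat]` of pseudo-functors and pseudo-natural transformations; this is its
type of objects. -/
structure Ps (I : Type) [SmallCategory I] where
  /-- The underlying pseudo-functor. -/
  toPs : LocallyDiscrete I ⥤ᵖ Cat.{u, u}

namespace Ps

/-- The category `F_k`. -/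
abbrev ob (F : Ps.{u} I) (k : I) : Cat.{u, u} := F.toPs.obj ⟨k⟩

/-- The functor `F(f) : F_k ⥤ F_l`. -/
def mp (F : Ps.{u} I) {k l : I} (f : k ⟶ l) : F.ob k ⥤ F.ob l := (F.toPs.map f.toLoc).toFunctor

/-- The unit constraint `F(𝟙) x ≅ x`. -/
def idIso (F : Ps.{u} I) {k : I} (x : F.ob k) : (F.mp (𝟙 k)).obj x ≅ x :=
  (Cat.Hom.toNatIso (F.toPs.mapId ⟨k⟩)).app x

/-- The composition constraint `F(f ≫ g) x ≅ F(g) (F(f) x)`. -/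
def compIso (F : Ps.{u} I) {k l m : I} (f : k ⟶ l) (g : l ⟶ m) (x : F.ob k) :
    (F.mp (f ≫ g)).obj x ≅ (F.mp g).obj ((F.mp f).obj x) :=
  (Cat.Hom.toNatIso (F.toPs.mapComp f.toLoc g.toLoc)).app x

theorem idIso_naturality (F : Ps.{u} I) {k : I} {x y : F.ob k} (a : x ⟶ y) :
    (F.mp (𝟙 k)).map a ≫ (F.idIso y).hom = (F.idIso x).hom ≫ a :=
  (F.toPs.mapId ⟨k⟩).hom.toNatTrans.naturality a

theorem compIso_naturality (F : Ps.{u} I) {k l m : I} (f : k ⟶ l) (g : l ⟶ m) {x y : F.ob k}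
    (a : x ⟶ y) : (F.mp (f ≫ g)).map a ≫ (F.compIso f g y).hom =
      (F.compIso f g x).hom ≫ (F.mp g).map ((F.mp f).map a) :=
  (F.toPs.mapComp f.toLoc g.toLoc).hom.toNatTrans.naturality a

theorem map₂_app (F : LocallyDiscrete I ⥤ᵖ Cat.{u, u}) {a b : LocallyDiscrete I} {f g : a ⟶ b}
    (h : f ⟶ g) (x : F.obj a) :
    (F.map₂ h).toNatTrans.app x = eqToHom (by rw [LocallyDiscrete.eq_of_hom h]) := by
  obtain rfl : f = g := LocallyDiscrete.eq_of_hom h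
  obtain rfl : h = 𝟙 _ := Subsingleton.elim _ _
  rw [F.map₂_id]
  rfl

theorem compIso_id (F : Ps.{u} I) {k l : I} (f : k ⟶ l) (x : F.ob k) :
    (F.compIso f (𝟙 l) x).hom ≫ (F.idIso ((F.mp f).obj x)).hom = eqToHom (by rw [Category.comp_id]) := by
  have h := congrArg (fun q => q.toNatTrans.app x) (F.toPs.map₂_right_unitor f.toLoc)
  rw [map₂_app] at h
  refine Eq.trans ?_ h.symm
  exact (congrArg (fun q => (F.compIso f (𝟙 l) x).hom ≫ q) (Category.comp_id _)).symm

theorem id_compIso (F : Ps.{u} I) {k l : I} (f : k ⟶ l) (x : F.ob k) :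
    (F.compIso (𝟙 k) f x).hom ≫ (F.mp f).map (F.idIso x).hom = eqToHom (by rw [Category.id_comp]) := by
  have h := congrArg (fun q => q.toNatTrans.app x) (F.toPs.map₂_left_unitor f.toLoc)
  rw [map₂_app] at h
  refine Eq.trans ?_ h.symm
  exact (congrArg (fun q => (F.compIso (𝟙 k) f x).hom ≫ q) (Category.comp_id _)).symm

theorem compIso_assoc (F : Ps.{u} I) {k l m n : I} (f : k ⟶ l) (g : l ⟶ m) (h : m ⟶ n)
    (x : F.ob k) : (F.compIso (f ≫ g) h x).hom ≫ (F.mp h).map (F.compIso f g x).hom =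
      eqToHom (by rw [Category.assoc]) ≫ (F.compIso f (g ≫ h) x).hom ≫
        (F.compIso g h ((F.mp f).obj x)).hom := by
  have e := congrArg (fun q => q.toNatTrans.app x)
    (F.toPs.map₂_associator f.toLoc g.toLoc h.toLoc)
  rw [map₂_app] at e
  have e' : eqToHom (by rw [Category.assoc]) = (F.compIso (f ≫ g) h x).hom ≫
      (F.mp h).map (F.compIso f g x).hom ≫ 𝟙 _ ≫
        (F.compIso g h ((F.mp f).obj x)).inv ≫ (F.compIso f (g ≫ h) x).inv := e
  rw [e']
  simp

/-- Morphisms of pseudo-functors are the pseudo-natural transformations (`StrongTrans`). -/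
instance : CategoryStruct (Ps.{u} I) where
  Hom F G := Pseudofunctor.StrongTrans F.toPs G.toPs
  id F := Pseudofunctor.StrongTrans.id F.toPs
  comp θ η := Pseudofunctor.StrongTrans.vcomp θ η

/-- The components of a pseudo-natural transformation. -/
def app {F G : Ps.{u} I} (θ : F ⟶ G) (k : I) : F.ob k ⥤ G.ob k :=
  (Pseudofunctor.StrongTrans.app θ ⟨k⟩).toFunctor

/-- The constraint `θ_l (F(f) x) ≅ G(f) (θ_k x)` of a pseudo-natural transformation. -/
def nat {F G : Ps.{u} I} (θ : F ⟶ G) {k l : I} (f : k ⟶ l) (x : F.ob k) :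
    (app θ l).obj ((F.mp f).obj x) ≅ (G.mp f).obj ((app θ k).obj x) :=
  (Cat.Hom.toNatIso (Pseudofunctor.StrongTrans.naturality θ f.toLoc)).app x

theorem hom_ext {F G : Ps.{u} I} {θ η : F ⟶ G} (h : ∀ k, app θ k = app η k)
    (h' : ∀ {k l : I} (f : k ⟶ l) (x : F.ob k), (nat θ f x).hom = eqToHom (by rw [h]) ≫
      (nat η f x).hom ≫ eqToHom (by rw [h])) : θ = η := by
  obtain ⟨a1, n1, p1, p2, p3⟩ := θ
  obtain ⟨a2, n2, q1, q2, q3⟩ := η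
  obtain rfl : a1 = a2 := funext fun a => Cat.ext (h a.as)
  congr 1
  funext a b f
  ext x
  exact (h' f.as x).trans ((Category.id_comp _).trans (Category.comp_id _))

theorem hom_ext' {F G : Ps.{u} I} {θ η : F ⟶ G} (h : ∀ k, app θ k = app η k)
    (h' : ∀ {k l : I} (f : k ⟶ l) (x : F.ob k), (nat θ f x).hom ≍ (nat η f x).hom) : θ = η :=
  hom_ext h (fun f x => (conj_eqToHom_iff_heq _ _ (by rw [h]) (by rw [h])).mpr (h' f x))

theorem app_id (F : Ps.{u} I) (k : I) : app (𝟙 F) k = 𝟭 _ := rfl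

theorem app_comp {F G H : Ps.{u} I} (θ : F ⟶ G) (η : G ⟶ H) (k : I) :
    app (θ ≫ η) k = app θ k ⋙ app η k := rfl

theorem nat_id (F : Ps.{u} I) {k l : I} (f : k ⟶ l) (x : F.ob k) : (nat (𝟙 F) f x).hom = 𝟙 _ := 
  Category.comp_id _

theorem nat_comp {F G H : Ps.{u} I} (θ : F ⟶ G) (η : G ⟶ H) {k l : I} (f : k ⟶ l) (x : F.ob k) :
    (nat (θ ≫ η) f x).hom = (app η l).map (nat θ f x).hom ≫ (nat η f ((app θ k).obj x)).hom := by
  have : (Pseudofunctor.StrongTrans.naturality (θ ≫ η) f.toLoc).hom =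
    (α_ _ _ _).inv ≫ (Pseudofunctor.StrongTrans.naturality θ f.toLoc).hom ▷ _ ≫
    (α_ _ _ _).hom ≫ _ ◁ (Pseudofunctor.StrongTrans.naturality η f.toLoc).hom ≫ (α_ _ _ _).inv :=
    Pseudofunctor.StrongTrans.categoryStruct_comp_naturality_hom _ _ _
  have := congrArg (fun q => q.toNatTrans.app x) this
  refine this.trans ?_
  simp
  rfl

instance : Category (Ps.{u} I) where
  id_comp {X _} θ := hom_ext' (fun a => rfl) (fun f x => heq_of_eq (by
    rw [nat_comp, nat_id]
    change (app θ _).map (𝟙 ((X.mp f).obj x)) ≫ (nat θ f x).hom = _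
    rw [CategoryTheory.Functor.map_id, Category.id_comp]))
  comp_id θ := hom_ext' (fun a => rfl) (fun f x => heq_of_eq (by
    rw [nat_comp, nat_id]
    exact Category.comp_id (nat θ f x).hom))
  assoc θ η ζ := hom_ext' (fun a => rfl) (fun f x => heq_of_eq (by
    rw [nat_comp, nat_comp, nat_comp, nat_comp]
    change (app ζ _).map ((app η _).map (nat θ f x).hom ≫ (nat η f ((app θ _).obj x)).hom) ≫ 
      (nat ζ f _).hom = (app ζ _).map ((app η _).map (nat θ f x).hom) ≫ _ 
    rw [CategoryTheory.Functor.map_comp, Category.assoc]))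

theorem nat_naturality {F G : Ps.{u} I} (θ : F ⟶ G) {k l : I} (f : k ⟶ l) {x y : F.ob k} (a : x ⟶ y) :
    (app θ l).map ((F.mp f).map a) ≫ (nat θ f y).hom =
      (nat θ f x).hom ≫ (G.mp f).map ((app θ k).map a) :=
  (Pseudofunctor.StrongTrans.naturality θ f.toLoc).hom.toNatTrans.naturality a

theorem nat_unit {F G : Ps.{u} I} (θ : F ⟶ G) {k : I} (x : F.ob k) :
    (nat θ (𝟙 k) x).hom ≫ (G.idIso _).hom = (app θ k).map (F.idIso x).hom := by
  have := congrArg (fun q => q.toNatTrans.app x) (Pseudofunctor.StrongTrans.naturality_id θ ⟨k⟩)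
  refine this.trans ?_
  simp
  rfl

theorem nat_mul {F G : Ps.{u} I} (θ : F ⟶ G) {k l m : I} (f : k ⟶ l) (g : l ⟶ m) (x : F.ob k) :
    (nat θ (f ≫ g) x).hom ≫ (G.compIso f g _).hom = 
      (app θ m).map (F.compIso f g x).hom ≫ (nat θ g _).hom ≫ (G.mp g).map (nat θ f x).hom := by
  have := congrArg (fun q => q.toNatTrans.app x)
    (Pseudofunctor.StrongTrans.naturality_comp θ f.toLoc g.toLoc)
  refine this.trans ?_
  simp
  rfl

/-! ### Strictification -/

/-- The objects of `(T U F)_k = ∐_r ∐_{r ⟶ k} F_r`; the category structure is that of a coproduct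
(`Sigma`) of categories. Here `T` is the monad on `[ob I, Cat]` whose strict algebras are the functors
`I ⥤ Cat`. -/
abbrev TU (F : Ps.{u} I) (k : I) : Type u := Σ p : (Σ r : I, r ⟶ k), F.ob p.1

/-- The strict functoriality of `T U F` in `k`, by composition with `φ`. -/
def tuMap (F : Ps.{u} I) {k l : I} (φ : k ⟶ l) : F.TU k ⥤ F.TU l :=
  Sigma.desc fun p => Sigma.incl (C := fun q : (Σ r : I, r ⟶ l) => F.ob q.1) ⟨p.1, p.2 ≫ φ⟩

/-- The structure map `h_k : (T U F)_k ⥤ F_k` of the pseudo-algebra `F`: it is `F(f)` on the summand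
indexed by `f : r ⟶ k`. -/
def act (F : Ps.{u} I) (k : I) : F.TU k ⥤ F.ob k := Sigma.desc fun p => F.mp p.2

/-- The category `L_k` in the factorization `h_k = g_k ∘ v_k` of `h_k` as a bijective-on-objects
functor `v_k` followed by a fully faithful functor `g_k`: the objects are those of `(T U F)_k`, the
morphisms `x ⟶ y` are the morphisms `h_k x ⟶ h_k y` of `F_k`. -/
abbrev StObj (F : Ps.{u} I) (k : I) : Type u := InducedCategory (F.ob k) (F.act k).obj

/-- The functor `v_k`, the identity on objects. -/
def toStObj (F : Ps.{u} I) (k : I) : F.TU k ⥤ F.StObj k where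
  obj x := x
  map a := InducedCategory.homMk ((F.act k).map a)
  map_id x := InducedCategory.hom_ext ((F.act k).map_id x)
  map_comp a b := InducedCategory.hom_ext ((F.act k).map_comp a b)

/-- The fully faithful functor `g_k`. -/
def ofStObj (F : Ps.{u} I) (k : I) : F.StObj k ⥤ F.ob k := inducedFunctor _

theorem induced_ext {A C D : Type u} [SmallCategory A] [SmallCategory D] {o : C → D}
    {K L : A ⥤ InducedCategory D o} (h : ∀ a, K.obj a = L.obj a)
    (h' : ∀ {a b : A} (f : a ⟶ b), (K.map f).hom ≍ (L.map f).hom) : K = L := by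
  have key : ∀ {x y x' y' : InducedCategory D o} (f : x ⟶ y) (g : x' ⟶ y'), x = x' → y = y' →
      f.hom ≍ g.hom → f ≍ g := by
    intro x y x' y' f g hx hy e
    subst hx hy
    exact heq_of_eq (InducedCategory.hom_ext (eq_of_heq e))
  exact CategoryTheory.Functor.hext h fun a b f => key _ _ (h a) (h b) (h' f)

/-- The functor `L(φ) : L_k ⥤ L_l`. On objects it is that of `T U F`, on morphisms it is `F(φ)`
conjugated by the composition constraints of `F`. So `v` is strictly natural (`toStObj_stMap`) and
`g` is pseudo-natural with the composition constraints of `F` as its constraints (`counit`). -/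
def stMap (F : Ps.{u} I) {k l : I} (φ : k ⟶ l) : F.StObj k ⥤ F.StObj l where
  obj x := (F.tuMap φ).obj x
  map {x y} a := InducedCategory.homMk
    ((F.compIso x.1.2 φ x.2).hom ≫ (F.mp φ).map a.hom ≫ (F.compIso y.1.2 φ y.2).inv)
  map_id x := InducedCategory.hom_ext (by
    change (F.compIso x.1.2 φ x.2).hom ≫ (F.mp φ).map (𝟙 ((F.mp x.1.2).obj x.2)) ≫
      (F.compIso x.1.2 φ x.2).inv = 𝟙 _
    simp)
  map_comp {x y z} a b := InducedCategory.hom_ext (by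
    let a' : (F.mp x.1.2).obj x.2 ⟶ (F.mp y.1.2).obj y.2 := a.hom
    let b' : (F.mp y.1.2).obj y.2 ⟶ (F.mp z.1.2).obj z.2 := b.hom
    change (F.compIso x.1.2 φ x.2).hom ≫ (F.mp φ).map (a' ≫ b') ≫ (F.compIso z.1.2 φ z.2).inv =
      ((F.compIso x.1.2 φ x.2).hom ≫ (F.mp φ).map a' ≫ (F.compIso y.1.2 φ y.2).inv) ≫
      ((F.compIso y.1.2 φ y.2).hom ≫ (F.mp φ).map b' ≫ (F.compIso z.1.2 φ z.2).inv)
    simp)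

theorem toStObj_ofStObj (F : Ps.{u} I) (k : I) : F.toStObj k ⋙ F.ofStObj k = F.act k := rfl

theorem toStObj_stMap (F : Ps.{u} I) {k l : I} (φ : k ⟶ l) :
    F.toStObj k ⋙ F.stMap φ = F.tuMap φ ⋙ F.toStObj l := by
  refine induced_ext (fun a => rfl) ?_
  rintro _ _ ⟨a⟩
  rename_i p x y
  refine heq_of_eq ?_
  change (F.compIso p.2 φ x).hom ≫ (F.mp φ).map ((F.mp p.2).map a) ≫ (F.compIso p.2 φ y).inv =
    (F.mp (p.2 ≫ φ)).map a
  rw [← Category.assoc, ← F.compIso_naturality, Category.assoc, Iso.hom_inv_id, Category.comp_id]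

theorem stMap_id (F : Ps.{u} I) (k : I) : F.stMap (𝟙 k) = 𝟭 _ := by
  refine induced_ext (fun x => ?_) (fun {x y} a => ?_)
  · exact congrArg (fun q : x.1.1 ⟶ k => (⟨⟨x.1.1, q⟩, x.2⟩ : F.TU k)) (Category.comp_id x.1.2)
  · let a' : (F.mp x.1.2).obj x.2 ⟶ (F.mp y.1.2).obj y.2 := a.hom
    change (F.compIso x.1.2 (𝟙 k) x.2).hom ≫ (F.mp (𝟙 k)).map a' ≫
      (F.compIso y.1.2 (𝟙 k) y.2).inv ≍ a'
    have h (z : F.StObj k) : F.compIso z.1.2 (𝟙 k) z.2 =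
        eqToIso (by rw [Category.comp_id]) ≪≫ (F.idIso ((F.mp z.1.2).obj z.2)).symm := by
      ext
      have := F.compIso_id z.1.2 z.2
      rw [← Iso.eq_comp_inv] at this
      simpa using! this
    have h1 : (F.mp (𝟙 k)).map a' = (F.idIso _).hom ≫ a' ≫ (F.idIso _).inv := by
      rw [← Category.assoc, Iso.eq_comp_inv, F.idIso_naturality a']
    rw [h x, h y, h1]
    simp

theorem stMap_comp (F : Ps.{u} I) {k l m : I} (φ : k ⟶ l) (ψ : l ⟶ m) :
    F.stMap (φ ≫ ψ) = F.stMap φ ⋙ F.stMap ψ := by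
  refine induced_ext (fun x => ?_) (fun {x y} a => ?_)
  · exact congrArg (fun q : x.1.1 ⟶ m => (⟨⟨x.1.1, q⟩, x.2⟩ : F.TU m))
      (Category.assoc x.1.2 φ ψ).symm
  · let a' : (F.mp x.1.2).obj x.2 ⟶ (F.mp y.1.2).obj y.2 := a.hom
    change (F.compIso x.1.2 (φ ≫ ψ) x.2).hom ≫ (F.mp (φ ≫ ψ)).map a' ≫
      (F.compIso y.1.2 (φ ≫ ψ) y.2).inv ≍
      (F.compIso (x.1.2 ≫ φ) ψ x.2).hom ≫ (F.mp ψ).map ((F.compIso x.1.2 φ x.2).hom ≫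
        (F.mp φ).map a' ≫ (F.compIso y.1.2 φ y.2).inv) ≫ (F.compIso (y.1.2 ≫ φ) ψ y.2).inv
    have h (z : F.StObj k) : F.compIso (z.1.2 ≫ φ) ψ z.2 =
        eqToIso (by rw [Category.assoc]) ≪≫ F.compIso z.1.2 (φ ≫ ψ) z.2 ≪≫
          F.compIso φ ψ ((F.mp z.1.2).obj z.2) ≪≫ ((F.mp ψ).mapIso (F.compIso z.1.2 φ z.2)).symm := by
      ext
      have := F.compIso_assoc z.1.2 φ ψ z.2
      rw [← CategoryTheory.Functor.mapIso_hom, ← Iso.eq_comp_inv] at this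
      simpa using! this
    have h1 : (F.mp (φ ≫ ψ)).map a' = (F.compIso φ ψ _).hom ≫ (F.mp ψ).map ((F.mp φ).map a') ≫
        (F.compIso φ ψ _).inv := by
      rw [← Category.assoc, Iso.eq_comp_inv, F.compIso_naturality φ ψ a']
    rw [h x, h y, h1]
    simp
    simp only [← Category.assoc]
    exact (comp_eqToHom_heq _ _).symm

/-- The strict functor `St F : I ⥤ Cat`. -/
def st (F : Ps.{u} I) : I ⥤ Cat.{u, u} where
  obj k := Cat.of (F.StObj k)
  map φ := (F.stMap φ).toCatHom
  map_id k := Cat.ext (F.stMap_id k)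
  map_comp φ ψ := Cat.ext (F.stMap_comp φ ψ)

variable {F G : Ps.{u} I}

/-- The action of strictification on pseudo-natural transformations: `(r, f, x) ↦ (r, f, θ_r x)` on
objects, and on morphisms `θ_k` conjugated by the constraints of `θ`. -/
def stApp (θ : F ⟶ G) (k : I) : F.StObj k ⥤ G.StObj k where
  obj x := (⟨x.1, (app θ x.1.1).obj x.2⟩ : G.TU k)
  map {x y} a := InducedCategory.homMk
    ((nat θ x.1.2 x.2).inv ≫ (app θ k).map a.hom ≫ (nat θ y.1.2 y.2).hom)
  map_id x := InducedCategory.hom_ext (by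
    change (nat θ x.1.2 x.2).inv ≫ (app θ k).map (𝟙 ((F.mp x.1.2).obj x.2)) ≫
      (nat θ x.1.2 x.2).hom = 𝟙 _
    simp)
  map_comp {x y z} a b := InducedCategory.hom_ext (by
    let a' : (F.mp x.1.2).obj x.2 ⟶ (F.mp y.1.2).obj y.2 := a.hom
    let b' : (F.mp y.1.2).obj y.2 ⟶ (F.mp z.1.2).obj z.2 := b.hom
    change (nat θ x.1.2 x.2).inv ≫ (app θ k).map (a' ≫ b') ≫ (nat θ z.1.2 z.2).hom =
      ((nat θ x.1.2 x.2).inv ≫ (app θ k).map a' ≫ (nat θ y.1.2 y.2).hom) ≫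
      ((nat θ y.1.2 y.2).inv ≫ (app θ k).map b' ≫ (nat θ z.1.2 z.2).hom)
    simp)

theorem stApp_naturality (θ : F ⟶ G) {k l : I} (φ : k ⟶ l) :
    F.stMap φ ⋙ stApp θ l = stApp θ k ⋙ G.stMap φ := by
  refine induced_ext (fun x => rfl) (fun {x y} a => heq_of_eq ?_)
  let a' : (F.mp x.1.2).obj x.2 ⟶ (F.mp y.1.2).obj y.2 := a.hom
  change (nat θ (x.1.2 ≫ φ) x.2).inv ≫ (app θ l).map ((F.compIso x.1.2 φ x.2).hom ≫
      (F.mp φ).map a' ≫ (F.compIso y.1.2 φ y.2).inv) ≫ (nat θ (y.1.2 ≫ φ) y.2).hom =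
    (G.compIso x.1.2 φ ((app θ x.1.1).obj x.2)).hom ≫ (G.mp φ).map ((nat θ x.1.2 x.2).inv ≫
      (app θ k).map a' ≫ (nat θ y.1.2 y.2).hom) ≫ (G.compIso y.1.2 φ ((app θ y.1.1).obj y.2)).inv
  have h (z : F.StObj k) : nat θ (z.1.2 ≫ φ) z.2 =
      (app θ l).mapIso (F.compIso z.1.2 φ z.2) ≪≫ nat θ φ ((F.mp z.1.2).obj z.2) ≪≫
        (G.mp φ).mapIso (nat θ z.1.2 z.2) ≪≫ (G.compIso z.1.2 φ _).symm := by
    ext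
    have := nat_mul θ z.1.2 φ z.2
    rw [← Iso.eq_comp_inv] at this
    simpa using! this
  have h1 : (app θ l).map ((F.mp φ).map a') =
      (nat θ φ _).hom ≫ (G.mp φ).map ((app θ k).map a') ≫ (nat θ φ _).inv := by
    rw [← Category.assoc, Iso.eq_comp_inv, nat_naturality θ φ a']
  rw [h x, h y]
  simp [h1]

theorem stApp_id (k : I) : stApp (𝟙 F) k = 𝟭 _ := by
  refine induced_ext (fun x => rfl) (fun {x y} a => heq_of_eq ?_)
  let a' : (F.mp x.1.2).obj x.2 ⟶ (F.mp y.1.2).obj y.2 := a.hom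
  have h (z : F.StObj k) : nat (𝟙 F) z.1.2 z.2 = Iso.refl ((F.mp z.1.2).obj z.2) :=
    Iso.ext (nat_id F z.1.2 z.2)
  change (nat (𝟙 F) x.1.2 x.2).inv ≫ a' ≫ (nat (𝟙 F) y.1.2 y.2).hom = a'
  rw [h, h]
  exact (Category.id_comp _).trans (Category.comp_id _)

theorem stApp_comp {H : Ps.{u} I} (θ : F ⟶ G) (η : G ⟶ H) (k : I) :
    stApp (θ ≫ η) k = stApp θ k ⋙ stApp η k := by
  refine induced_ext (fun x => rfl) (fun {x y} a => heq_of_eq ?_)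
  let a' : (F.mp x.1.2).obj x.2 ⟶ (F.mp y.1.2).obj y.2 := a.hom
  have h (z : F.StObj k) : nat (θ ≫ η) z.1.2 z.2 =
      (app η k).mapIso (nat θ z.1.2 z.2) ≪≫ nat η z.1.2 ((app θ _).obj z.2) :=
    Iso.ext (nat_comp θ η z.1.2 z.2)
  change (nat (θ ≫ η) x.1.2 x.2).inv ≫ (app η k).map ((app θ k).map a') ≫
      (nat (θ ≫ η) y.1.2 y.2).hom = (nat η x.1.2 ((app θ _).obj x.2)).inv ≫
    (app η k).map ((nat θ x.1.2 x.2).inv ≫ (app θ k).map a' ≫ (nat θ y.1.2 y.2).hom) ≫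
      (nat η y.1.2 ((app θ _).obj y.2)).hom
  rw [h x, h y]
  simp only [Iso.trans_inv, Iso.trans_hom, CategoryTheory.Functor.mapIso_hom,
    CategoryTheory.Functor.mapIso_inv, CategoryTheory.Functor.map_comp, Category.assoc]
  exact Category.assoc _ _ _

/-- The strictification functor `St : Ps[I, Cat] ⥤ [I, Cat]`. -/
def St (I : Type) [SmallCategory I] : Ps.{u} I ⥤ (I ⥤ Cat.{u, u}) where
  obj F := F.st
  map θ :=
    { app k := (stApp θ k).toCatHom
      naturality _ _ φ := Cat.ext (stApp_naturality θ φ) }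
  map_id _ := NatTrans.ext (funext fun k => Cat.ext (stApp_id k))
  map_comp θ η := NatTrans.ext (funext fun k => Cat.ext (stApp_comp θ η k))

/-- A strict functor regarded as a pseudo-functor. -/
def ofStrict (X : I ⥤ Cat.{u, u}) : Ps.{u} I := ⟨X.toPseudofunctor'⟩

theorem eqToHom_toNatTrans_app {A B : Cat.{u, u}} {K L : A ⟶ B} (h : K = L) (x : A) :
    (eqToHom h).toNatTrans.app x = eqToHom (by rw [h]) := by
  subst h; rfl

/-- The constraints of the pseudo-natural transformation `g`. -/
def counitIso (F : Ps.{u} I) {k l : I} (f : k ⟶ l) :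
    F.stMap f ⋙ F.ofStObj l ≅ F.ofStObj k ⋙ F.mp f :=
  NatIso.ofComponents (fun x => F.compIso x.1.2 f x.2) (fun {x y} a => by
    let a' : (F.mp x.1.2).obj x.2 ⟶ (F.mp y.1.2).obj y.2 := a.hom
    change ((F.compIso x.1.2 f x.2).hom ≫ (F.mp f).map a' ≫
      (F.compIso y.1.2 f y.2).inv) ≫ (F.compIso y.1.2 f y.2).hom =
        (F.compIso x.1.2 f x.2).hom ≫ (F.mp f).map a'
    simp)

/-- A constructor for pseudo-natural transformations. -/
def mkHom (ap : ∀ a, F.toPs.obj a ⟶ G.toPs.obj a)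
    (nt : ∀ {a b : LocallyDiscrete I} (f : a ⟶ b), F.toPs.map f ≫ ap b ≅ ap a ≫ G.toPs.map f)
    (unit : ∀ {k : I} (x : F.ob k),
      (nt (𝟙 k).toLoc).hom.toNatTrans.app x ≫ (G.idIso ((ap ⟨k⟩).toFunctor.obj x)).hom =
        (ap ⟨k⟩).toFunctor.map (F.idIso x).hom)
    (mul : ∀ {k l m : I} (f : k ⟶ l) (g : l ⟶ m) (x : F.ob k),
      (nt (f ≫ g).toLoc).hom.toNatTrans.app x ≫
          (G.compIso f g ((ap ⟨k⟩).toFunctor.obj x)).hom =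
        (ap ⟨m⟩).toFunctor.map (F.compIso f g x).hom ≫
          (nt g.toLoc).hom.toNatTrans.app ((F.mp f).obj x) ≫
            (G.mp g).map ((nt f.toLoc).hom.toNatTrans.app x)) : F ⟶ G :=
  show Pseudofunctor.StrongTrans F.toPs G.toPs from
  { app := ap
    naturality := nt
    naturality_naturality {k l f g} h := by
      obtain rfl : f = g := LocallyDiscrete.eq_of_hom h
      obtain rfl : h = 𝟙 _ := Subsingleton.elim _ _
      simp
    naturality_id k := by
      ext x
      refine (unit x).trans ?_
      simp
      rfl
    naturality_comp {k l m} f g := by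
      ext x
      refine (mul f.as g.as x).trans ?_
      simp
      rfl }

theorem ofStrict_idIso (X : I ⥤ Cat.{u, u}) (k : I) (x : X.obj k) :
    ((ofStrict X).idIso x).hom = eqToHom (by change (X.map (𝟙 k)).toFunctor.obj x = x; simp) :=
  eqToHom_toNatTrans_app (X.map_id k) x

theorem ofStrict_compIso (X : I ⥤ Cat.{u, u}) {k l m : I} (f : k ⟶ l) (g : l ⟶ m) (x : X.obj k) :
    ((ofStrict X).compIso f g x).hom = eqToHom (by
      change (X.map (f ≫ g)).toFunctor.obj x = (X.map g).toFunctor.obj ((X.map f).toFunctor.obj x)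
      simp) :=
  eqToHom_toNatTrans_app (X.map_comp f g) x

/-- The pseudo-natural transformation `g : St F ⟶ F` given by the fully faithful functors `g_k`. -/
def counit (F : Ps.{u} I) : ofStrict ((St I).obj F) ⟶ F :=
  mkHom (fun k => (F.ofStObj k.as).toCatHom) (fun f => Cat.Hom.isoMk (F.counitIso f.as))
    (fun {k} x => by
      refine (F.compIso_id x.1.2 x.2).trans ?_
      refine Eq.trans ?_ (congrArg (fun q => (F.ofStObj k).map q) (ofStrict_idIso F.st k x).symm)
      exact (eqToHom_map (F.ofStObj k)
        (CategoryTheory.Functor.congr_obj (F.stMap_id k) x)).symm)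
    (fun {k l m} f g x => by
      have h := (congrArg (fun q => (F.ofStObj m).map q) (ofStrict_compIso F.st f g x)).trans
        (eqToHom_map (F.ofStObj m) _)
      have e := congrArg (fun q => eqToHom (by rw [Category.assoc]) ≫ q)
        (F.compIso_assoc x.1.2 f g x.2)
      refine Eq.trans ?_ (congrArg (fun q => q ≫ _) h.symm)
      refine Eq.trans ?_ e.symm
      simp
      rfl)

end Ps
end Pseudo

section Segalic

namespace Ps

variable {I : Type} [SmallCategory I]

theorem isoClasses_iso {C : Cat.{u, u}} {x y : C} (e : x ≅ y) :
    (Quotient.mk (isIsomorphicSetoid C) x : isomorphismClasses.obj C) =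
      Quotient.mk (isIsomorphicSetoid C) y := Quotient.sound ⟨e⟩

/-- Isomorphism classes of objects turn a pseudo-functor into a strict functor to sets. -/
def pbar (F : Ps.{u} I) : I ⥤ Type u where
  obj k := isomorphismClasses.obj (F.ob k)
  map f := isomorphismClasses.map (F.toPs.map f.toLoc)
  map_id k := by
    ext x
    induction x using Quotient.inductionOn with
    | h x => exact isoClasses_iso (F.idIso x)
  map_comp f g := by
    ext x
    induction x using Quotient.inductionOn with
    | h x => exact isoClasses_iso (F.compIso f g x)

/-- If `F_m` is discrete then `F(f ≫ g)` is equal to the composite of `F(f)` and `F(g)`. -/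
theorem mp_comp (F : Ps.{u} I) {k l m : I} (f : k ⟶ l) (g : l ⟶ m) (h : IsDiscrete (F.ob m)) :
    F.mp (f ≫ g) = F.mp f ⋙ F.mp g :=
  CategoryTheory.Functor.ext (fun x => obj_ext_of_isDiscrete (F.compIso f g x).hom)
    (fun _ _ _ => Subsingleton.elim _ _)

end Ps

variable {m : ℕ}

/-- The morphism of multi-indices that is `e` in direction `i` and the identity elsewhere. -/
def dir (i : Fin (m + 1)) (k : MIdx m) {s t : SimplexCategoryᵒᵖ} (e : s ⟶ t) :
    (ins i).obj (s, k) ⟶ (ins i).obj (t, k) := (ins i).map (CategoryTheory.Prod.mkHom e (𝟙 k))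

theorem dir_comp (i : Fin (m + 1)) (k : MIdx m) {s t r : SimplexCategoryᵒᵖ} (e : s ⟶ t) (f : t ⟶ r) :
    dir i k (e ≫ f) = dir i k e ≫ dir i k f := by
  unfold dir
  rw [← CategoryTheory.Functor.map_comp]
  congr 1

/-- The Segal map of `H` in direction `i`, from `H_k` (with `r` in direction `i`) to the `r`-fold
fibre product of `H_{k(1,i)}` over `H_{k(0,i)}`; it exists as `H_{k(0,i)}` is discrete. -/
def Ps.segalMap (H : Ps.{u} (MIdx (m + 1))) (i : Fin (m + 1)) (k : MIdx m)
    (h : IsDiscrete (H.ob ((ins i).obj (smp 0, k)))) (r : ℕ) :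
    H.ob ((ins i).obj (smp r, k)) ⥤ Chain (H.mp (dir i k src)) (H.mp (dir i k tgt)) r :=
  Chain.lift (fun j => H.mp (dir i k (spine r j))) (fun a b hab => by
    rw [← H.mp_comp _ _ h, ← H.mp_comp _ _ h, ← dir_comp, ← dir_comp, spine_link a b hab])

/-- Segalic pseudo-functors `Δ^{op (m+1)} → Cat`: `H_{k(0,i)}` is discrete for all `k` and `i`; all
Segal maps are isomorphisms; levelwise isomorphism classes of objects give (the nerve of) a weakly
globular `(m+1)`-fold category. -/
structure IsSegalic (H : Ps.{u} (MIdx (m + 1))) : Prop where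
  /-- The discreteness condition. -/
  discrete : ∀ i k, IsDiscrete (H.ob ((ins i).obj (smp 0, k)))
  /-- The Segal condition. -/
  segal : ∀ i k r, 2 ≤ r → IsIso (H.segalMap i k (discrete i k) r).toCatHom
  /-- The truncation condition, first part: the levelwise isomorphism classes of objects form a nerve
  in the last direction. -/
  multinerve : IsMultinerve H.pbar
  /-- The truncation condition, second part: they form a weakly globular object. -/
  wg : IsWG m ((toCat m).obj H.pbar)

end Segalic

/-- The category of weakly globular `(m+1)`-fold categories, as a full subcategory of
`[Δ^{op m}, Cat]`. -/
abbrev CatWG (m : ℕ) := ObjectProperty.FullSubcategory (IsWG.{u} m)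
/-- The category of Segalic pseudo-functors, as a full subcategory of `Ps[Δ^{op (m+1)}, Cat]`. -/
abbrev SegPs (m : ℕ) := ObjectProperty.FullSubcategory (fun H : Ps.{u} (MIdx (m + 1)) => IsSegalic H)

end NFold

end

noncomputable section

namespace NFold

section

/-! ### Isomorphisms of categories and of diagrams of categories -/

/-! Write $L=\mathrm{St}\,H$. The functor $g_k$ is fully faithful by construction and reaches $y\in
H_k$ up to isomorphism at $(k,\mathrm{id},y)$, by the unit constraint. So $g_k$ is an equivalence,
and $\bar pL\cong\bar pH$ (`pbar_st_iso`): the truncation of $L$ exists and is weakly globular. The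
rest extracts weak globularity of $L$ from this and from strict levelwise properties.

Levelwise properties (`IsSegalic.isLineWG`), along each line of multi-indices. In degree $0$, $L$ is
fully faithful over a discrete category, hence an equivalence relation. On objects $(p,f,a)$ the
structure maps only compose with $f$, and $[r]$ is glued in $\Delta$ from its spine edges, so the
objects of $L_r$ are exactly the chains of objects of $L_1$. Arrows of $L_r$ are arrows of $H_r$, a
fibre product over a discrete category; such a product puts no condition on arrows between given
objects, so the spine functors $L_r\to L_1$ are jointly fully faithful. Together these give the
Segal isomorphisms.

Criterion (`IsLevelwiseWG.isWG`): a diagram $X$ with these properties and a weakly globular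
truncation $pX$ is weakly globular. The proof is by induction on the number of directions.
Truncation commutes with slices (`sliceTruncIso`), so the $X_s$ satisfy the hypotheses again, and
$X_0$ is homotopically discrete by `isHD_succ`. The induced Segal maps of $X$ are levelwise fully
faithful. Apart from the lowest dimension, which is treated directly, their truncations are the
induced Segal maps of $pX$, which are equivalences by assumption. Then `IsFF.isNEquiv` applies: a
levelwise fully faithful map whose truncation is an equivalence is an equivalence. That is an
induction over hom-objects, using $p(X(a,b))\cong(pX)(a,b)$.

The commutation of truncation with hom-objects and with fibre products over $X_0^d$ rests on the
notion `IsClopen`. Both constructions are cut out by conditions with values in sets, so they are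
unions of connected components of $X_1$ or of a power of it. Clopen families are stable under slices
and truncation, inherit the relevant structure, and are determined by their objects
(`IsClopen.isIso`). -/

theorem isIso_toCatHom_of_bijective {C D : Type u} [SmallCategory C] [SmallCategory D] (F : C ⥤ D)
    (h : Function.Bijective F.obj)
    (h' : ∀ x y : C, Function.Bijective (F.map : (x ⟶ y) → (F.obj x ⟶ F.obj y))) :
    IsIso F.toCatHom := by
  let e := Equiv.ofBijective _ h
  have he : ∀ d, F.obj (e.symm d) = d := fun d => e.apply_symm_apply d
  have ff : F.FullyFaithful := (Functor.FullyFaithful.nonempty_iff_map_bijective F).2 h' |>.some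
  let G : D ⥤ C :=
    { obj := e.symm
      map {x y} f := ff.preimage (eqToHom (he x) ≫ f ≫ eqToHom (he y).symm)
      map_id x := ff.map_injective (by simp)
      map_comp f g := ff.map_injective (by simp) }
  have hGF : G ⋙ F = 𝟭 D := CategoryTheory.Functor.ext he (fun x y f => by simp [G])
  have hFG : F ⋙ G = 𝟭 C := by
    have hx : ∀ x, e.symm (F.obj x) = x := e.symm_apply_apply
    refine CategoryTheory.Functor.ext hx (fun x y f => ff.map_injective ?_)
    change F.map (ff.preimage _) = F.map (eqToHom (hx x) ≫ f ≫ eqToHom (hx y).symm)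
    rw [ff.map_preimage, CategoryTheory.Functor.map_comp, CategoryTheory.Functor.map_comp,
      eqToHom_map, eqToHom_map]
  exact ⟨G.toCatHom, Cat.ext hFG, Cat.ext hGF⟩

theorem isIso_cat_iff {C D : Cat.{u, u}} (F : C ⟶ D) :
    IsIso F ↔ Function.Bijective F.toFunctor.obj ∧ ∀ x y : C, Function.Bijective
      (F.toFunctor.map : (x ⟶ y) → (F.toFunctor.obj x ⟶ F.toFunctor.obj y)) := by
  constructor
  · intro hF
    have h1 : F.toFunctor ⋙ (inv F).toFunctor = 𝟭 C :=
      congrArg Cat.Hom.toFunctor (IsIso.hom_inv_id F)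
    have h2 : (inv F).toFunctor ⋙ F.toFunctor = 𝟭 D :=
      congrArg Cat.Hom.toFunctor (IsIso.inv_hom_id F)
    refine ⟨⟨fun x y h => ?_, fun y => ⟨(inv F).toFunctor.obj y, Functor.congr_obj h2 y⟩⟩, ?_⟩
    · have hx := Functor.congr_obj h1 x
      have hy := Functor.congr_obj h1 y
      simp only [Functor.comp_obj, Functor.id_obj] at hx hy
      rw [← hx, ← hy, h]
    · let e : C ≌ D := CategoryTheory.Equivalence.mk F.toFunctor (inv F).toFunctor
        (eqToIso h1.symm) (eqToIso h2)
      intro x y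
      exact (Functor.FullyFaithful.ofFullyFaithful e.functor).map_bijective x y
  · rintro ⟨h, h'⟩
    exact isIso_toCatHom_of_bijective F.toFunctor h h'

theorem isIso_diagram_iff {D : Type} [SmallCategory D] {A B : D ⥤ Cat.{u, u}} (f : A ⟶ B) :
    IsIso f ↔ ∀ d, Function.Bijective (f.app d).toFunctor.obj ∧ ∀ x y : A.obj d,
      Function.Bijective ((f.app d).toFunctor.map :
        (x ⟶ y) → ((f.app d).toFunctor.obj x ⟶ (f.app d).toFunctor.obj y)) := by
  rw [NatTrans.isIso_iff_isIso_app]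
  exact forall_congr' fun d => isIso_cat_iff _

/-! ### Simplicial sets which are nerves -/

/-- The canonical map from a simplicial set to the nerve of its homotopy category. -/
abbrev toNerve (K : SSet.{u}) : K ⟶ nerveFunctor.obj (SSet.hoFunctor.obj K) := nerveAdjunction.unit.app K

/-- A simplicial set is a nerve if it is isomorphic to the nerve of its homotopy category. -/
abbrev IsNerve (K : SSet.{u}) : Prop := IsIso (nerveAdjunction.unit.app K)

theorem isNerve_nerve (C : Cat.{u, u}) : IsNerve (nerveFunctor.obj C) := by
  have : IsIso (nerveAdjunction.unit.app (nerveFunctor.obj C)) :=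
    nerveFunctor.obj_mem_essImage C |>.unit_isIso
  exact this

/-- The nerve functor is fully faithful and has a left adjoint, so its essential image consists of
the objects with invertible unit. -/
theorem IsNerve.of_iso {K L : SSet.{u}} (e : K ≅ L) (h : IsNerve L) : IsNerve K := by
  have : nerveFunctor.essImage K :=
    ⟨_, ⟨(@asIso _ _ _ _ (nerveAdjunction.unit.app L) h).symm ≪≫ e.symm⟩⟩
  exact this.unit_isIso

theorem IsNerve.bijective {K : SSet.{u}} (h : IsNerve K) (t : SimplexCategoryᵒᵖ) :
    Function.Bijective ((toNerve K).app t) :=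
  (isIso_iff_bijective _).1 (@NatIso.isIso_app_of_isIso _ _ _ _ _ _ (toNerve K) h t)

/-- An isomorphism `f` factors as the unit followed by the nerve of its transpose, and the nerve
functor reflects isomorphisms. The second conclusion identifies the homotopy category of `K` with
`C`. -/
theorem isNerve_of_bijective {K : SSet.{u}} {C : Cat.{u, u}} (f : K ⟶ nerveFunctor.obj C)
    (h : ∀ t, Function.Bijective (f.app t)) :
    IsNerve K ∧ IsIso ((nerveAdjunction.homEquiv K C).symm f) := by
  have : IsIso f := by
    rw [NatTrans.isIso_iff_isIso_app]
    exact fun t => (isIso_iff_bijective _).2 (h t)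
  have h1 : IsNerve K := IsNerve.of_iso (asIso f) (isNerve_nerve C)
  refine ⟨h1, ?_⟩
  have e : toNerve K ≫ nerveFunctor.map ((nerveAdjunction.homEquiv K C).symm f) = f :=
    (Adjunction.homEquiv_unit _ _ _ _).symm.trans (Equiv.apply_symm_apply _ _)
  have h2 : IsIso (toNerve K) := h1
  have : IsIso (nerveFunctor.map ((nerveAdjunction.homEquiv K C).symm f)) := by
    rw [← e] at this
    exact IsIso.of_isIso_comp_left (toNerve K) _
  exact isIso_of_reflects_iso _ nerveFunctor

/-- A map from a simplicial set which is a nerve to a nerve, given by a functor. -/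
theorem toNerve_naturality {K L : SSet.{u}} (g : K ⟶ L) {t : SimplexCategoryᵒᵖ} (z : K.obj t) :
    (toNerve L).app t (g.app t z) =
      (nerveFunctor.map (SSet.hoFunctor.map g)).app t ((toNerve K).app t z) :=
  congrArg (fun q => q.app t z) (nerveAdjunction.unit.naturality g)

theorem IsNerve.exists_vtx {K : SSet.{u}} (h : IsNerve K) (b : SSet.hoFunctor.obj K) :
    ∃ z : K.obj (smp 0), vtx K z = b := by
  obtain ⟨z, hz⟩ := (h.bijective (smp 0)).2 (ComposableArrows.mk₀ b)
  exact ⟨z, by unfold vtx; erw [hz]; rfl⟩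

theorem IsNerve.vtx_injective {K : SSet.{u}} (h : IsNerve K) {z z' : K.obj (smp 0)}
    (e : vtx K z = vtx K z') : z = z' := by
  apply (h.bijective (smp 0)).1
  exact ComposableArrows.ext₀ e

/-- The vertex `j` of `[t]` in `Δ^{op}`. -/
def vert {t : SimplexCategoryᵒᵖ} (j : Fin (t.unop.len + 1)) : t ⟶ smp 0 :=
  (SimplexCategory.const _ _ j).op

theorem toNerve_obj {K : SSet.{u}} {t : SimplexCategoryᵒᵖ} (z : K.obj t) (j : Fin (t.unop.len + 1)) :
    ((toNerve K).app t z).obj j = vtx K (K.map (vert j) z) := by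
  have e : (toNerve K).app (smp 0) (K.map (vert j) z) =
      (nerve (SSet.hoFunctor.obj K)).map (vert j) ((toNerve K).app t z) :=
    congrArg (fun q => q z) ((toNerve K).naturality (vert j))
  unfold vtx
  erw [e]
  rfl

end

section

/-! ### Clopen families of functors -/

/-- The functors `Q_i : C ⥤ D` identify `C` with a full subcategory of the power of `D`, which is a
union of connected components. -/
structure IsClopenEmb {ι : Type} {C D : Type u} [SmallCategory C] [SmallCategory D]
    (Q : ι → (C ⥤ D)) : Prop where
  obj_injective : ∀ x y : C, (∀ i, (Q i).obj x = (Q i).obj y) → x = y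
  map_bijective : ∀ x y : C, Function.Bijective
    (fun (f : x ⟶ y) (i : ι) => ((Q i).map f : (Q i).obj x ⟶ (Q i).obj y))
  exists_target : ∀ (x : C) (y : ι → D), (∀ i, Nonempty ((Q i).obj x ⟶ y i)) →
    ∃ z : C, ∀ i, (Q i).obj z = y i
  exists_source : ∀ (x : C) (y : ι → D), (∀ i, Nonempty (y i ⟶ (Q i).obj x)) →
    ∃ z : C, ∀ i, (Q i).obj z = y i

namespace IsClopenEmb

variable {ι : Type} {C D : Type u} [SmallCategory C] [SmallCategory D] {Q : ι → (C ⥤ D)}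

theorem comp_isIso {E : Cat.{u, u}} {F : E ⟶ Cat.of C} [IsIso F] (h : IsClopenEmb Q) :
    IsClopenEmb (fun i => F.toFunctor ⋙ Q i) := by
  obtain ⟨h1, h2⟩ := (isIso_cat_iff F).1 inferInstance
  constructor
  · exact fun x y e => h1.1 (h.obj_injective _ _ e)
  · exact fun x y => (h.map_bijective _ _).comp (h2 x y)
  · intro x y f
    obtain ⟨z, hz⟩ := h.exists_target (F.toFunctor.obj x) y f
    obtain ⟨w, rfl⟩ := h1.2 z
    exact ⟨w, hz⟩
  · intro x y f
    obtain ⟨z, hz⟩ := h.exists_source (F.toFunctor.obj x) y f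
    obtain ⟨w, rfl⟩ := h1.2 z
    exact ⟨w, hz⟩

/-- Joint full faithfulness lifts the inverse isomorphisms componentwise. This is what makes clopen
families pass to isomorphism classes. -/
theorem nonempty_iso (h : IsClopenEmb Q) {x y : C}
    (e : ∀ i, Nonempty ((Q i).obj x ≅ (Q i).obj y)) : Nonempty (x ≅ y) := by
  replace e := fun i => (e i).some
  obtain ⟨f, hf⟩ := (h.map_bijective x y).2 (fun i => (e i).hom)
  obtain ⟨g, hg⟩ := (h.map_bijective y x).2 (fun i => (e i).inv)
  have hf' : ∀ i, (Q i).map f = (e i).hom := congrFun hf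
  have hg' : ∀ i, (Q i).map g = (e i).inv := congrFun hg
  exact ⟨f, g, (h.map_bijective x x).1 (funext fun i => by simp [hf', hg']),
    (h.map_bijective y y).1 (funext fun i => by simp [hf', hg'])⟩

theorem isEqRel (h : IsClopenEmb Q) (hD : IsEqRel D) : IsEqRel C := by
  obtain ⟨h1, h2⟩ := hD
  refine ⟨fun x y => ⟨fun f g => (h.map_bijective x y).1 (funext fun i => (h1 _ _).elim _ _)⟩, ?_⟩
  rintro x y ⟨f⟩
  have g := fun i => (h2 _ _ ⟨(Q i).map f⟩ : Nonempty ((Q i).obj y ⟶ (Q i).obj x)).some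
  obtain ⟨g', -⟩ := (h.map_bijective y x).2 g
  exact ⟨g'⟩

end IsClopenEmb

/-! ### Clopen families of maps of simplicial sets -/

/-- The maps `q_i : K ⟶ L` identify `K` with a subobject of the power of `L`, which is a union of
connected components. -/
structure IsClopenSSet {ι : Type} {K L : SSet.{u}} (q : ι → (K ⟶ L)) : Prop where
  injective : ∀ (t : SimplexCategoryᵒᵖ) (z z' : K.obj t),
    (∀ i, (q i).app t z = (q i).app t z') → z = z'
  exists_lift : ∀ {s t : SimplexCategoryᵒᵖ} (f : s ⟶ t) (x : ι → L.obj s) (z : K.obj t),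
    (∀ i, (q i).app t z = L.map f (x i)) → ∃ w : K.obj s, ∀ i, (q i).app s w = x i

namespace IsClopenSSet

variable {ι : Type} {K L : SSet.{u}}

/-- The families of objects of the homotopy category which come from a vertex of `K`. -/
def vertexFamily (q : ι → (K ⟶ L)) : ObjectProperty (ι → SSet.hoFunctor.obj L) :=
  fun b => ∃ z : K.obj (smp 0), ∀ i, vtx L ((q i).app _ z) = b i

/-- The `i`-th component. -/
def vertexFamilyProj (q : ι → (K ⟶ L)) (i : ι) :
    (vertexFamily q).FullSubcategory ⥤ SSet.hoFunctor.obj L :=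
  (vertexFamily q).ι ⋙ Pi.eval _ i

theorem vertexFamily_functor_ext (q : ι → (K ⟶ L)) {A : Type*} [Category* A]
    {F G : A ⥤ (vertexFamily q).FullSubcategory}
    (h : ∀ i, F ⋙ vertexFamilyProj q i = G ⋙ vertexFamilyProj q i) : F = G := by
  have h' : F ⋙ (vertexFamily q).ι = G ⋙ (vertexFamily q).ι := Functor.pi_ext _ _ h
  refine CategoryTheory.Functor.ext (fun x => ?_) (fun x y f => ?_)
  · exact ObjectProperty.FullSubcategory.ext (CategoryTheory.Functor.congr_obj h' x)
  · apply (vertexFamily q).ι.map_injective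
    refine (CategoryTheory.Functor.congr_hom h' f).trans ?_
    simp

/-- The map to the nerve of the category of vertex families. -/
def toVertexFamily (q : ι → (K ⟶ L)) :
    K ⟶ nerveFunctor.obj (Cat.of (vertexFamily q).FullSubcategory) where
  app t := TypeCat.ofHom fun z => (vertexFamily q).lift
    (Functor.pi' fun i => (toNerve L).app t ((q i).app t z)) (fun j =>
      ⟨K.map (vert j) z, fun i => by
        refine Eq.trans ?_ (toNerve_obj _ j).symm
        rw [NatTrans.naturality_apply (q i) (vert j) z]⟩)
  naturality s t f := by
    ext z
    refine vertexFamily_functor_ext q fun i => ?_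
    change (toNerve L).app t ((q i).app t (K.map f z)) =
      (nerveFunctor.obj (SSet.hoFunctor.obj L)).map f ((toNerve L).app s ((q i).app s z))
    rw [NatTrans.naturality_apply (q i) f z, NatTrans.naturality_apply (toNerve L) f]

theorem toVertexFamily_proj (q : ι → (K ⟶ L)) (i : ι) :
    toVertexFamily q ≫ nerveFunctor.map (vertexFamilyProj q i).toCatHom = q i ≫ toNerve L := rfl

theorem toVertexFamily_app_proj (q : ι → (K ⟶ L)) {t : SimplexCategoryᵒᵖ} (z : K.obj t) (i : ι) :
    (((toVertexFamily q).app t z) ⋙ vertexFamilyProj q i : ComposableArrows _ _) =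
      (toNerve L).app t ((q i).app t z) := rfl

variable {q : ι → (K ⟶ L)}

/-- For surjectivity, a chain of vertex families is a family of simplices of `L` because `L` is a
nerve. Its vertex `0` comes from `K` by definition of `vertexFamily`, and then `exists_lift` along
`vert 0` brings the whole simplex into `K`. -/
theorem toVertexFamily_bijective (hL : IsNerve L) (h : IsClopenSSet q) (t : SimplexCategoryᵒᵖ) :
    Function.Bijective ((toVertexFamily q).app t) := by
  constructor
  · intro z z' e
    refine h.injective t z z' fun i => (hL.bijective t).1 ?_
    rw [← toVertexFamily_app_proj, ← toVertexFamily_app_proj, e]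
  · intro G
    choose x hx using fun i => (hL.bijective t).2 (G ⋙ vertexFamilyProj q i : ComposableArrows _ _)
    obtain ⟨z, hz⟩ := (G.obj 0).property
    obtain ⟨w, hw⟩ := h.exists_lift (vert 0) x z (fun i => hL.vtx_injective (by
      rw [hz, ← toNerve_obj]
      erw [hx]
      rfl))
    refine ⟨w, vertexFamily_functor_ext q fun i => ?_⟩
    erw [toVertexFamily_app_proj, hw, hx]
    rfl

/-- An arrow of the homotopy category is an edge of the nerve `L`. If one of its ends comes from
`K`, the edge lifts to `K`, and so does its other end: lifting along `vert 0` gives closure under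
targets, along `vert 1` under sources. -/
theorem vertexFamilyProj_isClopenEmb (hL : IsNerve L) (h : IsClopenSSet q) :
    IsClopenEmb (vertexFamilyProj q) := by
  constructor
  · intro x y e
    exact ObjectProperty.FullSubcategory.ext (funext e)
  · intro x y
    constructor
    · intro f g e
      exact (vertexFamily q).ι.map_injective e
    · intro f
      exact ⟨(vertexFamily q).fullyFaithfulι.preimage f, rfl⟩
  · intro x y f
    obtain ⟨z, hz⟩ := x.property
    choose e he using fun i => (hL.bijective (smp 1)).2 (ComposableArrows.mk₁ (f i).some)
    obtain ⟨w, hw⟩ := h.exists_lift (vert 0) e z (fun i => hL.vtx_injective (by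
      rw [hz, ← toNerve_obj]
      erw [he]
      rfl))
    refine ⟨⟨y, K.map (vert 1) w, fun i => ?_⟩, fun i => rfl⟩
    rw [NatTrans.naturality_apply (q i) (vert 1) w, hw, ← toNerve_obj]
    erw [he]
    rfl
  · intro x y f
    obtain ⟨z, hz⟩ := x.property
    choose e he using fun i => (hL.bijective (smp 1)).2 (ComposableArrows.mk₁ (f i).some)
    obtain ⟨w, hw⟩ := h.exists_lift (vert 1) e z (fun i => hL.vtx_injective (by
      rw [hz, ← toNerve_obj]
      erw [he]
      rfl))
    refine ⟨⟨y, K.map (vert 0) w, fun i => ?_⟩, fun i => rfl⟩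
    rw [NatTrans.naturality_apply (q i) (vert 0) w, hw, ← toNerve_obj]
    erw [he]
    rfl

theorem isNerve (hL : IsNerve L) (h : IsClopenSSet q) : IsNerve K :=
  (isNerve_of_bijective _ (h.toVertexFamily_bijective hL)).1

/-- The transpose of `toVertexFamily` is an isomorphism from the homotopy category of `K` to the
category of vertex families, and it carries the functors induced by `q i` to the projections. -/
theorem isClopenEmb (hL : IsNerve L) (h : IsClopenSSet q) :
    IsClopenEmb (fun i => (SSet.hoFunctor.map (q i)).toFunctor) := by
  have := (isNerve_of_bijective _ (h.toVertexFamily_bijective hL)).2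
  have e : ∀ i, (nerveAdjunction.homEquiv K _).symm (toVertexFamily q) ≫
      (vertexFamilyProj q i).toCatHom = SSet.hoFunctor.map (q i) := by
    intro i
    apply (nerveAdjunction.homEquiv K _).injective
    rw [Adjunction.homEquiv_naturality_right, Equiv.apply_symm_apply]
    exact (toVertexFamily_proj q i).trans ((nerveAdjunction.unit.naturality (q i)).trans
      (Adjunction.homEquiv_unit _ _ _ _).symm)
  have := (vertexFamilyProj_isClopenEmb hL h).comp_isIso
    (F := (nerveAdjunction.homEquiv K _).symm (toVertexFamily q))
  convert! this using 2 with i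
  exact congrArg Cat.Hom.toFunctor (e i).symm

end IsClopenSSet

end

section

/-! ### The Segal condition -/

/-- The functors `ν_i : A ⥤ C` exhibit `A` as the iterated fibre product of `C` over `Z`. -/
structure IsChainIso {A C Z : Type u} [SmallCategory A] [SmallCategory C] [SmallCategory Z]
    (s t : C ⥤ Z) {k : ℕ} (ν : Fin k → (A ⥤ C)) : Prop where
  obj_injective : ∀ x y : A, (∀ i, (ν i).obj x = (ν i).obj y) → x = y
  exists_obj : ∀ c : Fin k → C, (∀ i j : Fin k, (i : ℕ) + 1 = j → t.obj (c i) = s.obj (c j)) →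
    ∃ x : A, ∀ i, (ν i).obj x = c i
  map_injective : ∀ (x y : A) (f g : x ⟶ y), (∀ i, (ν i).map f = (ν i).map g) → f = g
  exists_map : ∀ (x y : A) (a : ∀ i, (ν i).obj x ⟶ (ν i).obj y),
    (∀ i j : Fin k, (i : ℕ) + 1 = j → t.map (a i) ≍ s.map (a j)) →
      ∃ f : x ⟶ y, ∀ i, (ν i).map f = a i

theorem bijective_chainLift_iff {A C Z : Type u} [SmallCategory A] [SmallCategory C]
    [SmallCategory Z] {s t : C ⥤ Z} {k : ℕ} (ν : Fin k → (A ⥤ C))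
    (hν : ∀ i j : Fin k, (i : ℕ) + 1 = j → ν i ⋙ t = ν j ⋙ s) :
    (Function.Bijective (Chain.lift ν hν).obj ∧ ∀ x y : A, Function.Bijective
      ((Chain.lift ν hν).map : (x ⟶ y) → ((Chain.lift ν hν).obj x ⟶ (Chain.lift ν hν).obj y))) ↔
      IsChainIso s t ν := by
  constructor
  · rintro ⟨h1, h2⟩
    refine ⟨fun x y e => h1.1 (Chain.ext (funext e)), fun c hc => ?_,
      fun x y f g e => (h2 x y).1 (Chain.Hom.ext (funext e)), fun x y a ha => ?_⟩
    · obtain ⟨x, hx⟩ := h1.2 ⟨c, hc⟩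
      exact ⟨x, fun i => congrFun (congrArg Chain.obj hx) i⟩
    · obtain ⟨f, hf⟩ := (h2 x y).2 ⟨a, fun i j h => (conj_eqToHom_iff_heq (t.map (a i)) (s.map (a j))
        (((Chain.lift ν hν).obj x).link i j h) (((Chain.lift ν hν).obj y).link i j h)).2 (ha i j h)⟩
      exact ⟨f, fun i => congrFun (congrArg Chain.Hom.app hf) i⟩
  · intro h
    refine ⟨⟨fun x y e => h.obj_injective x y (congrFun (congrArg Chain.obj e)), fun c => ?_⟩,
      fun x y => ⟨fun f g e => h.map_injective x y f g (congrFun (congrArg Chain.Hom.app e)),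
        fun a => ?_⟩⟩
    · obtain ⟨x, hx⟩ := h.exists_obj c.obj c.link
      exact ⟨x, Chain.ext (funext hx)⟩
    · obtain ⟨f, hf⟩ := h.exists_map x y a.app
        (fun i j h => (conj_eqToHom_iff_heq (t.map (a.app i)) (s.map (a.app j))
          (((Chain.lift ν hν).obj x).link i j h) (((Chain.lift ν hν).obj y).link i j h)).1 (a.link i j h))
      exact ⟨f, Chain.Hom.ext (funext hf)⟩

theorem isIso_chainLift_iff {A C Z : Type u} [SmallCategory A] [SmallCategory C] [SmallCategory Z]
    {s t : C ⥤ Z} {k : ℕ} (ν : Fin k → (A ⥤ C))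
    (hν : ∀ i j : Fin k, (i : ℕ) + 1 = j → ν i ⋙ t = ν j ⋙ s) :
    IsIso (Chain.lift ν hν).toCatHom ↔ IsChainIso s t ν :=
  (isIso_cat_iff _).trans (bijective_chainLift_iff ν hν)

theorem isSegal_iff {D : Type} [SmallCategory D] (X : SimplexCategoryᵒᵖ ⥤ (D ⥤ Cat.{u, u})) :
    IsSegal X ↔ ∀ k, 2 ≤ k → ∀ d, IsChainIso ((X.map src).app d).toFunctor
      ((X.map tgt).app d).toFunctor (fun j : Fin k => ((X.map (spine k j)).app d).toFunctor) := by
  refine forall_congr' fun k => forall_congr' fun _ => ?_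
  rw [NatTrans.isIso_iff_isIso_app]
  exact forall_congr' fun d => isIso_chainLift_iff _ _

/-! ### Clopen families of maps of diagrams of categories -/

/-- The maps `q_i : W ⟶ A` identify `W` with a full subdiagram of the power of `A`, which is a union
of connected components. -/
structure IsClopen {ι D : Type} [SmallCategory D] {W A : D ⥤ Cat.{u, u}} (q : ι → (W ⟶ A)) :
    Prop where
  emb : ∀ k, IsClopenEmb (fun i => ((q i).app k).toFunctor)
  exists_lift : ∀ {k l : D} (f : k ⟶ l) (x : ι → A.obj k) (w : W.obj l),
    (∀ i, ((q i).app l).toFunctor.obj w = (A.map f).toFunctor.obj (x i)) →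
      ∃ v : W.obj k, ∀ i, ((q i).app k).toFunctor.obj v = x i

theorem natTrans_obj {D : Type} [SmallCategory D] {W A : D ⥤ Cat.{u, u}} (q : W ⟶ A) {k l : D}
    (f : k ⟶ l) (w : W.obj k) : (q.app l).toFunctor.obj ((W.map f).toFunctor.obj w) =
      (A.map f).toFunctor.obj ((q.app k).toFunctor.obj w) :=
  congrArg (fun F : W.obj k ⟶ A.obj l => F.toFunctor.obj w) (q.naturality f)

theorem natTrans_map {D : Type} [SmallCategory D] {W A : D ⥤ Cat.{u, u}} (q : W ⟶ A) {k l : D}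
    (f : k ⟶ l) {w w' : W.obj k} (a : w ⟶ w') :
    (q.app l).toFunctor.map ((W.map f).toFunctor.map a) ≍
      (A.map f).toFunctor.map ((q.app k).toFunctor.map a) := by
  have := Functor.congr_hom (congrArg Cat.Hom.toFunctor (q.naturality f)) a
  exact (conj_eqToHom_iff_heq _ _ (natTrans_obj q f w) (natTrans_obj q f w')).1 this

theorem map_heq_map {C D : Type*} [Category* C] [Category* D] (F : C ⥤ D) {x y x' y' : C}
    {f : x ⟶ y} {g : x' ⟶ y'} (hx : x = x') (hy : y = y') (h : f ≍ g) : F.map f ≍ F.map g := by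
  subst hx hy
  rw [eq_of_heq h]

theorem eqToHom_conj_heq {C : Type*} [Category* C] {x y x' y' : C} (f : x ⟶ y) (hx : x' = x)
    (hy : y = y') : eqToHom hx ≫ f ≫ eqToHom hy ≍ f := by
  subst hx hy
  simp

/-- Seen as a one-member clopen family, an isomorphism transports every property that clopen
families inherit; invariance under isomorphism then needs no separate proof. -/
theorem isClopen_of_isIso {D : Type} [SmallCategory D] {W A : D ⥤ Cat.{u, u}} (q : W ⟶ A) [IsIso q] :
    IsClopen (fun _ : Unit => q) := by
  have h := (isIso_diagram_iff q).1 inferInstance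
  have hs : ∀ {k : D} (y : Unit → A.obj k), ∃ z, ∀ i, (q.app k).toFunctor.obj z = y i := fun {k} y => by
    obtain ⟨z, hz⟩ := (h k).1.2 (y ())
    exact ⟨z, fun _ => hz⟩
  refine ⟨fun k => ⟨fun x y e => (h k).1.1 (e ()), fun x y => ⟨fun f g e => ?_, fun f => ?_⟩,
    fun _ y _ => hs y, fun _ y _ => hs y⟩, fun _ x _ _ => hs x⟩
  · exact ((h k).2 x y).1 (congrFun e ())
  · obtain ⟨g, hg⟩ := ((h k).2 x y).2 (f ())
    exact ⟨g, funext fun _ => hg⟩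

namespace IsClopen

theorem slice {ι : Type} {m : ℕ} {W A : MCat.{u} (m + 1)} {q : ι → (W ⟶ A)} (h : IsClopen q)
    (s : SimplexCategoryᵒᵖ) : IsClopen (fun i => ((slices m).map (q i)).app s) :=
  ⟨fun _ => h.emb _, fun {k l} f x w e => h.exists_lift
    ((ins 0).map (CategoryTheory.Prod.mkHom (𝟙 s) f : (s, k) ⟶ (s, l))) x w e⟩

/-- A chain in $W_1$ has componentwise images in $A_1$, which are filled uniquely in $A_r$. One edge
of the filler lies in $W$, so `exists_lift` along that edge puts the filler in $W$. Arrows are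
filled componentwise and reassembled by joint full faithfulness. -/
theorem isSegal {ι : Type} {m : ℕ} {W A : MCat.{u} (m + 1)} {q : ι → (W ⟶ A)} (h : IsClopen q)
    (hA : IsSegal ((slices m).obj A)) : IsSegal ((slices m).obj W) := by
  rw [isSegal_iff] at hA ⊢
  intro r hr k
  specialize hA r hr k
  have nat_obj : ∀ (i : ι) {s t : SimplexCategoryᵒᵖ} (e : s ⟶ t) (w : (((slices m).obj W).obj s).obj k),
      ((((slices m).map (q i)).app t).app k).toFunctor.obj
        ((((slices m).obj W).map e).app k |>.toFunctor.obj w) =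
      ((((slices m).obj A).map e).app k).toFunctor.obj
        (((((slices m).map (q i)).app s).app k).toFunctor.obj w) := fun i s t e w =>
    natTrans_obj (q i) ((ins 0).map (CategoryTheory.Prod.mkHom e (𝟙 k))) w
  have nat_map : ∀ (i : ι) {s t : SimplexCategoryᵒᵖ} (e : s ⟶ t)
      {w w' : (((slices m).obj W).obj s).obj k} (a : w ⟶ w'),
      ((((slices m).map (q i)).app t).app k).toFunctor.map
        ((((slices m).obj W).map e).app k |>.toFunctor.map a) ≍
      ((((slices m).obj A).map e).app k).toFunctor.map
        (((((slices m).map (q i)).app s).app k).toFunctor.map a) := fun i s t e w w' a =>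
    natTrans_map (q i) ((ins 0).map (CategoryTheory.Prod.mkHom e (𝟙 k))) a
  have emb : ∀ s, IsClopenEmb fun i => ((((slices m).map (q i)).app s).app k).toFunctor :=
    fun s => (h.slice s).emb k
  have lift : ∀ {s t : SimplexCategoryᵒᵖ} (e : s ⟶ t) (x : ι → (((slices m).obj A).obj s).obj k)
      (w : (((slices m).obj W).obj t).obj k), (∀ i,
        ((((slices m).map (q i)).app t).app k).toFunctor.obj w =
          ((((slices m).obj A).map e).app k).toFunctor.obj (x i)) →
        ∃ v : (((slices m).obj W).obj s).obj k, ∀ i,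
          ((((slices m).map (q i)).app s).app k).toFunctor.obj v = x i := fun e x w hw =>
    h.exists_lift ((ins 0).map (CategoryTheory.Prod.mkHom e (𝟙 k))) x w hw
  have link : ∀ (x : (((slices m).obj W).obj (smp r)).obj k) (i j : Fin r), (i : ℕ) + 1 = j →
      ((((slices m).obj W).map tgt).app k).toFunctor.obj
        ((((slices m).obj W).map (spine r i)).app k |>.toFunctor.obj x) =
      ((((slices m).obj W).map src).app k).toFunctor.obj
        ((((slices m).obj W).map (spine r j)).app k |>.toFunctor.obj x) := fun x i j hij => by
    have := congrArg (fun e => (((slices m).obj W).map e).app k) (spine_link i j hij)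
    simp only [Functor.map_comp] at this
    exact congrArg (fun F : (((slices m).obj W).obj (smp r)).obj k ⟶ _ => F.toFunctor.obj x) this
  constructor
  · intro x y e
    refine (emb _).obj_injective x y fun i => hA.obj_injective _ _ fun j => ?_
    rw [← nat_obj, ← nat_obj, e]
  · intro c hc
    choose x hx using fun i => hA.exists_obj
      (fun j => ((((slices m).map (q i)).app (smp 1)).app k).toFunctor.obj (c j))
      (fun j j' hj => by rw [← nat_obj, ← nat_obj, hc j j' hj])
    -- Any single edge would serve; the bound on `r` guarantees that edge `0` exists.
    obtain ⟨w, hw⟩ := lift (spine r ⟨0, by omega⟩) x (c ⟨0, by omega⟩)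
      (fun i => (hx i ⟨0, by omega⟩).symm)
    refine ⟨w, fun j => (emb _).obj_injective _ _ fun i => ?_⟩
    rw [nat_obj, ← hx i j, hw i]
  · intro x y f g e
    refine ((emb _).map_bijective x y).1 (funext fun i => hA.map_injective _ _ _ _ fun j => ?_)
    refine eq_of_heq ((nat_map i (spine r j) f).symm.trans (HEq.trans ?_ (nat_map i (spine r j) g)))
    rw [e]
  · intro x y a ha
    choose g hg using fun i => hA.exists_map
      (((((slices m).map (q i)).app (smp r)).app k).toFunctor.obj x)
      (((((slices m).map (q i)).app (smp r)).app k).toFunctor.obj y)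
      (fun j => eqToHom (nat_obj i _ x).symm ≫
        ((((slices m).map (q i)).app (smp 1)).app k).toFunctor.map (a j) ≫
          eqToHom (nat_obj i _ y)) (fun j j' hj => by
        refine (map_heq_map _ (nat_obj i _ x).symm (nat_obj i _ y).symm
          (eqToHom_conj_heq _ _ _)).trans (HEq.trans ?_ (map_heq_map _ (nat_obj i _ x).symm
            (nat_obj i _ y).symm (eqToHom_conj_heq _ _ _)).symm)
        refine (nat_map i _ _).symm.trans (HEq.trans ?_ (nat_map i _ _))
        exact map_heq_map _ (link x j j' hj) (link y j j' hj) (ha j j' hj))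
    obtain ⟨f, hf⟩ := ((emb _).map_bijective x y).2 g
    refine ⟨f, fun j => ((emb _).map_bijective _ _).1 (funext fun i => eq_of_heq ?_)⟩
    refine (nat_map i _ f).trans ?_
    have hf' : ((((slices m).map (q i)).app (smp r)).app k).toFunctor.map f = g i := congrFun hf i
    rw [hf', hg i j]
    exact eqToHom_conj_heq _ _ _

end IsClopen

end

section

/-! ### Multinerves -/

variable {m : ℕ}

/-- The simplicial set of isomorphism classes of objects of `A`, in the last direction. -/
abbrev classes (A : MCat.{u} (m + 1)) (k : MIdx m) : SSet.{u} :=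
  ((lastDir m).obj ((pbar (m + 1)).obj A)).obj k

/-- The map induced on isomorphism classes. -/
abbrev classesMap {W A : MCat.{u} (m + 1)} (q : W ⟶ A) (k : MIdx m) : classes W k ⟶ classes A k :=
  ((lastDir m).map ((pbar (m + 1)).map q)).app k

/-- The isomorphism class of an object. -/
def cls {A : MCat.{u} (m + 1)} {k : MIdx m} {t : SimplexCategoryᵒᵖ}
    (x : A.obj ((ins (Fin.last m)).obj (t, k))) : (classes A k).obj t :=
  Quotient.mk (isIsomorphicSetoid _) x

theorem cls_surjective {A : MCat.{u} (m + 1)} {k : MIdx m} {t : SimplexCategoryᵒᵖ}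
    (z : (classes A k).obj t) : ∃ x, cls x = z := Quotient.exists_rep z

theorem cls_eq_iff {A : MCat.{u} (m + 1)} {k : MIdx m} {t : SimplexCategoryᵒᵖ}
    {x y : A.obj ((ins (Fin.last m)).obj (t, k))} : cls x = cls y ↔ Nonempty (x ≅ y) :=
  Quotient.eq (r := isIsomorphicSetoid _)

/-- The operator in the last direction. -/
abbrev lastMap (k : MIdx m) {s t : SimplexCategoryᵒᵖ} (e : s ⟶ t) :
    (ins (Fin.last m)).obj (s, k) ⟶ (ins (Fin.last m)).obj (t, k) :=
  (ins (Fin.last m)).map (CategoryTheory.Prod.mkHom e (𝟙 k))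

/-- The operator in the directions other than the last. -/
abbrev restMap (t : SimplexCategoryᵒᵖ) {k l : MIdx m} (f : k ⟶ l) :
    (ins (Fin.last m)).obj (t, k) ⟶ (ins (Fin.last m)).obj (t, l) :=
  (ins (Fin.last m)).map (CategoryTheory.Prod.mkHom (𝟙 t) f)

/-- The unit is natural, so if it is invertible at each multi-index then it is an isomorphism of
diagrams, with `toCat` as the required diagram of categories. -/
theorem isMultinerve_iff (S : MSet.{u} (m + 1)) :
    IsMultinerve S ↔ ∀ k, IsNerve (((lastDir m).obj S).obj k) := by
  constructor
  · rintro ⟨A, ⟨e⟩⟩ k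
    exact IsNerve.of_iso (e.app k) (isNerve_nerve (A.obj k))
  · intro h
    have : IsIso (Functor.whiskerLeft ((lastDir m).obj S) nerveAdjunction.unit) := by
      rw [NatTrans.isIso_iff_isIso_app]
      exact h
    exact ⟨(toCat m).obj S, ⟨(Functor.rightUnitor _).symm ≪≫
      @asIso _ _ _ _ (Functor.whiskerLeft ((lastDir m).obj S) nerveAdjunction.unit) this⟩⟩

/-- The truncation is a multinerve. -/
abbrev HasTrunc (A : MCat.{u} (m + 1)) : Prop := IsMultinerve ((pbar (m + 1)).obj A)

theorem HasTrunc.isNerve {A : MCat.{u} (m + 1)} (h : HasTrunc A) (k : MIdx m) :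
    IsNerve (classes A k) := (isMultinerve_iff _).1 h k

/-- The vertex `0`, in the last direction, of the class of an object. -/
abbrev vtxCls {A : MCat.{u} (m + 1)} {k : MIdx m} {t : SimplexCategoryᵒᵖ}
    (x : A.obj ((ins (Fin.last m)).obj (t, k))) : ((trunc m).obj A).obj k :=
  vtx (classes A k) (cls x)

theorem HasTrunc.exists_vtxCls {A : MCat.{u} (m + 1)} (h : HasTrunc A) {k : MIdx m}
    (b : ((trunc m).obj A).obj k) :
    ∃ x : A.obj ((ins (Fin.last m)).obj (smp 0, k)), vtxCls x = b := by
  obtain ⟨z, rfl⟩ := (h.isNerve k).exists_vtx b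
  obtain ⟨x, rfl⟩ := cls_surjective z
  exact ⟨x, rfl⟩

theorem HasTrunc.vtxCls_eq_iff {A : MCat.{u} (m + 1)} (h : HasTrunc A) {k : MIdx m}
    {x y : A.obj ((ins (Fin.last m)).obj (smp 0, k))} : vtxCls x = vtxCls y ↔ Nonempty (x ≅ y) :=
  ⟨fun e => cls_eq_iff.1 ((h.isNerve k).vtx_injective e), fun e =>
    congrArg (vtx (classes A k)) (cls_eq_iff.2 e)⟩

theorem vtxCls_map {W A : MCat.{u} (m + 1)} (q : W ⟶ A) {k : MIdx m} {t : SimplexCategoryᵒᵖ}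
    (x : W.obj ((ins (Fin.last m)).obj (t, k))) :
    (((trunc m).map q).app k).toFunctor.obj (vtxCls x) = vtxCls ((q.app _).toFunctor.obj x) :=
  vtx_naturality (classesMap q k) (cls x)

theorem trunc_map_vtxCls {A : MCat.{u} (m + 1)} {k l : MIdx m} (f : k ⟶ l) {t : SimplexCategoryᵒᵖ}
    (x : A.obj ((ins (Fin.last m)).obj (t, k))) :
    (((trunc m).obj A).map f).toFunctor.obj (vtxCls x) =
      vtxCls ((A.map (restMap t f)).toFunctor.obj x) :=
  vtx_naturality (((lastDir m).obj ((pbar (m + 1)).obj A)).map f) (cls x)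

/-! ### Inheritance of truncations and of homotopical discreteness by clopen families -/

namespace IsClopen

variable {ι : Type} {W A : MCat.{u} (m + 1)} {q : ι → (W ⟶ A)}

/-- Closure under connected components replaces equality by isomorphism in the lifting condition, as
needed for lifting isomorphism classes. -/
theorem exists_of_iso {D : Type} [SmallCategory D] {W A : D ⥤ Cat.{u, u}} {q : ι → (W ⟶ A)}
    (h : IsClopen q) {k l : D} (f : k ⟶ l) (x : ι → A.obj k) (w : W.obj l)
    (e : ∀ i, Nonempty (((q i).app l).toFunctor.obj w ≅ (A.map f).toFunctor.obj (x i))) :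
    ∃ v : W.obj k, ∀ i, ((q i).app k).toFunctor.obj v = x i := by
  obtain ⟨w', hw'⟩ := (h.emb l).exists_target w _ (fun i => ⟨(e i).some.hom⟩)
  exact h.exists_lift f x w' hw'

theorem classes (h : IsClopen q) (k : MIdx m) : IsClopenSSet (fun i => classesMap (q i) k) := by
  constructor
  · intro t z z' e
    obtain ⟨x, rfl⟩ := cls_surjective z
    obtain ⟨x', rfl⟩ := cls_surjective z'
    exact cls_eq_iff.2 ((h.emb _).nonempty_iso fun i => cls_eq_iff.1 (e i))
  · intro s t f x z e
    obtain ⟨w, rfl⟩ := cls_surjective z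
    choose y hy using fun i => cls_surjective (x i)
    obtain rfl : (fun i => cls (y i)) = x := funext hy
    obtain ⟨v, hv⟩ := h.exists_of_iso (lastMap k f) y w (fun i => cls_eq_iff.1 (e i))
    exact ⟨cls v, fun i => congrArg cls (hv i)⟩

theorem hasTrunc (h : IsClopen q) (hA : HasTrunc A) : HasTrunc W :=
  (isMultinerve_iff _).2 fun k => (h.classes k).isNerve (hA.isNerve k)

/-- Levelwise this is `IsClopenSSet.isClopenEmb` for the simplicial sets of classes. For the lifting
condition, objects of the truncation are isomorphism classes of objects in degree `0` of the last
direction, which reduces it to lifting up to isomorphism in `W`. -/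
theorem trunc (h : IsClopen q) (hA : HasTrunc A) : IsClopen (fun i => (trunc m).map (q i)) := by
  refine ⟨fun k => (h.classes k).isClopenEmb (hA.isNerve k), fun {k l} f x w e => ?_⟩
  choose y hy using fun i => hA.exists_vtxCls (x i)
  obtain ⟨z, rfl⟩ := (h.hasTrunc hA).exists_vtxCls w
  obtain ⟨v, hv⟩ := h.exists_of_iso (restMap (smp 0) f) y z (fun i => by
    rw [← hA.vtxCls_eq_iff, ← vtxCls_map, ← trunc_map_vtxCls, hy, e])
  exact ⟨vtxCls v, fun i => by rw [vtxCls_map, hv, hy]⟩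

theorem isHD {ι : Type} : ∀ {m : ℕ} {W A : MCat.{u} m} {q : ι → (W ⟶ A)} (_ : IsClopen q)
    (_ : IsHD m A), IsHD m W
  | 0, _, _, _, h, hA => fun k => (h.emb k).isEqRel (hA k)
  | _ + 1, _, _, _, h, ⟨h1, h2, h3, h4⟩ =>
    ⟨fun s => (h.slice s).isHD (h1 s), h.isSegal h2, h.hasTrunc h3, (h.trunc h3).isHD h4⟩

end IsClopen

theorem IsHD.of_iso {m : ℕ} {X Y : MCat.{u} m} (e : X ≅ Y) (h : IsHD m Y) : IsHD m X :=
  (isClopen_of_isIso e.hom).isHD h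

/-- A weakening of weak globularity: every `X_s` has this property, `X_0` is homotopically discrete
and the truncation is a multinerve. -/
def IsPreWG : ∀ m : ℕ, MCat.{u} m → Prop
  | 0, _ => True
  | m + 1, X => (∀ s, IsPreWG m (((slices m).obj X).obj s)) ∧ IsHD m (slice X 0) ∧ HasTrunc X

theorem IsClopen.isPreWG {ι : Type} : ∀ {m : ℕ} {W A : MCat.{u} m} {q : ι → (W ⟶ A)}
    (_ : IsClopen q) (_ : IsPreWG m A), IsPreWG m W
  | 0, _, _, _, _, _ => trivial
  | _ + 1, _, _, _, h, ⟨h1, h2, h3⟩ =>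
    ⟨fun s => (h.slice s).isPreWG (h1 s), (h.slice _).isHD h2, h.hasTrunc h3⟩

/-- `IsHD` and `IsPreWG` quantify over the objects of $\Delta^{op}$, `IsWG` over natural numbers;
this passes from the second form to the first. -/
theorem slices_smp {m : ℕ} {X : MCat.{u} (m + 1)} {P : MCat.{u} m → Prop}
    (h : ∀ s, P (slice X s)) (s : SimplexCategoryᵒᵖ) : P (((slices m).obj X).obj s) := by
  induction s using Opposite.rec with
  | _ s => induction s using SimplexCategory.rec with
    | _ s => exact h s

theorem IsWG.isPreWG : ∀ {m : ℕ} {X : MCat.{u} m} (_ : IsWG m X), IsPreWG m X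
  | 0, _, _ => trivial
  | _ + 1, _, h => ⟨slices_smp fun s => (h.1 s).isPreWG, h.2.1.1, h.2.2.2.1⟩

end

section

/-! ### Slices of truncations -/

variable {m : ℕ}

theorem ins_zero_eval_zero : ins (0 : Fin (m + 1)) ⋙ Pi.eval _ 0 = CategoryTheory.Prod.fst _ _ :=
  (ins_eval 0 0).trans (Fin.insertNth_apply_same _ _ _)

theorem ins_zero_eval_succ (j : Fin m) :
    ins (0 : Fin (m + 1)) ⋙ Pi.eval _ j.succ = CategoryTheory.Prod.snd _ _ ⋙ Pi.eval _ j := by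
  rw [← Fin.succAbove_zero_apply]
  exact (ins_eval _ _).trans (Fin.insertNth_apply_succAbove _ _ _ _)

theorem ins_last_eval_last :
    ins (Fin.last m) ⋙ Pi.eval _ (Fin.last m) = CategoryTheory.Prod.fst _ _ :=
  (ins_eval _ _).trans (Fin.insertNth_apply_same _ _ _)

theorem ins_last_eval_castSucc (j : Fin m) :
    ins (Fin.last m) ⋙ Pi.eval _ j.castSucc = CategoryTheory.Prod.snd _ _ ⋙ Pi.eval _ j := by
  rw [← Fin.succAbove_last_apply]
  exact (ins_eval _ _).trans (Fin.insertNth_apply_succAbove _ _ _ _)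

/-- Insert first in the last and then in the first direction. -/
abbrev insLastFirst (m : ℕ) : SimplexCategoryᵒᵖ × (SimplexCategoryᵒᵖ × MIdx m) ⥤ MIdx (m + 2) :=
  Functor.prod (𝟭 _) (ins (Fin.last m)) ⋙ ins 0

/-- Insert first in the first and then in the last direction. -/
abbrev insFirstLast (m : ℕ) : SimplexCategoryᵒᵖ × (SimplexCategoryᵒᵖ × MIdx m) ⥤ MIdx (m + 2) :=
  Functor.prod' (CategoryTheory.Prod.snd _ _ ⋙ CategoryTheory.Prod.fst _ _)
    (Functor.prod (𝟭 _) (CategoryTheory.Prod.snd _ _) ⋙ ins 0) ⋙ ins (Fin.last (m + 1))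

theorem insLastFirst_eq (m : ℕ) : insLastFirst m = insFirstLast m := by
  refine Functor.pi_ext _ _ fun j => ?_
  rw [Functor.assoc, Functor.assoc]
  refine Fin.cases ?_ (fun j => ?_) j
  · have h : ins (Fin.last (m + 1)) ⋙ Pi.eval _ 0 =
        CategoryTheory.Prod.snd _ _ ⋙ Pi.eval _ (0 : Fin (m + 1)) := ins_last_eval_castSucc 0
    rw [ins_zero_eval_zero, h]
    change _ = Functor.prod (𝟭 _) (CategoryTheory.Prod.snd _ _) ⋙ (ins 0 ⋙ Pi.eval _ 0)
    rw [ins_zero_eval_zero]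
    rfl
  · rw [ins_zero_eval_succ]
    refine Fin.lastCases ?_ (fun j => ?_) j
    · rw [Fin.succ_last, ins_last_eval_last]
      change CategoryTheory.Prod.snd _ _ ⋙ (ins (Fin.last m) ⋙ _) = _
      rw [ins_last_eval_last]
      rfl
    · rw [Fin.succ_castSucc, ins_last_eval_castSucc]
      change CategoryTheory.Prod.snd _ _ ⋙ (ins (Fin.last m) ⋙ _) =
        Functor.prod (𝟭 _) (CategoryTheory.Prod.snd _ _) ⋙ (ins 0 ⋙ _)
      rw [ins_last_eval_castSucc, ins_zero_eval_succ]
      rfl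

/-- Insertion in the first direction commutes with insertion in the last direction. -/
def insSwap (m : ℕ) : insLastFirst m ≅ insFirstLast m := eqToIso (insLastFirst_eq m)

/-- This and the next two statements treat operators in the last direction, in the remaining ones
and in the first. The first two make the class comparison `sliceClassesIso` an isomorphism of
diagrams of simplicial sets; the third makes the truncation comparison compatible with the
simplicial structure in the first direction. -/
theorem insSwap_naturality_last (s : SimplexCategoryᵒᵖ) {t t' : SimplexCategoryᵒᵖ} (e : t ⟶ t')
    (k : MIdx m) :
    (ins 0).map (CategoryTheory.Prod.mkHom (𝟙 s) (lastMap k e) :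
      (s, (ins (Fin.last m)).obj (t, k)) ⟶ (s, (ins (Fin.last m)).obj (t', k))) ≫
      (insSwap m).hom.app (s, (t', k)) =
        (insSwap m).hom.app (s, (t, k)) ≫ lastMap ((ins 0).obj (s, k)) e := by
  refine ((insSwap m).hom.naturality (CategoryTheory.Prod.mkHom (𝟙 s)
    (CategoryTheory.Prod.mkHom e (𝟙 k)) : (s, (t, k)) ⟶ (s, (t', k)))).trans ?_
  congr 1
  change (ins (Fin.last (m + 1))).map (CategoryTheory.Prod.mkHom e ((ins 0).map (𝟙 (s, k)))) = _
  rw [CategoryTheory.Functor.map_id]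

theorem insSwap_naturality_rest (s t : SimplexCategoryᵒᵖ) {k k' : MIdx m} (f : k ⟶ k') :
    (ins 0).map (CategoryTheory.Prod.mkHom (𝟙 s) (restMap t f) :
      (s, (ins (Fin.last m)).obj (t, k)) ⟶ (s, (ins (Fin.last m)).obj (t, k'))) ≫
      (insSwap m).hom.app (s, (t, k')) =
        (insSwap m).hom.app (s, (t, k)) ≫
          restMap t ((ins 0).map (CategoryTheory.Prod.mkHom (𝟙 s) f : (s, k) ⟶ (s, k'))) :=
  (insSwap m).hom.naturality (CategoryTheory.Prod.mkHom (𝟙 s)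
    (CategoryTheory.Prod.mkHom (𝟙 t) f) : (s, (t, k)) ⟶ (s, (t, k')))

theorem insSwap_naturality_first {s s' : SimplexCategoryᵒᵖ} (e : s ⟶ s') (t : SimplexCategoryᵒᵖ)
    (k : MIdx m) :
    (ins 0).map (CategoryTheory.Prod.mkHom e (𝟙 _) :
      (s, (ins (Fin.last m)).obj (t, k)) ⟶ (s', (ins (Fin.last m)).obj (t, k))) ≫
      (insSwap m).hom.app (s', (t, k)) =
        (insSwap m).hom.app (s, (t, k)) ≫
          restMap t ((ins 0).map (CategoryTheory.Prod.mkHom e (𝟙 k) : (s, k) ⟶ (s', k))) := by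
  refine Eq.trans ?_ ((insSwap m).hom.naturality (CategoryTheory.Prod.mkHom e (𝟙 (t, k)) :
    (s, (t, k)) ⟶ (s', (t, k))))
  congr 1
  change _ = (ins 0).map (CategoryTheory.Prod.mkHom e ((ins (Fin.last m)).map (𝟙 (t, k))))
  rw [CategoryTheory.Functor.map_id]

/-- The isomorphism classes of objects of a slice. -/
def sliceClassesIso (X : MCat.{u} (m + 2)) (s : SimplexCategoryᵒᵖ) :
    (lastDir m).obj ((pbar (m + 1)).obj (((slices (m + 1)).obj X).obj s)) ≅
      Prod.sectR s (MIdx m) ⋙ ins 0 ⋙ (lastDir (m + 1)).obj ((pbar (m + 2)).obj X) :=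
  NatIso.ofComponents
    (fun k => NatIso.ofComponents
      (fun t => ((pbar (m + 2)).obj X).mapIso ((insSwap m).app (s, (t, k))))
      (fun {t t'} e => by
        have := congrArg (fun f => ((pbar (m + 2)).obj X).map f) (insSwap_naturality_last s e k)
        simp only [Functor.map_comp] at this
        exact this))
    (fun {k k'} f => by
      refine NatTrans.ext (funext fun t => ?_)
      have := congrArg (fun f => ((pbar (m + 2)).obj X).map f) (insSwap_naturality_rest s t f)
      simp only [Functor.map_comp] at this
      exact this)

/-- Truncation commutes with slices. -/
def sliceTruncIso (X : MCat.{u} (m + 2)) (s : SimplexCategoryᵒᵖ) :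
    (trunc m).obj (((slices (m + 1)).obj X).obj s) ≅
      ((slices m).obj ((trunc (m + 1)).obj X)).obj s :=
  Functor.isoWhiskerRight (sliceClassesIso X s) SSet.hoFunctor

theorem sliceTruncIso_naturality (X : MCat.{u} (m + 2)) {s s' : SimplexCategoryᵒᵖ} (e : s ⟶ s') :
    (trunc m).map (((slices (m + 1)).obj X).map e) ≫ (sliceTruncIso X s').hom =
      (sliceTruncIso X s).hom ≫ ((slices m).obj ((trunc (m + 1)).obj X)).map e := by
  ext k : 2
  change SSet.hoFunctor.map (classesMap (((slices (m + 1)).obj X).map e) k) ≫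
      SSet.hoFunctor.map ((sliceClassesIso X s').hom.app k) =
    SSet.hoFunctor.map ((sliceClassesIso X s).hom.app k) ≫
      SSet.hoFunctor.map (((lastDir (m + 1)).obj ((pbar (m + 2)).obj X)).map
        ((ins 0).map (CategoryTheory.Prod.mkHom e (𝟙 k) : (s, k) ⟶ (s', k))))
  refine (Functor.map_comp _ _ _).symm.trans (Eq.trans (congrArg _ ?_) (Functor.map_comp _ _ _))
  refine NatTrans.ext (funext fun t => ?_)
  have := congrArg (fun f => ((pbar (m + 2)).obj X).map f) (insSwap_naturality_first e t k)
  simp only [Functor.map_comp] at this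
  exact this

theorem sliceTruncIso_map {X Y : MCat.{u} (m + 2)} (f : X ⟶ Y) (s : SimplexCategoryᵒᵖ) :
    (trunc m).map (((slices (m + 1)).map f).app s) ≫ (sliceTruncIso Y s).hom =
      (sliceTruncIso X s).hom ≫ ((slices m).map ((trunc (m + 1)).map f)).app s := by
  ext k : 2
  change SSet.hoFunctor.map (classesMap (((slices (m + 1)).map f).app s) k) ≫
      SSet.hoFunctor.map ((sliceClassesIso Y s).hom.app k) =
    SSet.hoFunctor.map ((sliceClassesIso X s).hom.app k) ≫
      SSet.hoFunctor.map (classesMap f ((ins 0).obj (s, k)))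
  refine (Functor.map_comp _ _ _).symm.trans (Eq.trans (congrArg _ ?_) (Functor.map_comp _ _ _))
  refine NatTrans.ext (funext fun t => ?_)
  exact (((pbar (m + 2)).map f).naturality ((insSwap m).hom.app (s, (t, k)))).symm

theorem HasTrunc.slice {X : MCat.{u} (m + 2)} (h : HasTrunc X) (s : SimplexCategoryᵒᵖ) :
    HasTrunc (((slices (m + 1)).obj X).obj s) :=
  (isMultinerve_iff _).2 fun k => IsNerve.of_iso ((sliceClassesIso X s).app k) (h.isNerve _)

end

section

/-! ### Comparison of clopen families -/

section Compare

variable {ι D : Type} [SmallCategory D]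

theorem IsClopen.comp_isIso {W A B : D ⥤ Cat.{u, u}} {q : ι → (W ⟶ A)} (h : IsClopen q)
    (α : A ⟶ B) [IsIso α] : IsClopen (fun i => q i ≫ α) := by
  have hα := (isIso_diagram_iff α).1 inferInstance
  refine ⟨fun k => ⟨fun x y e => ?_, fun x y => ?_, fun x y f => ?_, fun x y f => ?_⟩,
    fun {k l} f x w e => ?_⟩
  · exact (h.emb k).obj_injective x y fun i => (hα k).1.1 (e i)
  · refine Function.Bijective.comp (g := fun (f : ∀ i, ((q i).app k).toFunctor.obj x ⟶
      ((q i).app k).toFunctor.obj y) i => (α.app k).toFunctor.map (f i)) ?_ ((h.emb k).map_bijective x y)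
    exact Function.Bijective.piMap fun i => (hα k).2 _ _
  · choose y' hy using fun i => (hα k).1.2 (y i)
    obtain rfl : _ = y := funext hy
    obtain ⟨z, hz⟩ := (h.emb k).exists_target x y' (fun i => by
      obtain ⟨g⟩ := f i
      exact ⟨(((hα k).2 _ _).2 g).choose⟩)
    exact ⟨z, fun i => congrArg _ (hz i)⟩
  · choose y' hy using fun i => (hα k).1.2 (y i)
    obtain rfl : _ = y := funext hy
    obtain ⟨z, hz⟩ := (h.emb k).exists_source x y' (fun i => by
      obtain ⟨g⟩ := f i
      exact ⟨(((hα k).2 _ _).2 g).choose⟩)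
    exact ⟨z, fun i => congrArg _ (hz i)⟩
  · choose y' hy using fun i => (hα k).1.2 (x i)
    obtain rfl : _ = x := funext hy
    obtain ⟨z, hz⟩ := h.exists_lift f y' w (fun i => (hα l).1.1 ((e i).trans
      (natTrans_obj α f (y' i)).symm))
    exact ⟨z, fun i => congrArg _ (hz i)⟩

/-- The arrows of a clopen family are all families of arrows between the components of its objects,
so two clopen families in `A` agree as soon as they contain the same families of objects. The
comparisons of hom-objects and fibre products below all have this form. -/
theorem IsClopen.isIso {W W' A : D ⥤ Cat.{u, u}} {q : ι → (W ⟶ A)} {q' : ι → (W' ⟶ A)}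
    (h : IsClopen q) (h' : IsClopen q') (w : W ⟶ W') (hw : ∀ i, w ≫ q' i = q i)
    (hs : ∀ k (y : W'.obj k), ∃ x : W.obj k, ∀ i,
      ((q i).app k).toFunctor.obj x = ((q' i).app k).toFunctor.obj y) : IsIso w := by
  obtain rfl : (fun i => w ≫ q' i) = q := funext hw
  refine (isIso_diagram_iff w).2 fun k => ⟨⟨fun x y e => ?_, fun y => ?_⟩, fun x y => ?_⟩
  · exact (h.emb k).obj_injective x y fun i => congrArg ((q' i).app k).toFunctor.obj e
  · obtain ⟨x, hx⟩ := hs k y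
    exact ⟨x, (h'.emb k).obj_injective _ _ hx⟩
  · exact (Function.Bijective.of_comp_iff' ((h'.emb k).map_bijective _ _) _).1
      ((h.emb k).map_bijective x y)

end Compare

/-! ### Fibres and iterated fibre products over sets -/

section Fiber

variable {D : Type} [SmallCategory D] {A W : D ⥤ Cat.{u, u}} {S : Type u}
  {φ ψ : A ⟶ (CategoryTheory.Functor.const _).obj (Cat.of (Discrete S))} {a b : S}

/-- The inclusion of a fibre. -/
def fiberι (φ ψ : A ⟶ (CategoryTheory.Functor.const _).obj (Cat.of (Discrete S))) (a b : S) :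
    fiber φ ψ a b ⟶ A where
  app d := (fiberProp φ ψ a b d).ι.toCatHom
  naturality _ _ _ := rfl

/-- A map to `A` which lands in a fibre. -/
def fiberLift (g : W ⟶ A)
    (hg : ∀ d x, fiberProp φ ψ a b d ((g.app d).toFunctor.obj x)) : W ⟶ fiber φ ψ a b where
  app d := ((fiberProp φ ψ a b d).lift (g.app d).toFunctor (hg d)).toCatHom
  naturality _ _ f := Cat.ext (fullSub_functor_ext (congrArg Cat.Hom.toFunctor (g.naturality f)))

theorem fiber_hom_ext {g h : W ⟶ fiber φ ψ a b} (e : g ≫ fiberι φ ψ a b = h ≫ fiberι φ ψ a b) :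
    g = h :=
  NatTrans.ext (funext fun d => Cat.ext (fullSub_functor_ext
    (congrArg (fun η : W ⟶ A => (η.app d).toFunctor) e)))

theorem fiberProp_hom {d : D} {x y : A.obj d} (f : x ⟶ y) :
    fiberProp φ ψ a b d x ↔ fiberProp φ ψ a b d y := by
  have h (χ : A ⟶ (CategoryTheory.Functor.const _).obj (Cat.of (Discrete S))) :
    (χ.app d).toFunctor.obj x = (χ.app d).toFunctor.obj y :=
    obj_ext_of_isDiscrete (C := Discrete S) ((χ.app d).toFunctor.map f)
  unfold fiberProp
  rw [h φ, h ψ]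

theorem const_obj_map (χ : A ⟶ (CategoryTheory.Functor.const _).obj (Cat.of (Discrete S))) {d e : D}
    (f : d ⟶ e) (x : A.obj d) :
    (χ.app e).toFunctor.obj ((A.map f).toFunctor.obj x) = (χ.app d).toFunctor.obj x :=
  congrArg (fun F : A.obj d ⟶ Cat.of (Discrete S) => F.toFunctor.obj x) (χ.naturality f)

/-- A functor to a discrete category is constant along arrows, and in a constant diagram the value
is unchanged by the structure maps. Membership in the fibre is therefore a property of components,
and can be tested after any structure map. -/
theorem isClopen_fiberι : IsClopen (fun _ : Unit => fiberι φ ψ a b) := by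
  refine ⟨fun k => ⟨fun x y e => ObjectProperty.FullSubcategory.ext (e ()),
    fun x y => ⟨fun f g e => (fiberProp φ ψ a b k).ι.map_injective (congrFun e ()),
      fun f => ⟨(fiberProp φ ψ a b k).fullyFaithfulι.preimage (f ()), rfl⟩⟩,
    fun x y f => ⟨⟨y (), (fiberProp_hom (f ()).some).1 x.property⟩, fun _ => rfl⟩,
    fun x y f => ⟨⟨y (), (fiberProp_hom (f ()).some).2 x.property⟩, fun _ => rfl⟩⟩, ?_⟩
  intro k l f x w e
  refine ⟨⟨x (), ?_⟩, fun _ => rfl⟩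
  have := w.property
  have e' : w.obj = (A.map f).toFunctor.obj (x ()) := e ()
  rw [e'] at this
  exact ⟨(const_obj_map φ f _).symm.trans this.1, (const_obj_map ψ f _).symm.trans this.2⟩

end Fiber

section Chains

variable {D : Type} [SmallCategory D] {C Z W : D ⥤ Cat.{u, u}}

/-- The projections from the iterated fibre product. -/
def chainsProj (s t : C ⟶ Z) {k : ℕ} (i : Fin k) : chains s t k ⟶ C where
  app _ := (Chain.proj _ _ i).toCatHom
  naturality _ _ _ := rfl

theorem chains_hom_ext {s t : C ⟶ Z} {k : ℕ} {g h : W ⟶ chains s t k}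
    (e : ∀ i, g ≫ chainsProj s t i = h ≫ chainsProj s t i) : g = h :=
  NatTrans.ext (funext fun d => Cat.ext (Chain.functor_ext fun i =>
    congrArg (fun η : W ⟶ C => (η.app d).toFunctor) (e i)))

variable {S : Type u} (s t : C ⟶ (CategoryTheory.Functor.const _).obj (Cat.of (Discrete S)))

/-- Over a set the matching condition concerns objects only and is constant along arrows and
structure maps; every family of arrows between two chains is automatically matched. -/
theorem isClopen_chainsProj (k : ℕ) : IsClopen (fun i : Fin k => chainsProj s t i) := by
  have inv : ∀ (χ : C ⟶ (CategoryTheory.Functor.const _).obj (Cat.of (Discrete S))) {d : D}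
      {x y : C.obj d} (_ : x ⟶ y), (χ.app d).toFunctor.obj x = (χ.app d).toFunctor.obj y := by
    intro χ d x y f
    exact obj_ext_of_isDiscrete (C := Discrete S) ((χ.app d).toFunctor.map f)
  refine ⟨fun d => ⟨fun x y e => Chain.ext (funext e),
    fun x y => ⟨fun f g e => Chain.Hom.ext e, fun f => ⟨⟨f, fun i j h => ?_⟩, rfl⟩⟩,
    fun x y f => ⟨⟨y, fun i j h => ?_⟩, fun _ => rfl⟩,
    fun x y f => ⟨⟨y, fun i j h => ?_⟩, fun _ => rfl⟩⟩, fun {k l} f x w e => ?_⟩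
  · exact (IsDiscrete.subsingleton (C := Discrete S) _ _).elim _ _
  · rw [← inv t (f i).some, ← inv s (f j).some]
    exact x.link i j h
  · rw [inv t (f i).some, inv s (f j).some]
    exact x.link i j h
  · refine ⟨⟨x, fun i j h => ?_⟩, fun _ => rfl⟩
    have := w.link i j h
    have e' : ∀ i, w.obj i = (C.map f).toFunctor.obj (x i) := e
    rw [e', e'] at this
    exact (const_obj_map t f _).symm.trans (this.trans (const_obj_map s f _))

end Chains

/-! ### Invariance of equivalences under isomorphism -/

theorem isEquivalence_of_isIso {C D : Cat.{u, u}} (F : C ⟶ D) [IsIso F] :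
    F.toFunctor.IsEquivalence := by
  obtain ⟨h1, h2⟩ := (isIso_cat_iff F).1 inferInstance
  have ff := ((Functor.FullyFaithful.nonempty_iff_map_bijective F.toFunctor).2 h2).some
  have := ff.full
  have := ff.faithful
  have : F.toFunctor.EssSurj := ⟨fun y => by
    obtain ⟨x, rfl⟩ := h1.2 y
    exact ⟨x, ⟨Iso.refl _⟩⟩⟩
  exact {}

/-! ### Hom-objects under isomorphism -/

variable {m : ℕ}

theorem homFib_mem_iff {X : MCat.{u} (m + 1)} (hX : IsHD m (slice X 0)) {a b : Disc0 X} {k : MIdx m}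
    {x : (slice X 1).obj k} :
    fiberProp (((slices m).obj X).map src ≫ gamma _ hX) (((slices m).obj X).map tgt ≫ gamma _ hX)
      a b k x ↔
    gammaObj m (slice X 0) k (((((slices m).obj X).map src).app k).toFunctor.obj x) = a ∧
    gammaObj m (slice X 0) k (((((slices m).obj X).map tgt).app k).toFunctor.obj x) = b :=
  ⟨fun h => ⟨congrArg Discrete.as h.1, congrArg Discrete.as h.2⟩,
    fun h => ⟨congrArg Discrete.mk h.1, congrArg Discrete.mk h.2⟩⟩

/-- The inclusion of `X(a, b)` in `X_1`. -/
abbrev homFibι (X : MCat.{u} (m + 1)) (hX : IsHD m (slice X 0)) (a b : Disc0 X) :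
    HomFib X hX a b ⟶ slice X 1 := fiberι _ _ a b

theorem homFibMap_ι {X Y : MCat.{u} (m + 1)} (f : X ⟶ Y) (hX : IsHD m (slice X 0))
    (hY : IsHD m (slice Y 0)) (a b : Disc0 X) :
    HomFib.map f hX hY a b ≫ homFibι Y hY _ _ = homFibι X hX a b ≫ sliceMap f 1 := rfl

theorem gammaObj_sliceMap {X Y : MCat.{u} (m + 1)} (f : X ⟶ Y) (e : smp 1 ⟶ smp 0) {k : MIdx m}
    (x : (slice X 1).obj k) :
    gammaObj m (slice Y 0) k (((((slices m).obj Y).map e).app k).toFunctor.obj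
      (((sliceMap f 1).app k).toFunctor.obj x)) =
    (Disc m).map (sliceMap f 0)
      (gammaObj m (slice X 0) k (((((slices m).obj X).map e).app k).toFunctor.obj x)) := by
  rw [← gammaObj_naturality]
  exact congrArg (fun η : slice X 1 ⟶ slice Y 0 => gammaObj m (slice Y 0) k ((η.app k).toFunctor.obj x))
    (((slices m).map f).naturality e).symm

theorem disc_map_injective {X Y : MCat.{u} m} (α : X ⟶ Y) [IsIso α] :
    Function.Injective ((Disc m).map α) :=
  ((isIso_iff_bijective _).1 inferInstance).1

/-- The end points of the target are arbitrary elements with equations, since in the applications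
the same point is reached by two different composites. -/
theorem exists_homFib_iso {X Y : MCat.{u} (m + 1)} (α : X ⟶ Y) [IsIso α] (hX : IsHD m (slice X 0))
    (hY : IsHD m (slice Y 0)) {a b : Disc0 X} {a' b' : Disc0 Y}
    (ha : (Disc m).map (sliceMap α 0) a = a') (hb : (Disc m).map (sliceMap α 0) b = b') :
    ∃ w : HomFib X hX a b ⟶ HomFib Y hY a' b', IsIso w ∧
      w ≫ homFibι Y hY a' b' = homFibι X hX a b ≫ sliceMap α 1 := by
  subst ha hb
  refine ⟨HomFib.map α hX hY a b, ?_, rfl⟩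
  refine (isClopen_fiberι.comp_isIso (sliceMap α 1)).isIso
    (q' := fun _ => homFibι Y hY _ _) isClopen_fiberι _ (fun _ => rfl) (fun k y => ?_)
  obtain ⟨x, hx⟩ := ((isIso_diagram_iff (sliceMap α 1)).1 inferInstance k).1.2 y.obj
  refine ⟨⟨x, (homFib_mem_iff hX).2 ?_⟩, fun _ => hx⟩
  have := (homFib_mem_iff hY).1 y.property
  rw [← hx, gammaObj_sliceMap, gammaObj_sliceMap] at this
  exact ⟨disc_map_injective _ this.1, disc_map_injective _ this.2⟩

/-- Isomorphisms of arrows restrict to hom-objects and pass to truncations, which gives the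
induction; for categories it is cancellation of equivalences. -/
theorem IsNEquiv.of_arrow : ∀ {m : ℕ} {X Y X' Y' : MCat.{u} m} {f : X ⟶ Y} {f' : X' ⟶ Y'}
    (α : X ⟶ X') (β : Y ⟶ Y') [IsIso α] [IsIso β] (_ : f ≫ β = α ≫ f') (_ : IsNEquiv m f),
    IsNEquiv m f'
  | 0, X, Y, X', Y', f, f', α, β, _, _, e, h => fun k => by
    have e' : (f.app k).toFunctor ⋙ (β.app k).toFunctor = (α.app k).toFunctor ⋙ (f'.app k).toFunctor :=
      congrArg (fun η : X ⟶ Y' => (η.app k).toFunctor) e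
    have := isEquivalence_of_isIso (α.app k)
    have := isEquivalence_of_isIso (β.app k)
    have := h k
    have : ((α.app k).toFunctor ⋙ (f'.app k).toFunctor).IsEquivalence := by
      rw [← e']; infer_instance
    exact Functor.isEquivalence_of_comp_left (α.app k).toFunctor _
  | m + 1, X, Y, X', Y', f, f', α, β, _, _, e, ⟨hX, hY, h1, h2⟩ => by
    have hX' : IsHD m (slice X' 0) := IsHD.of_iso (asIso (sliceMap α 0)).symm hX
    have hY' : IsHD m (slice Y' 0) := IsHD.of_iso (asIso (sliceMap β 0)).symm hY
    have e0 : sliceMap f 0 ≫ sliceMap β 0 = sliceMap α 0 ≫ sliceMap f' 0 :=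
      congrArg (fun η => sliceMap η 0) e
    have e1 : sliceMap f 1 ≫ sliceMap β 1 = sliceMap α 1 ≫ sliceMap f' 1 :=
      congrArg (fun η => sliceMap η 1) e
    refine ⟨hX', hY', fun a b => ?_, IsNEquiv.of_arrow ((trunc m).map α) ((trunc m).map β)
      (by rw [← Functor.map_comp, e, Functor.map_comp]) h2⟩
    -- The discretization of an isomorphism is a bijection, so the end points in `X'` come from `X`.
    obtain ⟨a, rfl⟩ := ((isIso_iff_bijective ((Disc m).map (sliceMap α 0))).1 inferInstance).2 a
    obtain ⟨b, rfl⟩ := ((isIso_iff_bijective ((Disc m).map (sliceMap α 0))).1 inferInstance).2 b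
    have hd : ∀ a : Disc0 X, (Disc m).map (sliceMap β 0) ((Disc m).map (sliceMap f 0) a) =
        (Disc m).map (sliceMap f' 0) ((Disc m).map (sliceMap α 0) a) := fun a => by
      rw [← Functor.map_comp_apply, e0, Functor.map_comp_apply]
    obtain ⟨w, _, hw⟩ := exists_homFib_iso α hX hX' (a := a) (b := b) rfl rfl
    obtain ⟨v, _, hv⟩ := exists_homFib_iso β hY hY' (hd a) (hd b)
    refine IsNEquiv.of_arrow w v (fiber_hom_ext ?_) (h1 a b)
    change HomFib.map f hX hY a b ≫ (v ≫ homFibι Y' hY' _ _) =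
      w ≫ (HomFib.map f' hX' hY' _ _ ≫ homFibι Y' hY' _ _)
    rw [hv, homFibMap_ι, ← Category.assoc w, hw, ← Category.assoc, homFibMap_ι, Category.assoc,
      Category.assoc, e1]

end

section

variable {m : ℕ}

/-! ### Discretization and truncation -/

theorem split_obj_ins (i : Fin (m + 1)) (p : SimplexCategoryᵒᵖ × MIdx m) :
    (split i).obj ((ins i).obj p) = p := by
  refine Prod.ext ?_ (funext fun j => ?_)
  · exact Functor.congr_obj ((ins_eval i i).trans (Fin.insertNth_apply_same _ _ _)) p
  · exact Functor.congr_obj ((ins_eval i _).trans (Fin.insertNth_apply_succAbove _ _ _ j)) p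

/-- Splitting an inserted multi-index gives back the pair only up to a propositional equality. With
`p` as a free variable that equality can be substituted away. -/
theorem gammaObj_vertex (S : MSet.{u} (m + 1)) (k : MIdx (m + 1)) (p : SimplexCategoryᵒᵖ × MIdx m)
    (hp : (split (Fin.last m)).obj k = p) (e : k = (ins (Fin.last m)).obj p) (z : S.obj k) :
    gammaObj m ((toCat m).obj S) ((split (Fin.last m)).obj k).2 (vertex S k z) =
      gammaObj m ((toCat m).obj S) p.2
        (vtx (((lastDir m).obj S).obj p.2) (t := p.1) (S.map (eqToHom e) z)) := by
  subst hp
  rfl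

theorem gammaObj_succ (Z : MCat.{u} (m + 1)) {k : MIdx m} {t : SimplexCategoryᵒᵖ}
    (x : Z.obj ((ins (Fin.last m)).obj (t, k))) :
    gammaObj (m + 1) Z _ x = gammaObj m ((trunc m).obj Z) k (vtxCls x) := by
  refine (gammaObj_vertex ((pbar (m + 1)).obj Z) _ (t, k) (split_obj_ins _ _) rfl _).trans ?_
  refine congrArg (fun z => gammaObj m ((trunc m).obj Z) k (vtx (classes Z k) z)) ?_
  change ((pbar (m + 1)).obj Z).map (𝟙 _) (cls x) = cls x
  rw [CategoryTheory.Functor.map_id]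
  rfl

/-- With no directions every morphism of multi-indices is invertible, so the reference object used
by `Disc` may be exchanged for any `k`. -/
theorem isIso_map_zero (X : MCat.{u} 0) {k l : MIdx 0} (f : k ⟶ l) : IsIso (X.map f) := by
  have : IsIso f := ⟨fun i => i.elim0, funext fun i => i.elim0, funext fun i => i.elim0⟩
  infer_instance

theorem gammaObj_zero_iff {X : MCat.{u} 0} {k : MIdx 0} {x y : X.obj k} :
    gammaObj 0 X k x = gammaObj 0 X k y ↔ Nonempty (x ≅ y) := by
  refine ⟨fun h => ?_, fun ⟨e⟩ => gammaObj_iso X e⟩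
  obtain ⟨f⟩ := Quotient.exact (s := isIsomorphicSetoid _) h
  have h' := (isIso_cat_iff (X.map (fun i => i.elim0 : k ⟶ fun i => i.elim0))).1 (isIso_map_zero X _)
  exact ⟨((Functor.FullyFaithful.nonempty_iff_map_bijective _).2 h'.2).some.preimageIso f⟩

theorem gammaObj_zero_surjective (X : MCat.{u} 0) (k : MIdx 0) (a : (Disc 0).obj X) :
    ∃ x, gammaObj 0 X k x = a := by
  have h' := (isIso_cat_iff (X.map (fun i => i.elim0 : k ⟶ fun i => i.elim0))).1 (isIso_map_zero X _)
  obtain ⟨y, rfl⟩ := Quotient.exists_rep (s := isIsomorphicSetoid _) a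
  obtain ⟨x, rfl⟩ := h'.1.2 y
  exact ⟨x, rfl⟩

/-- The map `X_0^d → (p X)_0^d`. -/
abbrev disc0Trunc (X : MCat.{u} (m + 2)) : Disc0 X → Disc0 ((trunc (m + 1)).obj X) :=
  (Disc m).map (sliceTruncIso X (smp 0)).hom

theorem disc0Trunc_injective (X : MCat.{u} (m + 2)) : Function.Injective (disc0Trunc X) :=
  disc_map_injective _

/-- The discretization of $X_0$ is by definition that of its truncation $p(X_0)\cong(pX)_0$. So the
class of an end of `x` in $X_0^d$ corresponds to the class of that end of the truncation of `x`. -/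
theorem gammaObj_sliceTruncIso (X : MCat.{u} (m + 2)) (e : smp 1 ⟶ smp 0) {k : MIdx m}
    {t : SimplexCategoryᵒᵖ} (x : (slice X 1).obj ((ins (Fin.last m)).obj (t, k))) :
    gammaObj m (slice ((trunc (m + 1)).obj X) 0) k
      (((((slices m).obj ((trunc (m + 1)).obj X)).map e).app k).toFunctor.obj
        (((sliceTruncIso X (smp 1)).hom.app k).toFunctor.obj (vtxCls x))) =
    disc0Trunc X (gammaObj (m + 1) (slice X 0) _
      (((((slices (m + 1)).obj X).map e).app _).toFunctor.obj x)) := by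
  rw [gammaObj_succ, ← vtxCls_map]
  refine Eq.trans ?_ (gammaObj_naturality (sliceTruncIso X (smp 0)).hom _)
  exact congrArg (fun η : (trunc m).obj (slice X 1) ⟶ slice ((trunc (m + 1)).obj X) 0 =>
    gammaObj m _ k ((η.app k).toFunctor.obj (vtxCls x))) (sliceTruncIso_naturality X e).symm

/-- Both sides are clopen in $(pX)_1$: one as the truncation of a fibre, the other as a fibre. They
have the same objects because the end classes agree by `gammaObj_sliceTruncIso` and `disc0Trunc` is
injective. -/
theorem exists_trunc_homFib_iso {X : MCat.{u} (m + 2)} (h1 : HasTrunc (slice X 1))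
    (hX : IsHD (m + 1) (slice X 0)) (hX' : IsHD m (slice ((trunc (m + 1)).obj X) 0))
    {a b : Disc0 X} {a' b' : Disc0 ((trunc (m + 1)).obj X)}
    (ha : disc0Trunc X a = a') (hb : disc0Trunc X b = b') :
    ∃ w : (trunc m).obj (HomFib X hX a b) ⟶ HomFib ((trunc (m + 1)).obj X) hX' a' b', IsIso w ∧
      w ≫ homFibι _ hX' a' b' =
        (trunc m).map (homFibι X hX a b) ≫ (sliceTruncIso X (smp 1)).hom := by
  subst ha hb
  have hc : IsClopen (fun _ : Unit => homFibι X hX a b) := isClopen_fiberι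
  refine ⟨fiberLift ((trunc m).map (homFibι X hX a b) ≫ (sliceTruncIso X (smp 1)).hom)
    (fun k v => (homFib_mem_iff hX').2 ?_), ?_, rfl⟩
  · obtain ⟨z, rfl⟩ := (hc.hasTrunc h1).exists_vtxCls v
    have hz := (homFib_mem_iff hX).1 z.property
    have key : ∀ e : smp 1 ⟶ smp 0, gammaObj m (slice ((trunc (m + 1)).obj X) 0) k
        (((((slices m).obj ((trunc (m + 1)).obj X)).map e).app k).toFunctor.obj
          (((sliceTruncIso X (smp 1)).hom.app k).toFunctor.obj
            ((((trunc m).map (homFibι X hX a b)).app k).toFunctor.obj (vtxCls z)))) =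
        disc0Trunc X (gammaObj (m + 1) (slice X 0) _
          (((((slices (m + 1)).obj X).map e).app _).toFunctor.obj z.obj)) := fun e => by
      rw [vtxCls_map]
      exact gammaObj_sliceTruncIso X e z.obj
    exact ⟨(key src).trans (congrArg _ hz.1), (key tgt).trans (congrArg _ hz.2)⟩
  · refine ((hc.trunc h1).comp_isIso (sliceTruncIso X (smp 1)).hom).isIso
      (q' := fun _ => homFibι _ hX' _ _) isClopen_fiberι _ (fun _ => rfl) (fun k y => ?_)
    obtain ⟨v, hv⟩ := ((isIso_diagram_iff (sliceTruncIso X (smp 1)).hom).1 inferInstance k).1.2 y.obj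
    obtain ⟨x, rfl⟩ := h1.exists_vtxCls v
    have := (homFib_mem_iff hX').1 y.property
    rw [← hv, gammaObj_sliceTruncIso, gammaObj_sliceTruncIso] at this
    refine ⟨vtxCls (⟨x, (homFib_mem_iff hX).2 ⟨disc0Trunc_injective X this.1,
      disc0Trunc_injective X this.2⟩⟩ : (HomFib X hX a b).obj _), fun _ => Eq.trans ?_ hv⟩
    exact congrArg ((sliceTruncIso X (smp 1)).hom.app k).toFunctor.obj (vtxCls_map _ _)

/-! ### A criterion for equivalences -/

/-- All functors `f_k` are fully faithful. -/
def IsFF {D : Type} [SmallCategory D] {X Y : D ⥤ Cat.{u, u}} (f : X ⟶ Y) : Prop :=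
  ∀ k, ∀ x y : X.obj k, Function.Bijective ((f.app k).toFunctor.map :
    (x ⟶ y) → ((f.app k).toFunctor.obj x ⟶ (f.app k).toFunctor.obj y))

theorem IsFF.isEquivalence {D : Type} [SmallCategory D] {X Y : D ⥤ Cat.{u, u}} {f : X ⟶ Y}
    (h : IsFF f) {k : D} (hs : ∀ y : Y.obj k, ∃ x, Nonempty ((f.app k).toFunctor.obj x ≅ y)) :
    (f.app k).toFunctor.IsEquivalence := by
  have ff := ((Functor.FullyFaithful.nonempty_iff_map_bijective (f.app k).toFunctor).2 (h k)).some
  have := ff.full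
  have := ff.faithful
  have : (f.app k).toFunctor.EssSurj := ⟨hs⟩
  exact {}

theorem IsFF.homFibMap {X Y : MCat.{u} (m + 1)} {f : X ⟶ Y} (h : IsFF f) (hX : IsHD m (slice X 0))
    (hY : IsHD m (slice Y 0)) (a b : Disc0 X) : IsFF (HomFib.map f hX hY a b) := by
  intro k x y
  have h1 := h _ x.obj y.obj
  refine ⟨fun u v e => ?_, fun u => ?_⟩
  · exact (ObjectProperty.ι _).map_injective (h1.1 (congrArg (ObjectProperty.ι _).map e))
  · obtain ⟨v, hv⟩ := h1.2 u.hom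
    exact ⟨(ObjectProperty.fullyFaithfulι _).preimage v, (ObjectProperty.ι _).map_injective hv⟩

/-! ### Objects as simplices of the truncation, and equivalences from full faithfulness -/

theorem vert_zero_smp : (vert 0 : smp 1 ⟶ smp 0) = src := by
  refine congrArg Quiver.Hom.op ?_
  ext i
  fin_cases i
  rfl

theorem vert_one_smp : (vert 1 : smp 1 ⟶ smp 0) = tgt := by
  refine congrArg Quiver.Hom.op ?_
  ext i
  fin_cases i
  rfl

/-- The simplex of the truncation determined by an object. -/
abbrev simplexCls {A : MCat.{u} (m + 1)} {k : MIdx m} {t : SimplexCategoryᵒᵖ}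
    (x : A.obj ((ins (Fin.last m)).obj (t, k))) :
    ComposableArrows (((trunc m).obj A).obj k) t.unop.len := (toNerve (classes A k)).app t (cls x)

theorem simplexCls_obj_zero {A : MCat.{u} (m + 1)} {k : MIdx m}
    (x : A.obj ((ins (Fin.last m)).obj (smp 1, k))) :
    (simplexCls x).obj 0 = vtxCls ((A.map (lastMap k src)).toFunctor.obj x) := by
  rw [← vert_zero_smp]
  exact toNerve_obj (cls x) 0

theorem simplexCls_obj_one {A : MCat.{u} (m + 1)} {k : MIdx m}
    (x : A.obj ((ins (Fin.last m)).obj (smp 1, k))) :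
    (simplexCls x).obj 1 = vtxCls ((A.map (lastMap k tgt)).toFunctor.obj x) := by
  rw [← vert_one_smp]
  exact toNerve_obj (cls x) 1

theorem HasTrunc.simplexCls_eq_iff {A : MCat.{u} (m + 1)} (h : HasTrunc A) {k : MIdx m}
    {t : SimplexCategoryᵒᵖ} {x y : A.obj ((ins (Fin.last m)).obj (t, k))} :
    simplexCls x = simplexCls y ↔ Nonempty (x ≅ y) :=
  (((h.isNerve k).bijective t).1.eq_iff).trans cls_eq_iff

theorem HasTrunc.exists_simplexCls {A : MCat.{u} (m + 1)} (h : HasTrunc A) {k : MIdx m}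
    {t : SimplexCategoryᵒᵖ} (z : ComposableArrows (((trunc m).obj A).obj k) t.unop.len) :
    ∃ x : A.obj ((ins (Fin.last m)).obj (t, k)), simplexCls x = z := by
  obtain ⟨z, rfl⟩ := ((h.isNerve k).bijective t).2 z
  obtain ⟨x, rfl⟩ := cls_surjective z
  exact ⟨x, rfl⟩

theorem simplexCls_map {W A : MCat.{u} (m + 1)} (q : W ⟶ A) {k : MIdx m} {t : SimplexCategoryᵒᵖ}
    (x : W.obj ((ins (Fin.last m)).obj (t, k))) :
    simplexCls ((q.app _).toFunctor.obj x) =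
      simplexCls x ⋙ (((trunc m).map q).app k).toFunctor :=
  toNerve_naturality (classesMap q k) (cls x)

/-- Only essential surjectivity is at stake. The class of an object `y` of the target is an arrow of
the category $p^{(2)}Y$ between images of points of `X`. Fullness of the truncated functor lifts it
to an arrow of $p^{(2)}X$, which is the class of some `x`; then $f(x)$ and `y` have the same class,
so they are isomorphic. -/
theorem isEquivalence_homFibMap {X Y : MCat.{u} 1} {f : X ⟶ Y} (h : IsFF f) (hXt : HasTrunc X)
    (hYt : HasTrunc Y) (hf : IsNEquiv 0 ((trunc 0).map f)) (hX : IsHD 0 (slice X 0))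
    (hY : IsHD 0 (slice Y 0)) (a b : Disc0 X) : IsNEquiv 0 (HomFib.map f hX hY a b) := by
  intro k
  refine (h.homFibMap hX hY a b).isEquivalence fun y => ?_
  obtain ⟨a, rfl⟩ := gammaObj_zero_surjective (slice X 0) k a
  obtain ⟨b, rfl⟩ := gammaObj_zero_surjective (slice X 0) k b
  -- There is only one direction, so the first direction, used for hom-objects, is also the last,
  -- used for truncation.
  let y' : Y.obj ((ins (Fin.last 0)).obj (smp 1, k)) := y.obj
  have hy := (homFib_mem_iff hY).1 y.property
  have hy1 := gammaObj_zero_iff.1 (hy.1.trans (gammaObj_naturality (sliceMap f 0) a).symm)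
  have hy2 := gammaObj_zero_iff.1 (hy.2.trans (gammaObj_naturality (sliceMap f 0) b).symm)
  let a' : X.obj ((ins (Fin.last 0)).obj (smp 0, k)) := a
  let b' : X.obj ((ins (Fin.last 0)).obj (smp 0, k)) := b
  let F : ((trunc 0).obj X).obj k ⥤ ((trunc 0).obj Y).obj k := (((trunc 0).map f).app k).toFunctor
  have hFE : F.IsEquivalence := hf k
  have e0 : F.obj (vtxCls a') = (simplexCls y').obj 0 :=
    (vtxCls_map f a').trans (((hYt.vtxCls_eq_iff).2 hy1).symm.trans (simplexCls_obj_zero y').symm)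
  have e1 : F.obj (vtxCls b') = (simplexCls y').obj 1 :=
    (vtxCls_map f b').trans (((hYt.vtxCls_eq_iff).2 hy2).symm.trans (simplexCls_obj_one y').symm)
  obtain ⟨g, hg⟩ := F.map_surjective (eqToHom e0 ≫ (simplexCls y').map' 0 1 ≫ eqToHom e1.symm)
  obtain ⟨x, hx⟩ := hXt.exists_simplexCls (t := smp 1) (ComposableArrows.mk₁ g)
  have hx0 : vtxCls ((X.map (lastMap k src)).toFunctor.obj x) = vtxCls a' :=
    (simplexCls_obj_zero x).symm.trans (by rw [hx]; rfl)
  have hx1 : vtxCls ((X.map (lastMap k tgt)).toFunctor.obj x) = vtxCls b' :=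
    (simplexCls_obj_one x).symm.trans (by rw [hx]; rfl)
  have hxy : simplexCls ((f.app _).toFunctor.obj x) = simplexCls y' := by
    rw [simplexCls_map, hx]
    exact ComposableArrows.ext₁ e0 e1 hg
  obtain ⟨e⟩ := hYt.simplexCls_eq_iff.1 hxy
  refine ⟨⟨x, (homFib_mem_iff hX).2 ⟨gammaObj_zero_iff.2 (hXt.vtxCls_eq_iff.1 hx0),
    gammaObj_zero_iff.2 (hXt.vtxCls_eq_iff.1 hx1)⟩⟩, ⟨(ObjectProperty.fullyFaithfulι _).preimageIso e⟩⟩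

/-- A levelwise fully faithful map, whose truncation is an equivalence, is an equivalence. -/
theorem IsFF.isNEquiv : ∀ {m : ℕ} {X Y : MCat.{u} (m + 1)} {f : X ⟶ Y} (_ : IsFF f)
    (_ : IsPreWG (m + 1) X) (_ : IsPreWG (m + 1) Y) (_ : IsNEquiv m ((trunc m).map f)),
    IsNEquiv (m + 1) f
  | 0, X, Y, f, h, hX, hY, hf => ⟨hX.2.1, hY.2.1,
      isEquivalence_homFibMap h hX.2.2 hY.2.2 hf hX.2.1 hY.2.1, hf⟩
  | m + 1, X, Y, f, h, hX, hY, hf => by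
    refine ⟨hX.2.1, hY.2.1, fun a b => ?_, hf⟩
    obtain ⟨hX', hY', hf', -⟩ := hf
    have preX : IsPreWG (m + 1) (HomFib X hX.2.1 a b) :=
      (isClopen_fiberι (D := MIdx (m + 1))).isPreWG (hX.1 (smp 1))
    have preY : IsPreWG (m + 1) (HomFib Y hY.2.1 ((Disc (m + 1)).map (sliceMap f 0) a)
        ((Disc (m + 1)).map (sliceMap f 0) b)) :=
      (isClopen_fiberι (D := MIdx (m + 1))).isPreWG (hY.1 (smp 1))
    -- The induction hypothesis needs the truncation of $f(a,b)$ to be an equivalence. The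
    -- isomorphisms `w` and `v` below identify it with the map of hom-objects induced by the
    -- truncation of `f`.
    refine (h.homFibMap hX.2.1 hY.2.1 a b).isNEquiv preX preY ?_
    have hd : ∀ a : Disc0 X, disc0Trunc Y ((Disc (m + 1)).map (sliceMap f 0) a) =
        (Disc m).map (sliceMap ((trunc (m + 1)).map f) 0) (disc0Trunc X a) := fun a => by
      refine (Functor.map_comp_apply (Disc m) ((trunc m).map (sliceMap f 0))
        (sliceTruncIso Y (smp 0)).hom a).symm.trans (Eq.trans ?_ (Functor.map_comp_apply (Disc m)
          (sliceTruncIso X (smp 0)).hom (sliceMap ((trunc (m + 1)).map f) 0) a))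
      exact congrArg (fun η => (Disc m).map η a) (sliceTruncIso_map f (smp 0))
    obtain ⟨w, _, hw⟩ := exists_trunc_homFib_iso (hX.1 (smp 1)).2.2 hX.2.1 hX' (a := a) (b := b) rfl rfl
    obtain ⟨v, _, hv⟩ := exists_trunc_homFib_iso (hY.1 (smp 1)).2.2 hY.2.1 hY' (hd a) (hd b)
    have sq : (trunc m).map (HomFib.map f hX.2.1 hY.2.1 a b) ≫ v =
        w ≫ HomFib.map ((trunc (m + 1)).map f) hX' hY' _ _ := by
      refine fiber_hom_ext ?_
      change (trunc m).map (HomFib.map f hX.2.1 hY.2.1 a b) ≫ (v ≫ homFibι _ hY' _ _) =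
        w ≫ (HomFib.map ((trunc (m + 1)).map f) hX' hY' _ _ ≫ homFibι _ hY' _ _)
      rw [hv, homFibMap_ι, ← Category.assoc w, hw, ← Category.assoc, ← Functor.map_comp,
        homFibMap_ι, Functor.map_comp, Category.assoc, Category.assoc]
      exact congrArg _ (sliceTruncIso_map f (smp 1))
    refine IsNEquiv.of_arrow (inv w) (inv v) ?_ (hf' _ _)
    rw [IsIso.eq_inv_comp, ← Category.assoc, ← sq, Category.assoc, IsIso.hom_inv_id, Category.comp_id]

end

section

/-! ### Composable chains in a nerve -/

theorem exists_nerve_spine (C : Cat.{u, u}) {r : ℕ} (hr : 1 ≤ r)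
    (z : Fin r → (nerveFunctor.obj C).obj (smp 1))
    (h : ∀ i j : Fin r, (i : ℕ) + 1 = j →
      (nerveFunctor.obj C).map tgt (z i) = (nerveFunctor.obj C).map src (z j)) :
    ∃ G : (nerveFunctor.obj C).obj (smp r), ∀ j, (nerveFunctor.obj C).map (spine r j) G = z j := by
  obtain ⟨r, rfl⟩ : ∃ r', r = r' + 1 := ⟨r - 1, by omega⟩
  -- The vertices are the source of the first arrow followed by the targets of all arrows; the links
  -- say that these are also the sources of the later arrows.
  let p : SSet.Path (nerve C) (r + 1) :=
    { vertex := Fin.cases ((nerveFunctor.obj C).map src (z 0))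
        (fun j => (nerveFunctor.obj C).map tgt (z j))
      arrow := z
      arrow_src := fun i => by
        refine Fin.cases ?_ (fun i => ?_) i
        · rfl
        · exact (h i.castSucc i.succ (by simp)).symm
      arrow_tgt := fun i => rfl }
  refine ⟨(Nerve.strictSegal C).spineToSimplex p, fun j => ?_⟩
  exact (Nerve.strictSegal C).spineToSimplex_arrow j p

theorem IsNerve.exists_spine {K : SSet.{u}} (hK : IsNerve K) {r : ℕ} (hr : 1 ≤ r)
    (z : Fin r → K.obj (smp 1))
    (h : ∀ i j : Fin r, (i : ℕ) + 1 = j → K.map tgt (z i) = K.map src (z j)) :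
    ∃ G : K.obj (smp r), ∀ j, K.map (spine r j) G = z j := by
  obtain ⟨G, hG⟩ := exists_nerve_spine (SSet.hoFunctor.obj K) hr
    (fun i => (toNerve K).app _ (z i)) (fun i j hij => by
      rw [← NatTrans.naturality_apply, ← NatTrans.naturality_apply, h i j hij])
  obtain ⟨G, rfl⟩ := (hK.bijective _).2 G
  refine ⟨G, fun j => (hK.bijective _).1 ?_⟩
  rw [NatTrans.naturality_apply, hG]

/-! ### Invariance of weak globularity under isomorphism -/

theorem const_hom_ext {D : Type} [SmallCategory D] {A : D ⥤ Cat.{u, u}} {S : Type u}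
    {φ ψ : A ⟶ (CategoryTheory.Functor.const _).obj (Cat.of (Discrete S))}
    (h : ∀ d x, (φ.app d).toFunctor.obj x = (ψ.app d).toFunctor.obj x) : φ = ψ :=
  NatTrans.ext (funext fun d => Cat.ext (CategoryTheory.Functor.ext (h d) (fun _ _ _ =>
    (IsDiscrete.subsingleton (C := Discrete S) _ _).elim _ _)))

/-! ### Iterated fibre products over the discretization -/

variable {m : ℕ}

/-- The class in `X_0^d` of an end of `x`. -/
abbrev endClass (X : MCat.{u} (m + 1)) (e : smp 1 ⟶ smp 0) {k : MIdx m} (x : (slice X 1).obj k) :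
    Disc0 X :=
  gammaObj m (slice X 0) k (((((slices m).obj X).map e).app k).toFunctor.obj x)

/-- The iterated fibre product `X_1 ×_{X_0^d} ⋯ ×_{X_0^d} X_1`. -/
abbrev discChains (X : MCat.{u} (m + 1)) (hX : IsHD m (slice X 0)) (r : ℕ) : MCat.{u} m :=
  chains (((slices m).obj X).map src ≫ gamma _ hX) (((slices m).obj X).map tgt ≫ gamma _ hX) r

/-- The projections `X_1 ×_{X_0^d} ⋯ ×_{X_0^d} X_1 ⟶ X_1`. -/
abbrev discChainsProj (X : MCat.{u} (m + 1)) (hX : IsHD m (slice X 0)) {r : ℕ} (i : Fin r) :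
    discChains X hX r ⟶ slice X 1 := chainsProj _ _ i

theorem isClopen_discChainsProj (X : MCat.{u} (m + 1)) (hX : IsHD m (slice X 0)) (r : ℕ) :
    IsClopen (fun i : Fin r => discChainsProj X hX i) := isClopen_chainsProj _ _ r

theorem discChains_link {X : MCat.{u} (m + 1)} {hX : IsHD m (slice X 0)} {r : ℕ} {k : MIdx m}
    (y : (discChains X hX r).obj k) (i j : Fin r) (h : (i : ℕ) + 1 = j) :
    endClass X tgt (((discChainsProj X hX i).app k).toFunctor.obj y) =
      endClass X src (((discChainsProj X hX j).app k).toFunctor.obj y) :=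
  congrArg Discrete.as (y.link i j h)

theorem exists_discChains {X : MCat.{u} (m + 1)} (hX : IsHD m (slice X 0)) {r : ℕ} {k : MIdx m}
    (y : Fin r → (slice X 1).obj k) (h : ∀ i j : Fin r, (i : ℕ) + 1 = j →
      endClass X tgt (y i) = endClass X src (y j)) :
    ∃ c : (discChains X hX r).obj k, ∀ i, ((discChainsProj X hX i).app k).toFunctor.obj c = y i :=
  ⟨⟨y, fun i j hij => congrArg Discrete.mk (h i j hij)⟩, fun _ => rfl⟩

/-- The induced Segal map. -/
abbrev discSegalMap (X : MCat.{u} (m + 1)) (hX : IsHD m (slice X 0)) (r : ℕ) :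
    slice X r ⟶ discChains X hX r := inducedSegalMap ((slices m).obj X) (gamma _ hX) r

theorem discSegalMap_proj (X : MCat.{u} (m + 1)) (hX : IsHD m (slice X 0)) {r : ℕ} (i : Fin r) :
    discSegalMap X hX r ≫ discChainsProj X hX i = ((slices m).obj X).map (spine r i) := rfl

theorem discChains_hom_ext {X : MCat.{u} (m + 1)} {hX : IsHD m (slice X 0)} {r : ℕ} {W : MCat.{u} m}
    {g h : W ⟶ discChains X hX r}
    (e : ∀ i, g ≫ discChainsProj X hX i = h ≫ discChainsProj X hX i) : g = h := chains_hom_ext e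

/-- The fibre product over $Y_0^d$ is itself clopen in the power of $Y_1$, so any clopen family
whose objects are exactly the matched chains is isomorphic to it. -/
theorem IsClopen.exists_discChains_iso {Y : MCat.{u} (m + 1)} (hY : IsHD m (NFold.slice Y 0)) {r : ℕ}
    {W : MCat.{u} m} {q : Fin r → (W ⟶ NFold.slice Y 1)} (h : IsClopen q)
    (h1 : ∀ d (w : W.obj d) (i j : Fin r), (i : ℕ) + 1 = j →
      endClass Y tgt (((q i).app d).toFunctor.obj w) = endClass Y src (((q j).app d).toFunctor.obj w))
    (h2 : ∀ d (y : Fin r → (NFold.slice Y 1).obj d), (∀ i j : Fin r, (i : ℕ) + 1 = j →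
      endClass Y tgt (y i) = endClass Y src (y j)) →
        ∃ w : W.obj d, ∀ i, ((q i).app d).toFunctor.obj w = y i) :
    ∃ w : W ⟶ discChains Y hY r, IsIso w ∧ ∀ i, w ≫ discChainsProj Y hY i = q i := by
  refine ⟨chainsLift q (fun i j hij => const_hom_ext fun d w =>
    congrArg Discrete.mk (h1 d w i j hij)), ?_, fun i => rfl⟩
  exact h.isIso (isClopen_discChainsProj Y hY r) _ (fun i => rfl)
    (fun d y => h2 d _ (discChains_link y))

/-- The Segal and multinerve conditions are inherited through the clopen family of the inverse. The
induced Segal maps of the two diagrams are isomorphic as arrows, and `IsNEquiv.of_arrow` transfers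
the equivalence. -/
theorem isWG_of_iso : ∀ {m : ℕ} {X Y : MCat.{u} m} (_ : X ≅ Y) (_ : IsWG m X), IsWG m Y
  | 0, _, _, _, _ => trivial
  | m + 1, X, Y, α, ⟨h1, ⟨hX, h2⟩, h3, h4, h5⟩ => by
    have hY : IsHD m (slice Y 0) := IsHD.of_iso (((slices m).mapIso α).app (smp 0)).symm hX
    have hc := isClopen_of_isIso α.inv
    refine ⟨fun s => isWG_of_iso (((slices m).mapIso α).app (smp s)) (h1 s), ⟨hY, fun r hr => ?_⟩,
      hc.isSegal h3, hc.hasTrunc h4, isWG_of_iso ((trunc m).mapIso α) h5⟩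
    have hp := (isClopen_discChainsProj X hX r).comp_isIso (sliceMap α.hom 1)
    obtain ⟨w, _, hw⟩ := hp.exists_discChains_iso hY
      (fun d w i j hij => by
        refine (gammaObj_sliceMap α.hom tgt _).trans (Eq.trans ?_ (gammaObj_sliceMap α.hom src _).symm)
        exact congrArg _ (discChains_link w i j hij))
      (fun d y hy => by
        choose x hx using fun i =>
          ((isIso_diagram_iff (sliceMap α.hom 1)).1 inferInstance d).1.2 (y i)
        obtain rfl : _ = y := funext hx
        obtain ⟨c, hc⟩ := exists_discChains hX x (fun i j hij =>
          disc_map_injective (sliceMap α.hom 0) ((gammaObj_sliceMap α.hom tgt (x i)).symm.trans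
            ((hy i j hij).trans (gammaObj_sliceMap α.hom src (x j)))))
        exact ⟨c, fun i => congrArg _ (hc i)⟩)
    have sq : discSegalMap X hX r ≫ w = sliceMap α.hom r ≫ discSegalMap Y hY r := by
      refine discChains_hom_ext fun i => ?_
      rw [Category.assoc, hw, Category.assoc, discSegalMap_proj, ← Category.assoc, discSegalMap_proj]
      exact ((slices m).map α.hom).naturality (spine r i)
    exact IsNEquiv.of_arrow (sliceMap α.hom r) w sq (h2 r hr)

/-! ### A criterion for homotopical discreteness -/

/-- All Segal maps, in all directions, are isomorphisms. -/
def IsSegalAll : ∀ m : ℕ, MCat.{u} m → Prop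
  | 0, _ => True
  | m + 1, X => (∀ s, IsSegalAll m (slice X s)) ∧ IsSegal ((slices m).obj X)

/-- Slices keep the levelwise hypotheses, and the truncation of $Z_s$ is $(pZ)_s$, which is
homotopically discrete; this closes the induction. -/
theorem isHD_succ : ∀ {m : ℕ} {Z : MCat.{u} (m + 1)} (_ : ∀ k, IsEqRel (Z.obj k))
    (_ : IsSegalAll (m + 1) Z) (_ : HasTrunc Z) (_ : IsHD m ((trunc m).obj Z)), IsHD (m + 1) Z
  | 0, _, h1, h2, h3, h4 => ⟨fun _ _ => h1 _, h2.2, h3, h4⟩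
  | _ + 1, Z, h1, h2, h3, h4 => ⟨fun s => isHD_succ (fun _ => h1 _)
      (slices_smp (P := IsSegalAll _) h2.1 s) (h3.slice s) (IsHD.of_iso (sliceTruncIso Z s) (h4.1 s)),
      h2.2, h3, h4⟩

/-! ### A criterion for weak globularity -/

/-- The functors `X_r → X_1` given by the edges of the spine are jointly fully faithful. -/
def SpineFF (X : MCat.{u} (m + 1)) (r : ℕ) : Prop :=
  ∀ k, ∀ x y : (slice X r).obj k, Function.Bijective (fun (f : x ⟶ y) (j : Fin r) =>
    ((((slices m).obj X).map (spine r j)).app k).toFunctor.map f)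

/-- A levelwise condition which, given a weakly globular truncation, implies weak globularity. -/
def IsLevelwiseWG : ∀ m : ℕ, MCat.{u} m → Prop
  | 0, _ => True
  | m + 1, X => (∀ s, IsLevelwiseWG m (slice X s)) ∧ (∀ k, IsEqRel ((slice X 0).obj k)) ∧
      IsSegal ((slices m).obj X) ∧ ∀ r, 2 ≤ r → SpineFF X r

theorem IsLevelwiseWG.isSegalAll : ∀ {m : ℕ} {X : MCat.{u} m} (_ : IsLevelwiseWG m X),
    IsSegalAll m X
  | 0, _, _ => trivial
  | _ + 1, _, h => ⟨fun s => (h.1 s).isSegalAll, h.2.2.1⟩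

/-- The induced Segal map followed by the projections gives the spine maps. Both the projections and
the spine maps are jointly fully faithful, so the induced Segal map is fully faithful. -/
theorem SpineFF.isFF {X : MCat.{u} (m + 1)} {r : ℕ} (h : SpineFF X r) (hX : IsHD m (slice X 0)) :
    IsFF (discSegalMap X hX r) := fun k x y =>
  (Function.Bijective.of_comp_iff' (((isClopen_discChainsProj X hX r).emb k).map_bijective _ _) _).1
    (h k x y)

/-- A chain matched over $X_0^d$ is a string of composable arrows in the category $p^{(2)}X$. The
simplex it spans is the class of some `x` in $X_r$, whose spine edges are isomorphic to the given
objects; hence `x` is sent to an object isomorphic to the chain. -/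
theorem isNEquiv_discSegalMap_zero {X : MCat.{u} 1} {r : ℕ} (hr : 2 ≤ r) (h : SpineFF X r)
    (hX : IsHD 0 (slice X 0)) (hT : HasTrunc X) : IsNEquiv 0 (discSegalMap X hX r) := by
  intro k
  refine (h.isFF hX).isEquivalence fun y => ?_
  let y' : Fin r → X.obj ((ins (Fin.last 0)).obj (smp 1, k)) := y.obj
  obtain ⟨z, hz⟩ := (hT.isNerve k).exists_spine (r := r) (by omega) (fun j => cls (y' j))
    (fun i j hij => cls_eq_iff.2 (gammaObj_zero_iff.1 (discChains_link y i j hij)))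
  obtain ⟨x, rfl⟩ := cls_surjective z
  exact ⟨x, ((isClopen_discChainsProj X hX r).emb k).nonempty_iso fun j => cls_eq_iff.1 (hz j)⟩

/-- Truncation commutes with fibre products over $X_0^d$: the truncated projections are a clopen
family in $(pX)_1$, and its objects are the matched chains. -/
theorem exists_trunc_discChains_iso {X : MCat.{u} (m + 2)} (h1 : HasTrunc (slice X 1))
    (hX : IsHD (m + 1) (slice X 0)) (hX' : IsHD m (slice ((trunc (m + 1)).obj X) 0)) (r : ℕ) :
    ∃ w : (trunc m).obj (discChains X hX r) ⟶ discChains ((trunc (m + 1)).obj X) hX' r, IsIso w ∧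
      ∀ i, w ≫ discChainsProj _ hX' i =
        (trunc m).map (discChainsProj X hX i) ≫ (sliceTruncIso X (smp 1)).hom := by
  have hp := isClopen_discChainsProj X hX r
  refine ((hp.trunc h1).comp_isIso (sliceTruncIso X (smp 1)).hom).exists_discChains_iso hX'
    (fun k v i j hij => ?_) (fun k y hy => ?_)
  · obtain ⟨z, rfl⟩ := (hp.hasTrunc h1).exists_vtxCls v
    have key : ∀ (e : smp 1 ⟶ smp 0) (i : Fin r), endClass ((trunc (m + 1)).obj X) e
        (((sliceTruncIso X (smp 1)).hom.app k).toFunctor.obj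
          ((((trunc m).map (discChainsProj X hX i)).app k).toFunctor.obj (vtxCls z))) =
        disc0Trunc X (endClass X e (((discChainsProj X hX i).app _).toFunctor.obj z)) := fun e i => by
      rw [vtxCls_map]
      exact gammaObj_sliceTruncIso X e _
    exact (key tgt i).trans ((congrArg _ (discChains_link z i j hij)).trans (key src j).symm)
  · choose v hv using fun i =>
      ((isIso_diagram_iff (sliceTruncIso X (smp 1)).hom).1 inferInstance k).1.2 (y i)
    obtain rfl : _ = y := funext hv
    choose x hx using fun i => h1.exists_vtxCls (v i)
    obtain rfl : _ = v := funext hx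
    obtain ⟨c, hc⟩ := exists_discChains hX x (fun i j hij => disc0Trunc_injective X
      ((gammaObj_sliceTruncIso X tgt (x i)).symm.trans
        ((hy i j hij).trans (gammaObj_sliceTruncIso X src (x j)))))
    refine ⟨vtxCls c, fun i => congrArg ((sliceTruncIso X (smp 1)).hom.app k).toFunctor.obj ?_⟩
    exact (vtxCls_map _ _).trans (congrArg vtxCls (hc i))

/-- The map is levelwise fully faithful, and its truncation is isomorphic to the induced Segal map
of the truncation, which is an equivalence because the truncation is weakly globular. -/
theorem isNEquiv_discSegalMap_succ {X : MCat.{u} (m + 2)} {r : ℕ} (hr : 2 ≤ r) (h : SpineFF X r)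
    (hX : IsHD (m + 1) (slice X 0)) (hs : ∀ s, IsPreWG (m + 1) (slice X s))
    (hW : IsWG (m + 1) ((trunc (m + 1)).obj X)) : IsNEquiv (m + 1) (discSegalMap X hX r) := by
  obtain ⟨hX', hE⟩ := hW.2.1
  refine (h.isFF hX).isNEquiv (hs r) ((isClopen_discChainsProj X hX r).isPreWG (hs 1)) ?_
  obtain ⟨w, _, hw⟩ := exists_trunc_discChains_iso (hs 1).2.2 hX hX' r
  have sq : (trunc m).map (discSegalMap X hX r) ≫ w =
      (sliceTruncIso X (smp r)).hom ≫ discSegalMap ((trunc (m + 1)).obj X) hX' r := by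
    refine discChains_hom_ext fun i => ?_
    rw [Category.assoc, hw, ← Category.assoc, ← Functor.map_comp, discSegalMap_proj, Category.assoc,
      discSegalMap_proj]
    exact sliceTruncIso_naturality X (spine r i)
  refine IsNEquiv.of_arrow (inv (sliceTruncIso X (smp r)).hom) (inv w) ?_ (hE r hr)
  rw [IsIso.eq_inv_comp, ← Category.assoc, ← sq, Category.assoc, IsIso.hom_inv_id, Category.comp_id]

/-- The truncations of the slices are the slices of the truncation, hence weakly globular, so the
induction applies to the slices. Only the truncation has to be known to be weakly globular; the
levelwise data supply the rest. -/
theorem IsLevelwiseWG.isWG : ∀ {m : ℕ} {X : MCat.{u} (m + 1)} (_ : IsLevelwiseWG (m + 1) X)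
    (_ : HasTrunc X) (_ : IsWG m ((trunc m).obj X)), IsWG (m + 1) X
  | 0, X, h, hT, hW => ⟨fun _ => trivial, ⟨h.2.1, fun r hr =>
      isNEquiv_discSegalMap_zero hr (h.2.2.2 r hr) h.2.1 hT⟩, h.2.2.1, hT, hW⟩
  | m + 1, X, h, hT, hW => by
    have hs : ∀ s, IsWG (m + 1) (slice X s) := fun s => (h.1 s).isWG (hT.slice _)
      (isWG_of_iso (sliceTruncIso X (smp s)).symm (hW.1 s))
    have hX : IsHD (m + 1) (slice X 0) := isHD_succ h.2.1 (h.1 0).isSegalAll (hT.slice _)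
      (IsHD.of_iso (sliceTruncIso X (smp 0)) hW.2.1.1)
    exact ⟨hs, ⟨hX, fun r hr => isNEquiv_discSegalMap_succ hr (h.2.2.2 r hr) hX
      (fun s => (hs s).isPreWG) hW⟩, h.2.2.1, hT, hW⟩

end

section

/-! ### Lines of multi-indices -/

/-- The spine edges cover the vertices of $[r]$, except for $r=0$, where there are no edges. -/
theorem spine_hom_ext {s : SimplexCategoryᵒᵖ} {r : ℕ} (hr : 1 ≤ r) {f g : s ⟶ smp r}
    (h : ∀ j, f ≫ spine r j = g ≫ spine r j) : f = g := by
  obtain ⟨r, rfl⟩ : ∃ r', r = r' + 1 := ⟨r - 1, by omega⟩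
  refine Quiver.Hom.unop_inj (SimplexCategory.Hom.ext _ _ (OrderHom.ext _ _ (funext fun v => ?_)))
  have h' : ∀ j (w : Fin 2), f.unop.toOrderHom ((SimplexCategory.mkOfSucc j).toOrderHom w) =
      g.unop.toOrderHom ((SimplexCategory.mkOfSucc j).toOrderHom w) := fun j w =>
    congrArg (fun q : s ⟶ smp 1 => q.unop.toOrderHom w) (h j)
  refine Fin.cases (h' 0 0) (fun j => h' j 1) v

theorem exists_spine_hom {s : SimplexCategoryᵒᵖ} {r : ℕ} (hr : 1 ≤ r) (g : Fin r → (s ⟶ smp 1))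
    (h : ∀ i j : Fin r, (i : ℕ) + 1 = j → g i ≫ tgt = g j ≫ src) :
    ∃ f : s ⟶ smp r, ∀ j, f ≫ spine r j = g j := by
  obtain ⟨r, rfl⟩ : ∃ r', r = r' + 1 := ⟨r - 1, by omega⟩
  have h' : ∀ i j : Fin (r + 1), (i : ℕ) + 1 = j →
      (g i).unop.toOrderHom (1 : Fin 2) = (g j).unop.toOrderHom (0 : Fin 2) := fun i j hij =>
    congrArg (fun q : s ⟶ smp 0 => q.unop.toOrderHom (0 : Fin 1)) (h i j hij)
  -- The vertices are the initial end of the first edge and then the final end of each edge. The map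
  -- is monotone because each edge is.
  let v : Fin (r + 2) → Fin (s.unop.len + 1) :=
    Fin.cases ((g 0).unop.toOrderHom (0 : Fin 2)) (fun j => (g j).unop.toOrderHom (1 : Fin 2))
  have hv0 : ∀ j : Fin (r + 1), v j.castSucc = (g j).unop.toOrderHom (0 : Fin 2) := fun j => by
    refine Fin.cases rfl (fun j => ?_) j
    exact h' j.castSucc j.succ (by simp)
  have hv : Monotone v := Fin.monotone_iff_le_succ.2 fun j => by
    rw [hv0]
    exact (g j).unop.toOrderHom.monotone (Fin.zero_le _)
  let f : SimplexCategory.mk (r + 1) ⟶ s.unop := SimplexCategory.Hom.mk ⟨v, hv⟩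
  refine ⟨f.op, fun j => ?_⟩
  refine Quiver.Hom.unop_inj (SimplexCategory.Hom.ext _ _ (OrderHom.ext _ _ (funext fun w => ?_)))
  change v ((SimplexCategory.mkOfSucc j).toOrderHom w) = (g j).unop.toOrderHom w
  refine Fin.cases (hv0 j) (fun w => ?_) w
  obtain rfl : w = 0 := Subsingleton.elim _ _
  rfl

variable {m : ℕ}

theorem ins_split (i : Fin (m + 1)) : ins i ⋙ split i = 𝟭 _ := by
  refine CategoryTheory.Functor.ext (split_obj_ins i) (fun p q f => Prod.ext ?_ (funext fun j => ?_))
  · have := Functor.congr_hom ((ins_eval i i).trans (Fin.insertNth_apply_same _ _ _)) f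
    refine this.trans ?_
    simp
    rfl
  · have := Functor.congr_hom ((ins_eval i _).trans (Fin.insertNth_apply_succAbove _ _ _ j)) f
    refine this.trans ?_
    simp [Functor.eqToHom_proj]
    rfl

theorem ins_fullyFaithful (i : Fin (m + 1)) : Nonempty (ins (m := m) i).FullyFaithful := by
  let e : SimplexCategoryᵒᵖ × MIdx m ≌ MIdx (m + 1) :=
    CategoryTheory.Equivalence.mk (ins i) (split i) (eqToIso (ins_split i).symm) (eqToIso (split_ins i))
  exact ⟨Functor.FullyFaithful.ofFullyFaithful e.functor⟩

theorem dir_hom_ext {i : Fin (m + 1)} {k : MIdx m} {p : MIdx (m + 1)} {r : ℕ} (hr : 1 ≤ r)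
    {f g : p ⟶ (ins i).obj (smp r, k)}
    (h : ∀ j, f ≫ dir i k (spine r j) = g ≫ dir i k (spine r j)) : f = g := by
  obtain ⟨ff⟩ := ins_fullyFaithful i
  obtain ⟨p, rfl⟩ : ∃ q, (ins i).obj q = p := ⟨_, Functor.congr_obj (split_ins i) p⟩
  obtain ⟨f, rfl⟩ := ff.map_surjective f
  obtain ⟨g, rfl⟩ := ff.map_surjective g
  have h' : ∀ j, f ≫ CategoryTheory.Prod.mkHom (spine r j) (𝟙 k) =
      g ≫ CategoryTheory.Prod.mkHom (spine r j) (𝟙 k) := fun j => ff.map_injective (by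
    simpa only [Functor.map_comp] using! h j)
  congr 1
  refine Prod.ext (spine_hom_ext hr fun j => congrArg Prod.fst (h' j)) ?_
  have := congrArg Prod.snd (h' ⟨0, hr⟩)
  simpa using this

theorem exists_dir_hom {i : Fin (m + 1)} {k : MIdx m} {p : MIdx (m + 1)} {r : ℕ} (hr : 1 ≤ r)
    (g : Fin r → (p ⟶ (ins i).obj (smp 1, k)))
    (h : ∀ a b : Fin r, (a : ℕ) + 1 = b → g a ≫ dir i k tgt = g b ≫ dir i k src) :
    ∃ f : p ⟶ (ins i).obj (smp r, k), ∀ j, f ≫ dir i k (spine r j) = g j := by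
  obtain ⟨ff⟩ := ins_fullyFaithful i
  obtain ⟨p, rfl⟩ : ∃ q, (ins i).obj q = p := ⟨_, Functor.congr_obj (split_ins i) p⟩
  choose g' hg using fun j => ff.map_surjective (g j)
  obtain rfl : _ = g := funext hg
  have h' : ∀ a b : Fin r, (a : ℕ) + 1 = b → g' a ≫ CategoryTheory.Prod.mkHom tgt (𝟙 k) =
      g' b ≫ CategoryTheory.Prod.mkHom src (𝟙 k) := fun a b hab => ff.map_injective (by
    simpa only [Functor.map_comp] using! h a b hab)
  -- `src` and `tgt` act only in direction `i`, so the matching conditions force all the maps to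
  -- have the same components in the other directions.
  have h2 : ∀ (n : ℕ) (hn : n < r), (g' ⟨n, hn⟩).2 = (g' ⟨0, hr⟩).2 := by
    intro n
    induction n with
    | zero => intro _; rfl
    | succ n ih =>
      intro hn
      rw [← ih (by omega)]
      have := congrArg Prod.snd (h' ⟨n, by omega⟩ ⟨n + 1, hn⟩ rfl)
      simpa using this.symm
  obtain ⟨f, hf⟩ := exists_spine_hom hr (fun j => (g' j).1)
    (fun a b hab => congrArg Prod.fst (h' a b hab))
  refine ⟨(ins i).map (CategoryTheory.Prod.mkHom f (g' ⟨0, hr⟩).2 : p ⟶ (smp r, k)), fun j => ?_⟩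
  refine ((ins i).map_comp _ _).symm.trans (congrArg (ins i).map ?_)
  refine Prod.ext (hf j) ?_
  simpa using (h2 j j.2).symm

/-- The line in direction `i` through the multi-indices given by `k` in the other directions. -/
abbrev line (i : Fin (m + 1)) (k : MIdx m) : SimplexCategoryᵒᵖ ⥤ MIdx (m + 1) :=
  Prod.sectL _ k ⋙ ins i

/-- A line in a slice of `X` is a line of `X` in the next direction; this drives the induction in
`isLevelwiseWG_of_lines`. -/
theorem line_cons (i : Fin (m + 1)) (k : MIdx m) (s : SimplexCategoryᵒᵖ) :
    line i k ⋙ Prod.sectR s _ ⋙ ins 0 = line i.succ ((ins 0).obj (s, k)) := by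
  refine Functor.pi_ext _ _ fun j => ?_
  refine Fin.cases ?_ (fun j => ?_) j
  · have h : ins i.succ ⋙ Pi.eval _ 0 = CategoryTheory.Prod.snd _ _ ⋙ Pi.eval _ (0 : Fin (m + 1)) :=
      (ins_eval i.succ (i.succ.succAbove 0)).trans (Fin.insertNth_apply_succAbove _ _ _ 0)
    change line i k ⋙ Prod.sectR s _ ⋙ (ins 0 ⋙ Pi.eval _ 0) =
      Prod.sectL _ _ ⋙ (ins i.succ ⋙ Pi.eval _ 0)
    rw [ins_zero_eval_zero, h]
    exact congrArg (fun a => (CategoryTheory.Functor.const SimplexCategoryᵒᵖ).obj a)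
      (Functor.congr_obj (ins_zero_eval_zero (m := m)) (s, k)).symm
  · change Prod.sectL _ k ⋙ ins i ⋙ Prod.sectR s _ ⋙ (ins 0 ⋙ Pi.eval _ j.succ) =
      Prod.sectL _ _ ⋙ (ins i.succ ⋙ Pi.eval _ j.succ)
    rw [ins_zero_eval_succ]
    change Prod.sectL _ k ⋙ (ins i ⋙ Pi.eval _ j) = _
    refine Fin.succAboveCases i ?_ (fun j => ?_) j
    · rw [ins_eval, ins_eval, Fin.insertNth_apply_same, Fin.insertNth_apply_same]
      rfl
    · rw [← Fin.succ_succAbove_succ, ins_eval, ins_eval, Fin.insertNth_apply_succAbove,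
        Fin.insertNth_apply_succAbove]
      exact congrArg (fun a => (CategoryTheory.Functor.const SimplexCategoryᵒᵖ).obj a)
        (Functor.congr_obj (ins_zero_eval_succ j) (s, k)).symm

/-- A simplicial category with the Segal property, with an equivalence relation in degree `0`, for
which the edges of the spines are jointly fully faithful. -/
structure IsLineWG (G : SimplexCategoryᵒᵖ ⥤ Cat.{u, u}) : Prop where
  isEqRel : IsEqRel (G.obj (smp 0))
  isChainIso : ∀ r, 2 ≤ r → IsChainIso (G.map src).toFunctor (G.map tgt).toFunctor
    (fun j : Fin r => (G.map (spine r j)).toFunctor)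
  map_bijective : ∀ r, 2 ≤ r → ∀ x y : G.obj (smp r), Function.Bijective
    (fun (f : x ⟶ y) (j : Fin r) => (G.map (spine r j)).toFunctor.map f)

theorem isLevelwiseWG_of_lines : ∀ {m : ℕ} {X : MCat.{u} (m + 1)}
    (_ : ∀ i k, IsLineWG (line i k ⋙ X)), IsLevelwiseWG (m + 1) X
  | m, X, h => by
    refine ⟨fun s => ?_, fun k => (h 0 k).isEqRel, (isSegal_iff _).2 fun r hr k =>
      (h 0 k).isChainIso r hr, fun r hr k => (h 0 k).map_bijective r hr⟩
    cases m with
    | zero => trivial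
    | succ m =>
      refine isLevelwiseWG_of_lines fun i k => ?_
      have := h i.succ ((ins 0).obj (smp s, k))
      rw [← line_cons] at this
      exact this

end

/-! ### Strictification: equivalence with the pseudo-functor and isomorphism classes -/

section

theorem heq_of_isDiscrete {C : Type u} [SmallCategory C] [IsDiscrete C] {x y x' y' : C}
    (f : x ⟶ y) (g : x' ⟶ y') (hx : x = x') (hy : y = y') : f ≍ g := by
  subst hx hy
  exact heq_of_eq (Subsingleton.elim _ _)

theorem conj_bijective {C : Type*} [Category* C] {x y x' y' : C} (α : x ≅ x') (β : y ≅ y') :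
    Function.Bijective (fun f : x' ⟶ y' => α.hom ≫ f ≫ β.inv) :=
  ⟨fun _ _ e => (cancel_mono _).1 ((cancel_epi _).1 e), fun g => ⟨α.inv ≫ g ≫ β.hom, by simp⟩⟩

namespace Ps

variable {I : Type} [SmallCategory I] (F : Ps.{u} I)

/-- The functor `g_k` is fully faithful. -/
def ofStObjFullyFaithful (k : I) : (F.ofStObj k).FullyFaithful := fullyFaithfulInducedFunctor _

/-- The summand indexed by the identity of `k` makes $g_k$ essentially surjective, through the unit
constraint $H(\mathrm{id})y\cong y$. -/
theorem ofStObj_isEquivalence (k : I) : (F.ofStObj k).IsEquivalence where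
  faithful := (F.ofStObjFullyFaithful k).faithful
  full := (F.ofStObjFullyFaithful k).full
  essSurj := ⟨fun y => ⟨(⟨⟨k, 𝟙 k⟩, y⟩ : F.TU k), ⟨F.idIso y⟩⟩⟩

/-- The isomorphism classes of objects are not changed by strictification. -/
theorem pbar_st_iso : Nonempty (F.st ⋙ isomorphismClasses ≅ F.pbar) := by
  let α : F.st ⋙ isomorphismClasses ⟶ F.pbar :=
    { app k := isomorphismClasses.map (F.ofStObj k).toCatHom
      naturality k l f := by
        ext x
        induction x using Quotient.inductionOn with
        | h x => exact isoClasses_iso ((F.counitIso f).app x) }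
  have (k : I) : IsIso (α.app k) := by
    rw [isIso_iff_bijective]
    constructor
    · intro x y
      induction x using Quotient.inductionOn with | h x => ?_
      induction y using Quotient.inductionOn with | h y => ?_
      intro h
      obtain ⟨e⟩ := Quotient.exact (s := isIsomorphicSetoid _) h
      exact Quotient.sound (s := isIsomorphicSetoid _) ⟨(F.ofStObjFullyFaithful k).preimageIso e⟩
    · intro y
      induction y using Quotient.inductionOn with | h y => ?_
      exact ⟨Quotient.mk (isIsomorphicSetoid _) (⟨⟨k, 𝟙 k⟩, y⟩ : F.TU k), isoClasses_iso (F.idIso y)⟩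
  have := NatIso.isIso_of_isIso_app α
  exact ⟨asIso α⟩

variable {F}

theorem tu_mk_inj {k p : I} {f g : p ⟶ k} {a b : F.ob p}
    (h : (⟨⟨p, f⟩, a⟩ : F.TU k) = ⟨⟨p, g⟩, b⟩) : f = g ∧ a = b := by
  have h1 := Sigma.mk.inj h
  obtain rfl := eq_of_heq (Sigma.mk.inj h1.1).2
  exact ⟨rfl, eq_of_heq h1.2⟩

/-- In a category fully faithful over a discrete one, an arrow between two objects exists exactly
when their images are equal, and it is unique. Distinct triples may have equal images, so
discreteness itself can be lost. -/
theorem isEqRel_stObj (k : I) (h : IsDiscrete (F.ob k)) : IsEqRel (F.StObj k) :=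
  ⟨fun _ _ => ⟨fun _ _ => InducedCategory.hom_ext (Subsingleton.elim _ _)⟩, fun _ _ ⟨f⟩ =>
    ⟨InducedCategory.homMk (eqToHom (obj_ext_of_isDiscrete f.hom).symm)⟩⟩

end Ps

/-! ### The strictification of a Segalic pseudo-functor is weakly globular -/

namespace IsSegalic

variable {m : ℕ} {H : Ps.{u} (MIdx (m + 1))}

theorem isChainIso (hH : IsSegalic H) (i : Fin (m + 1)) (k : MIdx m) {r : ℕ} (hr : 2 ≤ r) :
    IsChainIso (H.mp (dir i k src)) (H.mp (dir i k tgt)) (fun j : Fin r => H.mp (dir i k (spine r j))) :=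
  (isIso_chainLift_iff _ _).1 (hH.segal i k r hr)

/-- Arrows of the strictification are arrows of `H` conjugated by composition constraints, and
conjugation is a bijection. So the claim reduces to the Segal isomorphism of `H`, where the matching
condition on arrows is vacuous because $H_{k(0,i)}$ is discrete. -/
theorem stMap_bijective (hH : IsSegalic H) (i : Fin (m + 1)) (k : MIdx m) {r : ℕ} (hr : 2 ≤ r)
    (x y : H.StObj ((ins i).obj (smp r, k))) : Function.Bijective
      (fun (f : x ⟶ y) (j : Fin r) => (H.stMap (dir i k (spine r j))).map f) := by
  have hd := hH.discrete i k
  constructor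
  · intro f g e
    refine InducedCategory.hom_ext ((hH.isChainIso i k hr).map_injective _ _ _ _ fun j => ?_)
    exact (conj_bijective (H.compIso x.1.2 (dir i k (spine r j)) x.2) (H.compIso y.1.2 _ y.2)).1
      (congrArg InducedCategory.Hom.hom (congrFun e j))
  · intro c
    have link : ∀ (a b : Fin r) (_ : (a : ℕ) + 1 = b) (z : H.ob ((ins i).obj (smp r, k))),
        (H.mp (dir i k tgt)).obj ((H.mp (dir i k (spine r a))).obj z) =
          (H.mp (dir i k src)).obj ((H.mp (dir i k (spine r b))).obj z) := fun a b hab z =>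
      ((H.segalMap i k hd r).obj z).link a b hab
    choose a ha using fun j => (conj_bijective (H.compIso x.1.2 (dir i k (spine r j)) x.2)
      (H.compIso y.1.2 _ y.2)).2 (c j).hom
    obtain ⟨f, hf⟩ := (hH.isChainIso i k hr).exists_map ((H.mp x.1.2).obj x.2) ((H.mp y.1.2).obj y.2) a
      (fun a b hab => heq_of_isDiscrete _ _ (link a b hab _) (link a b hab _))
    refine ⟨InducedCategory.homMk f, funext fun j => InducedCategory.hom_ext ((ha j).symm.trans ?_).symm⟩
    rw [← hf j]
    rfl

/-- On objects the Segal property comes from the index category, since the structure maps only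
compose with `f` in $(p,f,a)$ and maps into $[r]$ are matched families of maps into $[1]$. On arrows
it follows from `stMap_bijective`; the matching condition there is automatic. -/
theorem isChainIso_st (hH : IsSegalic H) (i : Fin (m + 1)) (k : MIdx m) {r : ℕ} (hr : 2 ≤ r) :
    IsChainIso (H.stMap (dir i k src)) (H.stMap (dir i k tgt))
      (fun j : Fin r => H.stMap (dir i k (spine r j))) where
  obj_injective := by
    rintro ⟨⟨p, f⟩, a⟩ ⟨⟨q, g⟩, b⟩ h
    obtain rfl : p = q := congrArg (fun z : H.TU _ => z.1.1) (h ⟨0, by omega⟩)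
    obtain rfl : a = b := (Ps.tu_mk_inj (h ⟨0, by omega⟩)).2
    obtain rfl : f = g := dir_hom_ext (by omega) fun j => (Ps.tu_mk_inj (h j)).1
    rfl
  exists_obj c hc := by
    obtain ⟨⟨⟨p, f₀⟩, a⟩, h₀⟩ : ∃ z, c ⟨0, by omega⟩ = z := ⟨_, rfl⟩
    -- Equal ends force equal `p` and equal `a`, so these are constant along the chain and only the
    -- index maps `f` vary.
    have key : ∀ (n : ℕ) (hn : n < r), ∃ f, c ⟨n, hn⟩ = (⟨⟨p, f⟩, a⟩ : H.TU _) := by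
      intro n
      induction n with
      | zero => exact fun _ => ⟨f₀, h₀⟩
      | succ n ih =>
        intro hn
        obtain ⟨f, hf⟩ := ih (by omega)
        have := hc ⟨n, by omega⟩ ⟨n + 1, hn⟩ rfl
        rw [hf] at this
        generalize c ⟨n + 1, hn⟩ = d at this
        obtain ⟨⟨q, g⟩, b⟩ := d
        obtain rfl : p = q := congrArg (fun z : H.TU _ => z.1.1) this
        obtain rfl : a = b := (Ps.tu_mk_inj this).2
        exact ⟨g, rfl⟩
    choose f hf using fun j : Fin r => key j j.2
    obtain ⟨g, hg⟩ := exists_dir_hom (i := i) (k := k) (r := r) (by omega) f fun a b hab => by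
      have := hc a b hab
      rw [hf a, hf b] at this
      exact (Ps.tu_mk_inj this).1
    refine ⟨(⟨⟨p, g⟩, a⟩ : H.TU _), fun j => ?_⟩
    refine Eq.trans ?_ (hf j).symm
    rw [← hg j]
    rfl
  map_injective x y f g h := (hH.stMap_bijective i k hr x y).1 (funext h)
  exists_map x y a _ := by
    obtain ⟨f, hf⟩ := (hH.stMap_bijective i k hr x y).2 a
    exact ⟨f, congrFun hf⟩

theorem isLineWG (hH : IsSegalic H) (i : Fin (m + 1)) (k : MIdx m) : IsLineWG (line i k ⋙ H.st) :=
  ⟨Ps.isEqRel_stObj _ (hH.discrete i k), fun _ hr => hH.isChainIso_st i k hr,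
    fun _ hr => hH.stMap_bijective i k hr⟩

theorem isWG_st (hH : IsSegalic H) : IsWG (m + 1) H.st := by
  obtain ⟨e⟩ : Nonempty ((NFold.pbar (m + 1)).obj H.st ≅ H.pbar) := H.pbar_st_iso
  have h := hH.multinerve
  refine (isLevelwiseWG_of_lines hH.isLineWG).isWG ?_
    (isWG_of_iso ((toCat m).mapIso e.symm) hH.wg)
  obtain ⟨A, ⟨e'⟩⟩ := h
  exact ⟨A, ⟨(lastDir m).mapIso e ≪≫ e'⟩⟩

end IsSegalic

end

end NFold

end

/-! ### The restricted functor and the levelwise equivalences -/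

theorem mainTheorem1 (m : ℕ) :
    ∃ L : NFold.SegPs.{u} m ⥤ NFold.CatWG.{u} (m + 1),
      L ⋙ ObjectProperty.ι (NFold.IsWG.{u} (m + 1)) =
        ObjectProperty.ι (fun H : NFold.Ps.{u} (NFold.MIdx (m + 1)) => NFold.IsSegalic H) ⋙
          NFold.Ps.St (NFold.MIdx (m + 1)) ∧
      ∀ (H : NFold.SegPs.{u} m) (k : NFold.MIdx (m + 1)),
        (NFold.Ps.app (NFold.Ps.counit H.obj) k).IsEquivalence :=
  -- Weak globularity is a property of objects of a full subcategory, so the restriction is a lift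
  -- of `St`, and its composite with the inclusion agrees with `St` definitionally.
  ⟨ObjectProperty.lift _ (ObjectProperty.ι _ ⋙ NFold.Ps.St _) fun H => H.property.isWG_st,
    rfl, fun H k => H.obj.ofStObj_isEquivalence k⟩
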